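/- **Setting.** Let $\tau>0$, let $\eta$ be a finite signed Borel measure on $[0,\tau]$ (extended by $0$ to $\mathbb R$), let $b:\mathbb R\to\mathbb R$ be of class $C^2$ with $b'$ and $b''$ bounded, and let $x_0:[-\tau,0]\to\mathbb R$ be (deterministic and) of class $C^1$. Let $H\in(1/2,1)$ and let $Z=(Z_t)_{t\ge 0}$ be a continuous fractional Brownian motion with Hurst index $H$ on a probability space $(\Omega,\mathcal F,\mathbb P)$, i.e. a centred Gaussian process with a.s. continuous paths and $\mathbb E(Z_sZ_t)=\frac c2\left(s^{2H}+t^{2H}-|t-s|^{2H}\right)$ for some $c>0$. Let $X=(X_t)_{t\ge-\tau}$ be the continuous process that satisfies, almost surely, $$X_t=x_0(0)+\int_0^t\int_{[0,\tau]}b(X_{s-r})\,\eta(\mathrm dr)\,\mathrm ds+Z_t\quad(t\ge 0),\qquad X_t=x_0(t)\quad(-\tau\le t<0).$$ For $n\ge1$ put $\Delta_n=\tau/n$, $\mathcal T(s)=\lfloor s/\Delta_n\rfloor\Delta_n$, and let $X^n$ be the Euler scheme $$X^n_t=x_0(0)+\int_0^t\int_{[0,\tau]}b(X^n_{\mathcal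 T(s)-\mathcal T(r)})\,\eta(\mathrm dr)\,\mathrm ds+Z_t\quad(t\ge 0),\qquad X^n_t=x_0(t)\quad(-\tau\le t<0),$$ with error $U^n_t=X_t-X^n_t$. Almost surely there is a unique differential resolvent $R$ of the Volterra kernel $\kappa(t,A)=\int_{[0,t]}b'(X_{t-r})\mathbf 1_A(t-r)\,\eta(\mathrm dr)$, that is, a unique locally bounded measurable $R:[0,\infty)^2\to\mathbb R$ such that $R(t,s)=0$ for $s>t$, $R(t,t)=1$, and for $0\le s\le t$ $$R(t,s)=1+\int_0^t\int_{[0,u]}b'(X_{u-r})R(u-r,s)\,\eta(\mathrm dr)\,\mathrm du=1+\int_0^tR(t,u)\int_{[0,u]}b'(X_{u-r})\mathbf 1_{\{s\le u-r\}}\,\eta(\mathrm dr)\,\mathrm du .$$ Put $$V^n_t=\int_{[0,\tau]}\int_0^tR(t,s)\left[b(X_{s-r})-b(X_{s-\mathcal T(r)})\right]\mathrm ds\,\eta(\mathrm dr),\qquad N_t=\frac12\int_{[0,\tau]}\left(b(X_{t-r})-b(X_{-r})\right)\eta(\mathrm dr),\qquad t\ge0 .$$ Almost surely there is also a unique path $U(N)$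 on $[-\tau,\infty)$, continuous on $[0,\infty)$, with $$U(N)_t=\int_0^t\int_{[0,s]}b'(X_{s-r})\,U(N)_{s-r}\,\eta(\mathrm dr)\,\mathrm ds+N_t\quad(t\ge0),\qquad U(N)_t=0\quad(-\tau\le t<0).$$ **Theorem (the non-rough case).** For every $t>0$ and every real $p\ge1$ there is a constant $C>0$, not depending on $n$, such that for all $n\ge1$ $$\mathbb E\left(|U^n_t|^p\right)\le C\,\Delta_n^p .$$ Moreover $V^n_t$ and $U(N)_t$ belong to $L^p(\mathbb P)$, and $$\frac1{\Delta_n}\left(U^n_t-V^n_t\right)\longrightarrow U(N)_t\quad\text{in }L^p(\mathbb P)\text{ as }n\to\infty .$$ -/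

import Mathlib

open MeasureTheory ProbabilityTheory Set Filter Topology
open scoped NNReal ENNReal

noncomputable section

/-- `Z`, restricted to the time set `[0, ∞)`, is a fractional Brownian motion with Hurst index `H`
and scale `c = Var Z₁`: a centred Gaussian process with covariance
`c / 2 * (s ^ (2 H) + t ^ (2 H) - |t - s| ^ (2 H))` and almost surely continuous paths. -/
structure IsFractionalBrownianMotion {Ω : Type*} [MeasurableSpace Ω]
    (H c : ℝ) (Z : ℝ → Ω → ℝ) (P : Measure Ω) : Prop where
  gaussian : IsGaussianProcess (fun (t : ℝ≥0) (ω : Ω) => Z (t : ℝ) ω) P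
  centered : ∀ t : ℝ, 0 ≤ t → ∫ ω, Z t ω ∂P = 0
  covariance_eq : ∀ s t : ℝ, 0 ≤ s → 0 ≤ t →
    cov[Z s, Z t; P] = c / 2 * (s ^ (2 * H) + t ^ (2 * H) - |t - s| ^ (2 * H))
  cont : ∀ᵐ ω ∂P, ContinuousOn (fun t => Z t ω) (Ici 0)

/-- The path `x` solves the delay equation with drift `b`, delay measure `η` on `[0, τ]`,
initial segment `x₀` and (additive) noise path `z`. -/
structure IsDelaySolution (τ : ℝ) (η : SignedMeasure ℝ) (b x₀ z x : ℝ → ℝ) : Prop where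
  init : ∀ t : ℝ, -τ ≤ t → t < 0 → x t = x₀ t
  eqn : ∀ t : ℝ, 0 ≤ t →
    x t = x₀ 0 + (∫ s in (0 : ℝ)..t, ∫ᵛ r in Icc 0 τ, b (x (s - r)) ∂<•η) + z t

/-- The discretization map `s ↦ [s / Δ] Δ`. -/
def gridFloor (Δ s : ℝ) : ℝ := (⌊s / Δ⌋ : ℝ) * Δ

/-- The path `y` is the Euler scheme of step `Δ` of the above delay equation. -/
structure IsEulerScheme (τ : ℝ) (η : SignedMeasure ℝ) (b x₀ z : ℝ → ℝ) (Δ : ℝ)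
    (y : ℝ → ℝ) : Prop where
  init : ∀ t : ℝ, -τ ≤ t → t < 0 → y t = x₀ t
  eqn : ∀ t : ℝ, 0 ≤ t →
    y t = x₀ 0 + (∫ s in (0 : ℝ)..t, ∫ᵛ r in Icc 0 τ,
      b (y (gridFloor Δ s - gridFloor Δ r)) ∂<•η) + z t

/-- `R` is the differential resolvent of the Volterra kernel measure
`κ(t, A) = ∫_{[0, t]} β (t - r) 1_A (t - r) η(dr)`; only arguments in `[0, ∞)` matter. -/
structure IsDifferentialResolvent (η : SignedMeasure ℝ) (β : ℝ → ℝ) (R : ℝ → ℝ → ℝ) : Prop where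
  measurable : Measurable (fun q : ℝ≥0 × ℝ≥0 => R (q.1 : ℝ) (q.2 : ℝ))
  locallyBounded : ∀ T : ℝ, ∃ C : ℝ, ∀ t ∈ Icc 0 T, ∀ s ∈ Icc 0 T, |R t s| ≤ C
  eq_zero : ∀ t s : ℝ, 0 ≤ t → t < s → R t s = 0
  eq_one : ∀ t : ℝ, 0 ≤ t → R t t = 1
  eqn_left : ∀ t s : ℝ, 0 ≤ s → s ≤ t →
    R t s = 1 + ∫ u in (0 : ℝ)..t, ∫ᵛ r in Icc 0 u, β (u - r) * R (u - r) s ∂<•η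
  eqn_right : ∀ t s : ℝ, 0 ≤ s → s ≤ t →
    R t s = 1 + ∫ u in (0 : ℝ)..t,
      R t u * ∫ᵛ r in Icc 0 u, β (u - r) * (Iic (u - r)).indicator (fun _ => (1 : ℝ)) s ∂<•η

/-- The path `w` is a solution of the semi-linear delay equation
`w(t) = ∫_0^t ∫_{[0, s]} β(s - r) w(s - r) η(dr) ds + N(t)`, with `w = 0` on `[-τ, 0)`.
For continuous `N` every solution is continuous on `[0, ∞)`. -/
structure IsSemilinearSolution (τ : ℝ) (η : SignedMeasure ℝ) (β N w : ℝ → ℝ) : Prop where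
  cont : ContinuousOn w (Ici 0)
  init : ∀ t : ℝ, -τ ≤ t → t < 0 → w t = 0
  eqn : ∀ t : ℝ, 0 ≤ t →
    w t = (∫ s in (0 : ℝ)..t, ∫ᵛ r in Icc 0 s, β (s - r) * w (s - r) ∂<•η) + N t

/-- `N_t = (1/2) ∫_{[0, τ]} (b(x_{t - r}) - b(x_{-r})) η(dr)`. -/
def limitForcing (τ : ℝ) (η : SignedMeasure ℝ) (b x : ℝ → ℝ) (t : ℝ) : ℝ :=
  1 / 2 * ∫ᵛ r in Icc 0 τ, (b (x (t - r)) - b (x (-r))) ∂<•η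

/-- The bias term `∫_{[0, τ]} ∫_0^t R(t, s) (b(x_{s - r}) - b(x_{s - [r / Δ] Δ})) ds η(dr)`. -/
def biasTerm (τ : ℝ) (η : SignedMeasure ℝ) (b x : ℝ → ℝ) (R : ℝ → ℝ → ℝ) (Δ t : ℝ) : ℝ :=
  ∫ᵛ r in Icc 0 τ, (∫ s in (0 : ℝ)..t,
    R t s * (b (x (s - r)) - b (x (s - gridFloor Δ r)))) ∂<•η

end

open MeasureTheory ProbabilityTheory Set Filter Topology
open scoped NNReal ENNReal

/-! The signed measure `η` is written as a density `h` with values `±1` against its total variation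
`ν`, and `X` is replaced by a jointly measurable version `Y` all of whose paths are continuous. Let
`A f(t) = ∫_0^t ∫ b'(Y_{u-r}) f(u-r) η(dr) du` (`volterra`) be the linearized delay operator.

Linear theory. In the norm with weight `exp(-λ t)`, `λ` large, `A` is a contraction with factor
`1/2`. This gives existence and uniqueness for `w = A w + N`, the resolvent `R` (the solution with
forcing `1_{[s,∞)}`), and variation of constants: `∫_0^t R(t,u) f(u) du` solves the equation with
forcing `∫_0^t f`. The same weight, combined with Minkowski's integral inequality, gives a Grönwall
lemma in `L^q` (`LpBdd.gronwall`) that needs only pathwise boundedness of the unknown.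

Error equation. Up to a term that is Lipschitz in the error at grid times, the error equals `∫_0^t ∫
(b(Y_{s-r}) - b(Y_{T(s)-T(r)})) η(dr) ds`. Inserting `b(Y_{s-T(r)})` splits this forcing in two. The
discretization of the delay reduces, by a change of variables, to integrals over windows shorter
than `Δ`; it is `O(Δ)`, and variation of constants turns it into exactly the bias term. The
discretization of time is the error of the left-point rule along `b(Y)`, which is `Δ N_t` plus
errors of the trapezoidal rule and `Δ` times increments over lags of at most `Δ`. The heart of the
matter is that the trapezoidal error is `o(Δ)` in `L^q`.

Trapezoidal rule. On the grid its error is half the integral over `δ ∈ [0, Δ]` of sums of symmetric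
second differences of `b(Y)` over the cells (`gridError_natCast_mul`). Linearizing `b` at the left
endpoint of each cell costs `Δ^{2H}` per cell, hence `Δ^{2H-1}` in total; the drift of `Y`
contributes `Δ^{1+H}` per cell, hence `Δ^H`. For the noise, second differences over distinct cells
are negatively correlated, so a sum of `m` of them has `L^q` norm of order `Δ^H m^{1/2}`. The
weights `b'(Y_{kΔ})` are `H`-Hölder in `L^{2q}`, and since `H + 1/2 > 1` a discrete sewing lemma
bounds the weighted sum by `Δ^{H-1/2}`. All three exponents are positive because `H > 1/2`. On `[-τ,
0]` the path is of class `C^1` and the classical estimate applies.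

Conclusion. Grönwall gives an error of order `Δ`. Linearizing the error equation then costs
`O(Δ^{1+H})`, so the error minus the bias minus `Δ U(N)` solves the linear equation with forcing
`o(Δ)`, and a second use of Grönwall shows that it is itself `o(Δ)`. -/

noncomputable section

/-! ### Signed delay measures as unimodular densities -/

/-- `h` is a density of modulus one with respect to a measure `ν` carried by `[0, τ]`. -/
structure IsDelayDensity (τ : ℝ) (ν : Measure ℝ) (h : ℝ → ℝ) : Prop where
  measurable : Measurable h
  abs_eq_one : ∀ r, |h r| = 1
  supp : ∀ᵐ r ∂ν, r ∈ Icc 0 τ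

theorem setIntegral_toSignedMeasure (μ : Measure ℝ) [IsFiniteMeasure μ] {s : Set ℝ}
    (hs : MeasurableSet s) (f : ℝ → ℝ) :
    (∫ᵛ r in s, f r ∂<•μ.toSignedMeasure) = ∫ r in s, f r ∂μ := by
  have : μ.toSignedMeasure.restrict s = (μ.restrict s).toSignedMeasure := by
    rw [Measure.toSignedMeasure_restrict_eq_restrict_toSignedMeasure _ _ hs]
  rw [this, VectorMeasure.integral_toSignedMeasure]

/-- Integration against a signed measure is integration of a multiple by a unimodular density
against its total variation. -/
theorem exists_delayDensity (τ : ℝ) (η : SignedMeasure ℝ)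
    (hη : ∀ A : Set ℝ, MeasurableSet A → Disjoint A (Icc 0 τ) → η A = 0) :
    ∃ (ν : Measure ℝ) (h : ℝ → ℝ), IsFiniteMeasure ν ∧ IsDelayDensity τ ν h ∧
      ∀ (s : Set ℝ) (f : ℝ → ℝ), MeasurableSet s →
        (∫ᵛ r in s, f r ∂<•η) = ∫ r in s, h r * f r ∂ν := by
  classical
  set p := η.toJordanDecomposition.posPart with hp
  set n := η.toJordanDecomposition.negPart with hn
  have hη' : η = p.toSignedMeasure - n.toSignedMeasure :=
    (SignedMeasure.toSignedMeasure_toJordanDecomposition η).symm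
  obtain ⟨A, hA, hpA, hnA⟩ := η.toJordanDecomposition.mutuallySingular
  have htv : p + n = η.variation := by
    rw [← SignedMeasure.totalVariation_eq_variation]; rfl
  let h : ℝ → ℝ := fun r => if r ∈ A then -1 else 1
  have hh1 : ∀ r, |h r| = 1 := fun r => by by_cases hr : r ∈ A <;> simp [h, hr]
  have hhh : ∀ r, h r * h r = 1 := fun r => by by_cases hr : r ∈ A <;> simp [h, hr]
  have hhm : Measurable h := Measurable.ite hA measurable_const measurable_const
  refine ⟨p + n, h, inferInstance, ⟨hhm, hh1, ?_⟩, ?_⟩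
  · rw [ae_iff]
    have hpz : ∀ B : Set ℝ, MeasurableSet B → B ⊆ (Icc 0 τ)ᶜ → p.real B = n.real B := by
      intro B hB hBs
      have h1 := hη B hB (disjoint_left.2 fun x hx hx' => hBs hx hx')
      rw [hη'] at h1
      simp [Measure.toSignedMeasure_apply_measurable hB] at h1
      linarith
    have hS : MeasurableSet (Icc 0 τ : Set ℝ)ᶜ := measurableSet_Icc.compl
    -- Off `[0, τ]` the positive and negative parts agree, and on `A` and on its complement one of
    -- them vanishes; hence both vanish there.
    have e1 := hpz _ (hS.inter hA) inter_subset_left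
    have e2 := hpz _ (hS.diff hA) sdiff_subset
    have z1 : p ((Icc 0 τ)ᶜ ∩ A) = 0 := measure_mono_null inter_subset_right hpA
    have z2 : n ((Icc 0 τ)ᶜ \ A) = 0 := measure_mono_null (fun x hx => hx.2) hnA
    have z3 : n ((Icc 0 τ)ᶜ ∩ A) = 0 := by
      have : n.real ((Icc 0 τ)ᶜ ∩ A) = 0 := by rw [← e1]; simp [Measure.real, z1]
      simpa [Measure.real, ENNReal.toReal_eq_zero_iff, measure_ne_top] using this
    have z4 : p ((Icc 0 τ)ᶜ \ A) = 0 := by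
      have : p.real ((Icc 0 τ)ᶜ \ A) = 0 := by rw [e2]; simp [Measure.real, z2]
      simpa [Measure.real, ENNReal.toReal_eq_zero_iff, measure_ne_top] using this
    have : {a | a ∉ Icc 0 τ} = ((Icc 0 τ)ᶜ ∩ A) ∪ ((Icc 0 τ)ᶜ \ A) := by
      rw [inter_union_sdiff]; rfl
    rw [this, Measure.add_apply]
    rw [measure_union_null z1 z4, measure_union_null z3 z2, add_zero]
  · intro s f hs
    by_cases hf : IntegrableOn f s (p + n)
    · have hfp : IntegrableOn f s p := hf.mono_measure (Measure.le_add_right le_rfl)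
      have hfn : IntegrableOn f s n := hf.mono_measure (Measure.le_add_left le_rfl)
      have hvp : p.toSignedMeasure.variation = p := Measure.variation_toSignedMeasure
      have hvn : n.toSignedMeasure.variation = n := Measure.variation_toSignedMeasure
      have ip : (p.toSignedMeasure.restrict s).Integrable f := by
        rw [VectorMeasure.Integrable, VectorMeasure.variation_restrict hs, hvp]; exact hfp
      have im : (n.toSignedMeasure.restrict s).Integrable f := by
        rw [VectorMeasure.Integrable, VectorMeasure.variation_restrict hs, hvn]; exact hfn
      have hg : IntegrableOn (fun r => h r * f r) s (p + n) :=
        hf.bdd_mul (c := 1) hhm.aestronglyMeasurable (by simp [hh1])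
      have hgp : IntegrableOn (fun r => h r * f r) s p := hg.mono_measure (Measure.le_add_right le_rfl)
      have hgn : IntegrableOn (fun r => h r * f r) s n := hg.mono_measure (Measure.le_add_left le_rfl)
      rw [hη', VectorMeasure.restrict_sub, VectorMeasure.integral_sub_vectorMeasure ip im,
        setIntegral_toSignedMeasure p hs, setIntegral_toSignedMeasure n hs,
        Measure.restrict_add, integral_add_measure hgp hgn, sub_eq_add_neg, ← integral_neg]
      congr 1
      · refine integral_congr_ae (ae_restrict_of_ae ?_)
        have : ∀ᵐ r ∂p, r ∉ A := by rw [ae_iff]; simpa using hpA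
        filter_upwards [this] with r hr
        simp [h, hr]
      · refine integral_congr_ae (ae_restrict_of_ae ?_)
        have : ∀ᵐ r ∂n, r ∈ A := by rw [ae_iff]; exact hnA
        filter_upwards [this] with r hr
        simp [h, hr]
    -- Since `h * h = 1`, `f` and `h * f` are integrable simultaneously, so in the remaining case
    -- both integrals take the default value `0`.
    · rw [integral_undef, VectorMeasure.integral_undef]
      · rw [VectorMeasure.Integrable, VectorMeasure.variation_restrict hs, ← htv]; exact hf
      · intro hc
        apply hf
        have := hc.bdd_mul (c := 1) hhm.aestronglyMeasurable (by simp [hh1])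
        refine this.congr (Eventually.of_forall fun r => ?_)
        simp only [← mul_assoc, hhh, one_mul]

/-! ### Linear Volterra equations with delay -/

/-- `∫ h(r) g(u - r) ν(dr)`. -/
def delayInt (ν : Measure ℝ) (h g : ℝ → ℝ) (u : ℝ) : ℝ := ∫ r, h r * g (u - r) ∂ν

/-- `t ↦ ∫_0^t ∫_{[0, u]} β(u - r) f(u - r) h(r) ν(dr) du`. -/
def volterra (ν : Measure ℝ) (h β f : ℝ → ℝ) (t : ℝ) : ℝ :=
  ∫ u in (0 : ℝ)..t, delayInt ν h ((Ici 0).indicator (fun v => β v * f v)) u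

variable {τ : ℝ} {ν : Measure ℝ} [IsFiniteMeasure ν] {h : ℝ → ℝ}

/-- Moving the variable endpoints into an indicator reduces this to measurability of integrals over
a fixed space. The parameter space `S` is later `Ω`, so that the pathwise constructions below are
jointly measurable in time and `ω`. -/
theorem measurable_intervalIntegral_param {S : Type*} [MeasurableSpace S] {F : S → ℝ → ℝ}
    (hF : Measurable (fun p : S × ℝ => F p.1 p.2)) {a c : S → ℝ} (ha : Measurable a)
    (hc : Measurable c) : Measurable (fun σ => ∫ u in a σ..c σ, F σ u) := by
  have key : ∀ {a c : S → ℝ}, Measurable a → Measurable c →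
      Measurable (fun σ => ∫ u in Ioc (a σ) (c σ), F σ u) := by
    intro a c ha hc
    have : (fun σ => ∫ u in Ioc (a σ) (c σ), F σ u) =
        fun σ => ∫ u, {p : S × ℝ | a p.1 < p.2 ∧ p.2 ≤ c p.1}.indicator
          (fun p => F p.1 p.2) (σ, u) := by
      ext σ
      rw [← integral_indicator measurableSet_Ioc]
      rfl
    rw [this]
    have hm : MeasurableSet {p : S × ℝ | a p.1 < p.2 ∧ p.2 ≤ c p.1} :=
      (measurableSet_lt (ha.comp measurable_fst) measurable_snd).inter
        (measurableSet_le measurable_snd (hc.comp measurable_fst))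
    exact (StronglyMeasurable.integral_prod_right (f := fun σ u =>
      {p : S × ℝ | a p.1 < p.2 ∧ p.2 ≤ c p.1}.indicator (fun p => F p.1 p.2) (σ, u))
      (hF.indicator hm).stronglyMeasurable).measurable
  simp only [intervalIntegral]
  exact (key ha hc).sub (key hc ha)

theorem measurable_delayInt (hh : IsDelayDensity τ ν h) {S : Type*} [MeasurableSpace S]
    {g : S → ℝ → ℝ} (hg : Measurable (fun p : S × ℝ => g p.1 p.2)) :
    Measurable (fun p : S × ℝ => delayInt ν h (g p.1) p.2) := by
  have : Measurable (fun q : (S × ℝ) × ℝ => h q.2 * g q.1.1 (q.1.2 - q.2)) := by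
    have h2 : Measurable (fun q : (S × ℝ) × ℝ => (q.1.1, q.1.2 - q.2)) := by fun_prop
    exact (hh.measurable.comp measurable_snd).mul (hg.comp h2)
  exact (StronglyMeasurable.integral_prod_right
    (f := fun (p : S × ℝ) r => h r * g p.1 (p.2 - r)) this.stronglyMeasurable).measurable

theorem measurable_volterra (hh : IsDelayDensity τ ν h) {S : Type*} [MeasurableSpace S]
    {β f : S → ℝ → ℝ} (hβ : Measurable (fun p : S × ℝ => β p.1 p.2))
    (hf : Measurable (fun p : S × ℝ => f p.1 p.2)) :
    Measurable (fun p : S × ℝ => volterra ν h (β p.1) (f p.1) p.2) := by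
  have h1 : Measurable (fun p : S × ℝ => (Ici (0 : ℝ)).indicator
      (fun v => β p.1 v * f p.1 v) p.2) :=
    (hβ.mul hf).indicator (s := {p : S × ℝ | p.2 ∈ Ici (0:ℝ)}) (measurable_snd measurableSet_Ici)
  have h2 := measurable_delayInt hh (g := fun σ => (Ici (0 : ℝ)).indicator
    (fun v => β σ v * f σ v)) h1
  refine measurable_intervalIntegral_param (S := S × ℝ) (F := fun p u => delayInt ν h
    ((Ici 0).indicator (fun v => β p.1 v * f p.1 v)) u) ?_ measurable_const measurable_snd
  exact h2.comp ((measurable_fst.comp measurable_fst).prodMk measurable_snd)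

/-- The measurable functions that are bounded on every `[0, T]`. -/
def LocBdd (f : ℝ → ℝ) : Prop := Measurable f ∧ ∀ T : ℝ, ∃ C : ℝ, ∀ t ∈ Icc 0 T, |f t| ≤ C

theorem abs_delayInt_le (hh : IsDelayDensity τ ν h) {g : ℝ → ℝ} {C u : ℝ}
    (hg : ∀ v, u - τ ≤ v → v ≤ u → |g v| ≤ C) : |delayInt ν h g u| ≤ C * ν.real univ := by
  refine norm_integral_le_of_norm_le_const (f := fun r => h r * g (u - r)) ?_
  filter_upwards [hh.supp] with r hr
  rw [Real.norm_eq_abs, abs_mul, hh.abs_eq_one, one_mul]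
  exact hg _ (by linarith [hr.2]) (by linarith [hr.1])

theorem integrable_delay (hh : IsDelayDensity τ ν h) {g : ℝ → ℝ} (hg : Measurable g) {C u : ℝ}
    (hC : ∀ v, u - τ ≤ v → v ≤ u → |g v| ≤ C) : Integrable (fun r => h r * g (u - r)) ν := by
  refine Integrable.of_bound (C := C)
    (hh.measurable.mul (hg.comp (measurable_const.sub measurable_id))).aestronglyMeasurable ?_
  filter_upwards [hh.supp] with r hr
  rw [Real.norm_eq_abs, abs_mul, hh.abs_eq_one, one_mul]
  exact hC _ (by linarith [hr.2]) (by linarith [hr.1])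

theorem intervalIntegrable_of_bdd {f : ℝ → ℝ} (hf : Measurable f) {C t : ℝ} (ht : 0 ≤ t)
    (hC : ∀ u ∈ Icc 0 t, |f u| ≤ C) : IntervalIntegrable f volume 0 t := by
  rw [intervalIntegrable_iff_integrableOn_Ioc_of_le ht]
  refine Measure.integrableOn_of_bounded (M := C) (by simp) hf.aestronglyMeasurable ?_
  filter_upwards [ae_restrict_mem measurableSet_Ioc] with u hu
  exact hC u ⟨hu.1.le, hu.2⟩

theorem abs_indicator_mul_le {β f : ℝ → ℝ} {K C u : ℝ} (hC : 0 ≤ C) (hK : 0 ≤ K)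
    (hβ : ∀ v, 0 ≤ v → |β v| ≤ K)
    (hf : ∀ v ∈ Icc 0 u, |f v| ≤ C) (v : ℝ) (hv : v ≤ u) :
    |(Ici (0 : ℝ)).indicator (fun v => β v * f v) v| ≤ K * C := by
  by_cases h0 : 0 ≤ v
  · rw [indicator_of_mem (show v ∈ Ici (0:ℝ) from h0), abs_mul]
    exact mul_le_mul (hβ v h0) (hf v ⟨h0, hv⟩) (abs_nonneg _) hK
  · rw [indicator_of_notMem (show v ∉ Ici (0:ℝ) from h0)]
    simp [mul_nonneg hK hC]

/-- The exponential rate of the weighted norm in which the Volterra operator is a contraction. -/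
def volterraRate (ν : Measure ℝ) (K : ℝ) : ℝ := 2 * (K * ν.real univ) + 1

theorem volterraRate_pos {K : ℝ} (hK : 0 ≤ K) : 0 < volterraRate ν K := by
  have := mul_nonneg hK (measureReal_nonneg (μ := ν) (s := univ))
  unfold volterraRate; linarith

/-- Integrating `exp(λ u)` gains a factor `1 / λ`, and `λ ≥ 2 L` turns `L / λ` into at most `1 / 2`.
-/
theorem integral_exp_rate_le {lam L M t : ℝ} (hl : 0 < lam) (hL : 2 * L ≤ lam) (hM : 0 ≤ M) :
    ∫ u in (0 : ℝ)..t, L * (M * Real.exp (lam * u)) ≤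
      M / 2 * Real.exp (lam * t) - L * M / lam := by
  have : ∫ u in (0 : ℝ)..t, Real.exp (lam * u) = (Real.exp (lam * t) - 1) / lam := by
    rw [intervalIntegral.integral_comp_mul_left (fun x => Real.exp x) hl.ne']
    simp [div_eq_inv_mul]
  rw [intervalIntegral.integral_const_mul, intervalIntegral.integral_const_mul, this]
  have hE := Real.exp_pos (lam * t)
  have h2 : L / lam ≤ 1 / 2 := by rw [div_le_iff₀ hl]; linarith
  have h3 : L * (M * ((Real.exp (lam * t) - 1) / lam)) =
    L / lam * (M * Real.exp (lam * t)) - L * M / lam := by field_simp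
  rw [h3]
  nlinarith [mul_le_mul_of_nonneg_right h2 (mul_nonneg hM hE.le)]

/-- The contraction estimate on which the linear theory rests: delays are nonnegative, so the weight
at `u - r` is at most the weight at `u`, and the exponential integral then supplies the factor `1 /
2`. -/
theorem abs_volterra_le (hh : IsDelayDensity τ ν h) {β f : ℝ → ℝ} {K M T t : ℝ}
    (hK : 0 ≤ K) (hM : 0 ≤ M) (hβ : ∀ v, 0 ≤ v → |β v| ≤ K)
    (hf : ∀ u ∈ Icc 0 T, |f u| ≤ M * Real.exp (volterraRate ν K * u)) (ht : t ∈ Icc 0 T) :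
    |volterra ν h β f t| ≤ M / 2 * Real.exp (volterraRate ν K * t) := by
  have hl := volterraRate_pos (ν := ν) hK
  set lam := volterraRate ν K with hlam
  have h1 : |volterra ν h β f t| ≤
      ∫ u in (0 : ℝ)..t, (K * ν.real univ) * (M * Real.exp (lam * u)) := by
    refine intervalIntegral.norm_integral_le_of_norm_le (E := ℝ) ht.1 ?_ ?_
    · refine Eventually.of_forall fun u hu => ?_
      have := abs_delayInt_le (C := K * (M * Real.exp (lam * u))) hh
        (fun v _ hv => abs_indicator_mul_le (u := u) (by positivity) hK hβ (fun v hv =>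
          (hf v ⟨hv.1, hv.2.trans (hu.2.trans ht.2)⟩).trans ?_) v hv)
      · rw [Real.norm_eq_abs]; refine this.trans (le_of_eq (by ring))
      · gcongr; exact hv.2
    · exact (Continuous.intervalIntegrable (by fun_prop) _ _)
  refine h1.trans ((integral_exp_rate_le hl ?_ hM).trans ?_)
  · rw [hlam, volterraRate]; linarith
  · have : 0 ≤ K * ν.real univ * M / lam := by positivity
    linarith

/-- Causality: the operator at time `t` sees its argument on `[0, t]` only. -/
theorem volterra_congr {β f g : ℝ → ℝ} (hh : IsDelayDensity τ ν h) {t : ℝ} (ht : 0 ≤ t)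
    (hfg : ∀ u ∈ Icc 0 t, f u = g u) : volterra ν h β f t = volterra ν h β g t := by
  refine intervalIntegral.integral_congr fun u hu => ?_
  rw [uIcc_of_le ht] at hu
  refine integral_congr_ae ?_
  filter_upwards [hh.supp] with r hr
  by_cases h0 : 0 ≤ u - r
  · simp only [indicator_of_mem (show u - r ∈ Ici (0:ℝ) from h0)]
    rw [hfg _ ⟨h0, by linarith [hr.1, hu.2]⟩]
  · simp only [indicator_of_notMem (show u - r ∉ Ici (0:ℝ) from h0)]

theorem LocBdd.delay (hh : IsDelayDensity τ ν h) {β f : ℝ → ℝ} {K : ℝ}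
    (hK : 0 ≤ K) (hβm : Measurable β) (hβ : ∀ v, 0 ≤ v → |β v| ≤ K) (hf : LocBdd f) :
    Measurable ((Ici (0 : ℝ)).indicator (fun v => β v * f v)) ∧
    (∀ T, ∃ C, 0 ≤ C ∧ ∀ v ≤ T, |(Ici (0 : ℝ)).indicator (fun v => β v * f v) v| ≤ C) ∧
    LocBdd (delayInt ν h ((Ici (0 : ℝ)).indicator (fun v => β v * f v))) := by
  have hm : Measurable ((Ici (0 : ℝ)).indicator (fun v => β v * f v)) :=
    (hβm.mul hf.1).indicator measurableSet_Ici
  have hb : ∀ T, ∃ C, 0 ≤ C ∧ ∀ v ≤ T,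
      |(Ici (0 : ℝ)).indicator (fun v => β v * f v) v| ≤ C := by
    intro T
    obtain ⟨C, hC⟩ := hf.2 T
    exact ⟨K * |C|, by positivity, fun v hv => abs_indicator_mul_le (abs_nonneg C) hK hβ
      (fun v hv => (hC v hv).trans (le_abs_self C)) v hv⟩
  refine ⟨hm, hb, ?_, fun T => ?_⟩
  · exact (measurable_delayInt hh (S := Unit) (g := fun _ => _)
      (hm.comp measurable_snd)).comp (measurable_const (a := ()).prodMk measurable_id)
  · obtain ⟨C, hC0, hC⟩ := hb T
    exact ⟨_, fun t ht => abs_delayInt_le hh (fun v _ hv => hC v (hv.trans ht.2))⟩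

theorem volterra_sub (hh : IsDelayDensity τ ν h) {β f g : ℝ → ℝ} {K t : ℝ}
    (hK : 0 ≤ K) (hβm : Measurable β) (hβ : ∀ v, 0 ≤ v → |β v| ≤ K)
    (hf : LocBdd f) (hg : LocBdd g) (ht : 0 ≤ t) :
    volterra ν h β (fun v => f v - g v) t = volterra ν h β f t - volterra ν h β g t := by
  obtain ⟨mf, bf, lf⟩ := hf.delay hh hK hβm hβ
  obtain ⟨mg, bg, lg⟩ := hg.delay hh hK hβm hβ
  unfold volterra
  obtain ⟨Cf, hCf⟩ := lf.2 t
  obtain ⟨Cg, hCg⟩ := lg.2 t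
  rw [← intervalIntegral.integral_sub (intervalIntegrable_of_bdd lf.1 ht hCf)
    (intervalIntegrable_of_bdd lg.1 ht hCg)]
  refine intervalIntegral.integral_congr fun u _ => ?_
  obtain ⟨C1, _, hC1⟩ := bf u
  obtain ⟨C2, _, hC2⟩ := bg u
  simp only [delayInt]
  rw [← integral_sub (integrable_delay hh mf fun v _ hv => hC1 v hv)
    (integrable_delay hh mg fun v _ hv => hC2 v hv)]
  congr 1; ext r
  rw [← mul_sub]; congr 1
  by_cases h0 : 0 ≤ u - r
  · simp only [indicator_of_mem (show u - r ∈ Ici (0:ℝ) from h0)]; ring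
  · simp only [indicator_of_notMem (show u - r ∉ Ici (0:ℝ) from h0)]; ring

theorem LocBdd.volterra (hh : IsDelayDensity τ ν h) {β f : ℝ → ℝ} {K : ℝ}
    (hK : 0 ≤ K) (hβm : Measurable β) (hβ : ∀ v, 0 ≤ v → |β v| ≤ K) (hf : LocBdd f) :
    LocBdd (volterra ν h β f) := by
  refine ⟨(measurable_volterra hh (S := Unit) (β := fun _ => β) (f := fun _ => f)
      (hβm.comp measurable_snd) (hf.1.comp measurable_snd)).comp
      (measurable_const (a := ()).prodMk measurable_id), fun T => ?_⟩
  obtain ⟨C, hC⟩ := hf.2 T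
  have hl := volterraRate_pos (ν := ν) hK
  refine ⟨|C| / 2 * Real.exp (volterraRate ν K * T), fun t ht => ?_⟩
  refine (abs_volterra_le hh hK (abs_nonneg C) hβ (fun u hu => ?_) ht).trans ?_
  · refine ((hC u hu).trans (le_abs_self C)).trans (le_mul_of_one_le_right (abs_nonneg C) ?_)
    exact Real.one_le_exp (mul_nonneg hl.le hu.1)
  · gcongr; exact ht.2

/-- A locally bounded solution of the homogeneous equation vanishes. -/
theorem eq_zero_of_eq_volterra (hh : IsDelayDensity τ ν h) {β f : ℝ → ℝ} {K : ℝ}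
    (hK : 0 ≤ K) (hβ : ∀ v, 0 ≤ v → |β v| ≤ K) {T : ℝ} (hb : ∃ C, ∀ t ∈ Icc 0 T, |f t| ≤ C)
    (heq : ∀ t ∈ Icc 0 T, f t = volterra ν h β f t) : ∀ t ∈ Icc 0 T, f t = 0 := by
  obtain ⟨C, hC⟩ := hb
  have hl := volterraRate_pos (ν := ν) hK
  -- Each substitution of the equation into itself halves the weighted bound.
  have key : ∀ n : ℕ, ∀ t ∈ Icc 0 T,
      |f t| ≤ |C| * (1 / 2) ^ n * Real.exp (volterraRate ν K * t) := by
    intro n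
    induction n with
    | zero =>
      intro t ht
      refine ((hC t ht).trans (le_abs_self C)).trans ?_
      simpa using le_mul_of_one_le_right (abs_nonneg C) (Real.one_le_exp (mul_nonneg hl.le ht.1))
    | succ n ih =>
      intro t ht
      rw [heq t ht]
      refine (abs_volterra_le hh hK (by positivity) hβ ih ht).trans (le_of_eq ?_)
      rw [pow_succ]; ring
  intro t ht
  have hlim : Tendsto (fun n : ℕ => |C| * (1 / 2) ^ n * Real.exp (volterraRate ν K * t))
      atTop (𝓝 (|C| * 0 * Real.exp (volterraRate ν K * t))) :=
    ((tendsto_pow_atTop_nhds_zero_of_lt_one (by norm_num) (by norm_num)).const_mul _).mul_const _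
  have := ge_of_tendsto' hlim fun n => key n t ht
  simpa using this

/-- The iterates of the Volterra operator. -/
def volterraIter (ν : Measure ℝ) (h β N : ℝ → ℝ) : ℕ → ℝ → ℝ
  | 0 => N
  | k + 1 => volterra ν h β (volterraIter ν h β N k)

/-- The solution of `w = volterra w + N` on `[0, ∞)`, as a Neumann series; it is extended by
`0` to negative arguments. -/
def volterraSol (ν : Measure ℝ) (h β N : ℝ → ℝ) (t : ℝ) : ℝ :=
  (Ici (0 : ℝ)).indicator (fun t => ∑' k, volterraIter ν h β N k t) t

theorem measurable_volterraSol (hh : IsDelayDensity τ ν h) {S : Type*} [MeasurableSpace S]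
    {β N : S → ℝ → ℝ} (hβ : Measurable (fun p : S × ℝ => β p.1 p.2))
    (hN : Measurable (fun p : S × ℝ => N p.1 p.2)) :
    Measurable (fun p : S × ℝ => volterraSol ν h (β p.1) (N p.1) p.2) := by
  have h1 : ∀ k, Measurable (fun p : S × ℝ => volterraIter ν h (β p.1) (N p.1) k p.2) := by
    intro k
    induction k with
    | zero => exact hN
    | succ k ih => exact measurable_volterra hh (f := fun σ => volterraIter ν h (β σ) (N σ) k) hβ ih
  exact (Measurable.tsum h1).indicator (s := {p : S × ℝ | p.2 ∈ Ici (0:ℝ)})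
    (measurable_snd measurableSet_Ici)

theorem volterraIter_bound (hh : IsDelayDensity τ ν h) {β N : ℝ → ℝ} {K M T : ℝ}
    (hK : 0 ≤ K) (hM : 0 ≤ M) (hβ : ∀ v, 0 ≤ v → |β v| ≤ K)
    (hN : ∀ u ∈ Icc 0 T, |N u| ≤ M) (k : ℕ) : ∀ t ∈ Icc 0 T,
    |volterraIter ν h β N k t| ≤ M * (1 / 2) ^ k * Real.exp (volterraRate ν K * t) := by
  have hl := volterraRate_pos (ν := ν) hK
  induction k with
  | zero =>
    intro t ht
    refine (hN t ht).trans ?_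
    simpa using le_mul_of_one_le_right hM (Real.one_le_exp (mul_nonneg hl.le ht.1))
  | succ k ih =>
    intro t ht
    refine (abs_volterra_le hh hK (by positivity) hβ ih ht).trans (le_of_eq ?_)
    rw [pow_succ]; ring

theorem LocBdd.volterraIter (hh : IsDelayDensity τ ν h) {β N : ℝ → ℝ} {K : ℝ}
    (hK : 0 ≤ K) (hβm : Measurable β) (hβ : ∀ v, 0 ≤ v → |β v| ≤ K) (hN : LocBdd N) (k : ℕ) :
    LocBdd (volterraIter ν h β N k) := by
  induction k with
  | zero => exact hN
  | succ k ih => exact ih.volterra hh hK hβm hβ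

theorem abs_volterraSol_le (hh : IsDelayDensity τ ν h) {β N : ℝ → ℝ} {K M t : ℝ}
    (hK : 0 ≤ K) (hβ : ∀ v, 0 ≤ v → |β v| ≤ K) (hM : 0 ≤ M) (hN : ∀ u ∈ Icc 0 t, |N u| ≤ M)
    (ht : 0 ≤ t) : |volterraSol ν h β N t| ≤ M * 2 * Real.exp (volterraRate ν K * t) := by
  rw [volterraSol, indicator_of_mem (show t ∈ Ici (0:ℝ) from ht)]
  have hb := fun k => volterraIter_bound hh hK hM hβ hN k t ⟨ht, le_rfl⟩
  have hs : HasSum (fun k : ℕ => M * (1 / 2) ^ k * Real.exp (volterraRate ν K * t))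
      (M * 2 * Real.exp (volterraRate ν K * t)) :=
    (hasSum_geometric_two.mul_left _).mul_right _
  exact tsum_of_norm_bounded (E := ℝ) (f := fun k => volterraIter ν h β N k t) hs hb

theorem LocBdd.volterraSol (hh : IsDelayDensity τ ν h) {β N : ℝ → ℝ} {K : ℝ}
    (hK : 0 ≤ K) (hβm : Measurable β) (hβ : ∀ v, 0 ≤ v → |β v| ≤ K) (hN : LocBdd N) :
    LocBdd (volterraSol ν h β N) := by
  refine ⟨(measurable_volterraSol hh (S := Unit) (β := fun _ => β) (N := fun _ => N)
      (hβm.comp measurable_snd) (hN.1.comp measurable_snd)).comp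
      (measurable_const (a := ()).prodMk measurable_id), fun T => ?_⟩
  obtain ⟨C, hC⟩ := hN.2 T
  have hl := volterraRate_pos (ν := ν) hK
  refine ⟨|C| * 2 * Real.exp (volterraRate ν K * T), fun t ht => ?_⟩
  refine (abs_volterraSol_le hh hK hβ (abs_nonneg C) (fun u hu =>
    (hC u ⟨hu.1, hu.2.trans ht.2⟩).trans (le_abs_self C)) ht.1).trans ?_
  gcongr; exact ht.2

/-- The partial sums satisfy `S (n + 1) = A (S n) + N`. The tail of the Neumann series is
geometrically small in the weighted norm, uniformly on `[0, t]`, and the contraction estimate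
carries this through the operator, so the recursion passes to the limit. -/
theorem volterraSol_eq (hh : IsDelayDensity τ ν h) {β N : ℝ → ℝ} {K : ℝ}
    (hK : 0 ≤ K) (hβm : Measurable β) (hβ : ∀ v, 0 ≤ v → |β v| ≤ K) (hN : LocBdd N)
    {t : ℝ} (ht : 0 ≤ t) :
    volterraSol ν h β N t = volterra ν h β (volterraSol ν h β N) t + N t := by
  obtain ⟨C, hC⟩ := hN.2 t
  have hb := fun k => volterraIter_bound hh hK (abs_nonneg C) hβ
    (fun u hu => (hC u hu).trans (le_abs_self C)) k
  have hsum : ∀ u ∈ Icc 0 t, Summable (fun k => volterraIter ν h β N k u) := fun u hu =>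
    Summable.of_norm_bounded ((summable_geometric_two.mul_left _).mul_right _)
      (fun k => hb k u hu)
  set w := volterraSol ν h β N with hw
  have hwb := hN.volterraSol hh hK hβm hβ
  let S : ℕ → ℝ → ℝ := fun n u => ∑ k ∈ Finset.range n, volterraIter ν h β N k u
  have hSb : ∀ n, LocBdd (S n) := by
    intro n
    induction n with
    | zero => exact ⟨by simp only [S, Finset.range_zero, Finset.sum_empty]; exact measurable_const,
        fun T => ⟨0, fun t _ => by simp [S]⟩⟩
    | succ n ih =>
      have hi := hN.volterraIter hh hK hβm hβ n
      refine ⟨?_, fun T => ?_⟩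
      · simp only [S, Finset.sum_range_succ]; exact ih.1.add hi.1
      · obtain ⟨A, hA⟩ := ih.2 T
        obtain ⟨B, hB⟩ := hi.2 T
        refine ⟨A + B, fun t ht => ?_⟩
        simp only [S, Finset.sum_range_succ]
        exact (abs_add_le _ _).trans (add_le_add (hA t ht) (hB t ht))
  have hrem : ∀ n, ∀ u ∈ Icc 0 t, |w u - S n u| ≤
      |C| * 2 * (1 / 2) ^ n * Real.exp (volterraRate ν K * u) := by
    intro n u hu
    have h1 : w u - S n u = ∑' k, volterraIter ν h β N (k + n) u := by
      rw [hw, _root_.volterraSol, indicator_of_mem (show u ∈ Ici (0:ℝ) from hu.1),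
        ← (hsum u hu).sum_add_tsum_nat_add n]
      simp [S]
    rw [h1]
    have hs : HasSum (fun k : ℕ => |C| * (1 / 2) ^ k * ((1 / 2) ^ n *
        Real.exp (volterraRate ν K * u)))
      (|C| * 2 * ((1 / 2) ^ n * Real.exp (volterraRate ν K * u))) :=
      (hasSum_geometric_two.mul_left _).mul_right _
    refine (tsum_of_norm_bounded (E := ℝ) (f := fun k => volterraIter ν h β N (k + n) u) hs
      fun k => (hb (k + n) u hu).trans (le_of_eq ?_)).trans (le_of_eq ?_)
    · rw [pow_add]; ring
    · ring
  have hS : ∀ n, S (n + 1) t = volterra ν h β (S n) t + N t := by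
    intro n
    induction n with
    | zero => simp [S, volterraIter, volterra, delayInt]
    | succ n ih =>
      have e : volterra ν h β (fun v => S (n + 1) v - S n v) t = volterraIter ν h β N (n + 1) t := by
        simp only [S, Finset.sum_range_succ, add_sub_cancel_left]; rfl
      rw [volterra_sub hh hK hβm hβ (hSb _) (hSb _) ht] at e
      have e2 : S (n + 1 + 1) t = S (n + 1) t + volterraIter ν h β N (n + 1) t := by
        simp only [S, Finset.sum_range_succ]
      rw [e2, ← e, ih]; ring
  have hlim0 : ∀ c : ℝ, Tendsto (fun n : ℕ => |C| * 2 * (1 / 2) ^ n * c)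
      atTop (𝓝 0) := fun c => by
    simpa using ((tendsto_pow_atTop_nhds_zero_of_lt_one (r := (1/2 : ℝ))
      (by norm_num) (by norm_num)).const_mul (|C| * 2)).mul_const c
  have htt : t ∈ Icc 0 t := ⟨ht, le_rfl⟩
  have l1 : Tendsto (fun n => S (n + 1) t) atTop (𝓝 (w t)) := by
    refine (tendsto_add_atTop_iff_nat (f := fun n => S n t) 1).2 ?_
    rw [tendsto_iff_norm_sub_tendsto_zero]
    refine squeeze_zero (fun _ => norm_nonneg _) (fun n => ?_)
      (hlim0 (Real.exp (volterraRate ν K * t)))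
    rw [norm_sub_rev]; exact hrem n t htt
  have l2 : Tendsto (fun n => volterra ν h β (S n) t + N t) atTop
      (𝓝 (volterra ν h β w t + N t)) := by
    refine Tendsto.add_const _ ?_
    rw [tendsto_iff_norm_sub_tendsto_zero]
    refine squeeze_zero (fun _ => norm_nonneg _) (fun n => ?_)
      (hlim0 (1 / 2 * Real.exp (volterraRate ν K * t)))
    rw [norm_sub_rev, Real.norm_eq_abs, ← volterra_sub hh hK hβm hβ hwb (hSb n) ht]
    refine (abs_volterra_le hh hK (by positivity) hβ (hrem n) htt).trans (le_of_eq (by ring))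
  simp only [hS] at l1
  exact tendsto_nhds_unique l1 l2

theorem eq_of_volterra_eq (hh : IsDelayDensity τ ν h) {β N w w' : ℝ → ℝ} {K : ℝ}
    (hK : 0 ≤ K) (hβm : Measurable β) (hβ : ∀ v, 0 ≤ v → |β v| ≤ K)
    (hw : LocBdd w) (hw' : LocBdd w') {T : ℝ}
    (e : ∀ t ∈ Icc 0 T, w t = volterra ν h β w t + N t)
    (e' : ∀ t ∈ Icc 0 T, w' t = volterra ν h β w' t + N t) : ∀ t ∈ Icc 0 T, w t = w' t := by
  intro t ht
  have := eq_zero_of_eq_volterra (f := fun v => w v - w' v) (T := T) hh hK hβ ?_ ?_ t ht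
  · exact sub_eq_zero.1 this
  · obtain ⟨A, hA⟩ := hw.2 T
    obtain ⟨B, hB⟩ := hw'.2 T
    exact ⟨A + B, fun t ht => (abs_sub _ _).trans (add_le_add (hA t ht) (hB t ht))⟩
  · intro u hu
    rw [volterra_sub hh hK hβm hβ hw hw' hu.1, e u hu, e' u hu]; ring

end
-- The differential resolvent and variation of constants
noncomputable section

variable {τ : ℝ} {ν : Measure ℝ} [IsFiniteMeasure ν] {h : ℝ → ℝ}

theorem integrable_prod_of_bdd {α γ : Type*} [MeasurableSpace α] [MeasurableSpace γ]
    {μ : Measure α} {ρ : Measure γ} [IsFiniteMeasure μ] [IsFiniteMeasure ρ] {F : α → γ → ℝ}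
    (hF : Measurable (Function.uncurry F)) {C : ℝ} (hC : ∀ᵐ x ∂μ, ∀ᵐ y ∂ρ, |F x y| ≤ C) :
    Integrable (Function.uncurry F) (μ.prod ρ) := by
  refine Integrable.of_bound (C := C) hF.aestronglyMeasurable ?_
  exact (Measure.ae_prod_iff_ae_ae (p := fun z => ‖Function.uncurry F z‖ ≤ C)
    (measurableSet_le hF.norm measurable_const)).2 hC

theorem integral_swap_of_bdd {α γ : Type*} [MeasurableSpace α] [MeasurableSpace γ]
    {μ : Measure α} {ρ : Measure γ} [IsFiniteMeasure μ] [IsFiniteMeasure ρ] {F : α → γ → ℝ}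
    (hF : Measurable (Function.uncurry F)) {C : ℝ} (hC : ∀ᵐ x ∂μ, ∀ᵐ y ∂ρ, |F x y| ≤ C) :
    ∫ x, ∫ y, F x y ∂ρ ∂μ = ∫ y, ∫ x, F x y ∂μ ∂ρ :=
  integral_integral_swap (integrable_prod_of_bdd hF hC)

/-- The differential resolvent of the kernel with density `β`. -/
def delayResolvent (ν : Measure ℝ) (h β : ℝ → ℝ) (t s : ℝ) : ℝ :=
  volterraSol ν h β ((Ici s).indicator fun _ => 1) t

theorem measurable_delayResolvent (hh : IsDelayDensity τ ν h) {S : Type*} [MeasurableSpace S]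
    {β : S → ℝ → ℝ} (hβ : Measurable (fun p : S × ℝ => β p.1 p.2)) :
    Measurable (fun p : S × ℝ × ℝ => delayResolvent ν h (β p.1) p.2.1 p.2.2) := by
  have h1 : Measurable (fun p : (S × ℝ) × ℝ => (Ici p.1.2).indicator (fun _ => (1 : ℝ)) p.2) := by
    have : MeasurableSet {p : (S × ℝ) × ℝ | p.1.2 ≤ p.2} :=
      measurableSet_le (measurable_snd.comp measurable_fst) measurable_snd
    exact (measurable_const (a := (1:ℝ))).indicator this
  have h2 := measurable_volterraSol hh (S := S × ℝ) (β := fun p => β p.1)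
    (N := fun p => (Ici p.2).indicator fun _ => 1)
    (hβ.comp ((measurable_fst.comp measurable_fst).prodMk measurable_snd)) h1
  have h3 : Measurable (fun p : S × ℝ × ℝ => ((p.1, p.2.2), p.2.1)) := by fun_prop
  exact h2.comp h3

theorem locBdd_indicator (s : ℝ) : LocBdd ((Ici s).indicator fun _ => (1 : ℝ)) :=
  ⟨measurable_const.indicator measurableSet_Ici, fun _ => ⟨1, fun t _ => by
    by_cases hs : t ∈ Ici s <;> simp [hs]⟩⟩

section
variable {β : ℝ → ℝ} {K : ℝ}

theorem locBdd_delayResolvent (hh : IsDelayDensity τ ν h) (hK : 0 ≤ K) (hβm : Measurable β)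
    (hβ : ∀ v, 0 ≤ v → |β v| ≤ K) (s : ℝ) : LocBdd (fun t => delayResolvent ν h β t s) :=
  (locBdd_indicator s).volterraSol hh hK hβm hβ

theorem abs_delayResolvent_le (hh : IsDelayDensity τ ν h) (hK : 0 ≤ K)
    (hβ : ∀ v, 0 ≤ v → |β v| ≤ K) {t T : ℝ} (ht : t ≤ T) (s : ℝ) :
    |delayResolvent ν h β t s| ≤ 2 * Real.exp (volterraRate ν K * T) := by
  have hl := volterraRate_pos (ν := ν) hK
  by_cases h0 : 0 ≤ t
  · have := abs_volterraSol_le (N := (Ici s).indicator fun _ => (1 : ℝ)) (M := 1) hh hK hβ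
      zero_le_one (fun u _ => by by_cases hs : u ∈ Ici s <;> simp [hs]) h0
    rw [one_mul] at this
    refine this.trans ?_
    gcongr
  · rw [delayResolvent, volterraSol, indicator_of_notMem (show t ∉ Ici (0:ℝ) from h0)]
    simp; positivity

theorem delayResolvent_eq (hh : IsDelayDensity τ ν h) (hK : 0 ≤ K) (hβm : Measurable β)
    (hβ : ∀ v, 0 ≤ v → |β v| ≤ K) {t : ℝ} (ht : 0 ≤ t) (s : ℝ) :
    delayResolvent ν h β t s = volterra ν h β (fun v => delayResolvent ν h β v s) t +
      (Ici s).indicator (fun _ => 1) t :=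
  volterraSol_eq hh hK hβm hβ (locBdd_indicator s) ht

theorem delayResolvent_eq_zero (hh : IsDelayDensity τ ν h) (hK : 0 ≤ K) (hβm : Measurable β)
    (hβ : ∀ v, 0 ≤ v → |β v| ≤ K) {t s : ℝ} (ht : 0 ≤ t) (hts : t < s) :
    delayResolvent ν h β t s = 0 := by
  refine eq_zero_of_eq_volterra (f := fun v => delayResolvent ν h β v s) (T := t) hh hK hβ
    ((locBdd_delayResolvent hh hK hβm hβ s).2 t) (fun u hu => ?_) t ⟨ht, le_rfl⟩
  have := delayResolvent_eq hh hK hβm hβ hu.1 s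
  rwa [indicator_of_notMem (show u ∉ Ici s from not_le.2 (hu.2.trans_lt hts)), add_zero] at this

/-- For `u < t` the resolvent is evaluated at `u - r < t`, where it vanishes. An atom of `ν` at `0`
matters only for `u = t`, a null set. -/
theorem delayResolvent_self (hh : IsDelayDensity τ ν h) (hK : 0 ≤ K) (hβm : Measurable β)
    (hβ : ∀ v, 0 ≤ v → |β v| ≤ K) {t : ℝ} (ht : 0 ≤ t) : delayResolvent ν h β t t = 1 := by
  rw [delayResolvent_eq hh hK hβm hβ ht, indicator_of_mem self_mem_Ici, add_eq_right]
  refine intervalIntegral.integral_zero_ae ?_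
  have : ∀ᵐ u : ℝ, u ≠ t := by simp [ae_iff, measure_singleton]
  filter_upwards [this] with u hut hu
  rw [uIoc_of_le ht] at hu
  refine integral_eq_zero_of_ae ?_
  filter_upwards [hh.supp] with r hr
  by_cases h0 : 0 ≤ u - r
  · rw [indicator_of_mem (show u - r ∈ Ici (0:ℝ) from h0),
      delayResolvent_eq_zero hh hK hβm hβ h0 (by linarith [hr.1, lt_of_le_of_ne hu.2 hut])]
    simp
  · rw [indicator_of_notMem (show u - r ∉ Ici (0:ℝ) from h0)]; simp

/-- The path `t ↦ ∫_0^t R(t, u) f(u) du`. -/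
def resolventInt (ν : Measure ℝ) (h β f : ℝ → ℝ) (t : ℝ) : ℝ :=
  ∫ u in (0 : ℝ)..t, delayResolvent ν h β t u * f u

theorem measurable_resolventInt (hh : IsDelayDensity τ ν h) {S : Type*} [MeasurableSpace S]
    {β f : S → ℝ → ℝ} (hβ : Measurable (fun p : S × ℝ => β p.1 p.2))
    (hf : Measurable (fun p : S × ℝ => f p.1 p.2)) :
    Measurable (fun p : S × ℝ => resolventInt ν h (β p.1) (f p.1) p.2) := by
  refine measurable_intervalIntegral_param (S := S × ℝ)
    (F := fun p u => delayResolvent ν h (β p.1) p.2 u * f p.1 u) ?_ measurable_const measurable_snd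
  have h1 : Measurable (fun q : (S × ℝ) × ℝ => (q.1.1, (q.1.2, q.2))) := by fun_prop
  have h2 : Measurable (fun q : (S × ℝ) × ℝ => (q.1.1, q.2)) := by fun_prop
  exact ((measurable_delayResolvent hh hβ).comp h1).mul (hf.comp h2)

theorem locBdd_resolventInt (hh : IsDelayDensity τ ν h) (hK : 0 ≤ K) (hβm : Measurable β)
    (hβ : ∀ v, 0 ≤ v → |β v| ≤ K) {f : ℝ → ℝ} (hf : LocBdd f) :
    LocBdd (resolventInt ν h β f) := by
  refine ⟨(measurable_resolventInt hh (S := Unit) (β := fun _ => β) (f := fun _ => f)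
      (hβm.comp measurable_snd) (hf.1.comp measurable_snd)).comp
      (measurable_const (a := ()).prodMk measurable_id), fun T => ?_⟩
  obtain ⟨C, hC⟩ := hf.2 T
  refine ⟨2 * Real.exp (volterraRate ν K * T) * |C| * T, fun t ht => ?_⟩
  have := intervalIntegral.norm_integral_le_of_norm_le_const (a := 0) (b := t)
    (f := fun u => delayResolvent ν h β t u * f u)
    (C := 2 * Real.exp (volterraRate ν K * T) * |C|) (fun u hu => ?_)
  · refine this.trans ?_
    rw [sub_zero, abs_of_nonneg ht.1]
    gcongr; exact ht.2
  · rw [uIoc_of_le ht.1] at hu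
    rw [Real.norm_eq_abs, abs_mul]
    exact mul_le_mul (abs_delayResolvent_le hh hK hβ ht.2 u)
      ((hC u ⟨hu.1.le, hu.2.trans ht.2⟩).trans (le_abs_self C)) (abs_nonneg _) (by positivity)

/-- Variation of constants. -/
theorem volterra_resolventInt (hh : IsDelayDensity τ ν h) (hK : 0 ≤ K) (hβm : Measurable β)
    (hβ : ∀ v, 0 ≤ v → |β v| ≤ K) {f : ℝ → ℝ} (hf : LocBdd f) {t : ℝ} (ht : 0 ≤ t) :
    resolventInt ν h β f t =
      volterra ν h β (resolventInt ν h β f) t + ∫ u in (0 : ℝ)..t, f u := by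
  obtain ⟨C, hC⟩ := hf.2 t
  have hRm : Measurable (fun p : ℝ × ℝ => delayResolvent ν h β p.1 p.2) :=
    (measurable_delayResolvent hh (S := Unit) (β := fun _ => β) (hβm.comp measurable_snd)).comp
      (measurable_const (a := ()).prodMk measurable_id)
  let Q : ℝ → ℝ → ℝ := fun x v =>
    (Ici (0 : ℝ)).indicator (fun v => β v * delayResolvent ν h β v x) v
  have hQm : Measurable (fun p : ℝ × ℝ => Q p.1 p.2) :=
    ((hβm.comp measurable_snd).mul (hRm.comp measurable_swap)).indicator
      (s := {p : ℝ × ℝ | p.2 ∈ Ici (0:ℝ)}) (measurable_snd measurableSet_Ici)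
  set B := 2 * Real.exp (volterraRate ν K * t) with hB
  have hB0 : 0 ≤ B := by positivity
  have hQb : ∀ x v, v ≤ t → |Q x v| ≤ K * B := fun x v hv =>
    abs_indicator_mul_le hB0 hK hβ (fun v hv => abs_delayResolvent_le hh hK hβ hv.2 x) v hv
  set μ : Measure ℝ := volume.restrict (Ioc 0 t) with hμ
  have hμm : ∀ᵐ u ∂μ, u ∈ Ioc 0 t := ae_restrict_mem measurableSet_Ioc
  -- As `R(v, x) = 0` for `x > v`, the domain of integration can be taken to be `(0, t]` for all `v`
  -- at once. Fubini is then applied on rectangles, and the equation for `R(·, x)` is used under the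
  -- integral in `x`.
  have hY : ∀ v, 0 ≤ v → v ≤ t → resolventInt ν h β f v =
      ∫ x, delayResolvent ν h β v x * f x ∂μ := by
    intro v hv hvt
    rw [resolventInt, intervalIntegral.integral_of_le hv, hμ]
    refine setIntegral_eq_of_subset_of_forall_sdiff_eq_zero measurableSet_Ioc
      (Ioc_subset_Ioc_right hvt) (fun x hx => ?_) |>.symm
    have : v < x := by
      by_contra hcon
      exact hx.2 ⟨hx.1.1, not_lt.1 hcon⟩
    rw [delayResolvent_eq_zero hh hK hβm hβ hv this, zero_mul]
  have hYQ : ∀ v, v ≤ t → (Ici (0 : ℝ)).indicator (fun v => β v * resolventInt ν h β f v) v =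
      ∫ x, Q x v * f x ∂μ := by
    intro v hvt
    by_cases h0 : v ∈ Ici (0 : ℝ)
    · simp only [Q, indicator_of_mem h0, hY v h0 hvt, mul_assoc]
      rw [integral_const_mul]
    · simp [Q, indicator_of_notMem h0]
  have hinner : ∀ u ∈ Ioc 0 t, delayInt ν h
      ((Ici (0 : ℝ)).indicator (fun v => β v * resolventInt ν h β f v)) u =
      ∫ x, delayInt ν h (Q x) u * f x ∂μ := by
    intro u hu
    have e1 : delayInt ν h ((Ici (0 : ℝ)).indicator (fun v => β v * resolventInt ν h β f v)) u =
        ∫ r, ∫ x, h r * (Q x (u - r) * f x) ∂μ ∂ν := by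
      refine integral_congr_ae ?_
      filter_upwards [hh.supp] with r hr
      rw [hYQ _ (by linarith [hr.1, hu.2]), integral_const_mul]
    rw [e1, integral_swap_of_bdd (C := K * B * |C|)]
    · refine integral_congr_ae (Eventually.of_forall fun x => ?_)
      simp only [delayInt, ← integral_mul_const, mul_assoc]
    · have m1 : Measurable (fun p : ℝ × ℝ => (p.2, u - p.1)) := by fun_prop
      exact (hh.measurable.comp measurable_fst).mul
        ((hQm.comp m1).mul (hf.1.comp measurable_snd))
    · filter_upwards [hh.supp] with r hr
      filter_upwards [hμm] with x hx
      rw [abs_mul, hh.abs_eq_one, one_mul, abs_mul]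
      exact mul_le_mul (hQb _ _ (by linarith [hr.1, hu.2]))
        ((hC x ⟨hx.1.le, hx.2⟩).trans (le_abs_self C)) (abs_nonneg _) (by positivity)
  have houter : volterra ν h β (resolventInt ν h β f) t =
      ∫ x, volterra ν h β (fun v => delayResolvent ν h β v x) t * f x ∂μ := by
    rw [volterra, intervalIntegral.integral_of_le ht,
      setIntegral_congr_fun measurableSet_Ioc hinner,
      integral_swap_of_bdd (C := K * B * ν.real univ * |C|)]
    · refine integral_congr_ae (Eventually.of_forall fun x => ?_)
      simp only [volterra, intervalIntegral.integral_of_le ht, ← integral_mul_const]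
      rfl
    · have := (measurable_delayInt hh hQm).comp (measurable_swap (α := ℝ) (β := ℝ))
      exact this.mul (hf.1.comp measurable_snd)
    · filter_upwards [hμm] with u hu
      filter_upwards [hμm] with x hx
      rw [abs_mul]
      exact mul_le_mul (abs_delayInt_le hh fun v _ hv => hQb x v (hv.trans hu.2))
        ((hC x ⟨hx.1.le, hx.2⟩).trans (le_abs_self C)) (abs_nonneg _) (by positivity)
  have hi1 : Integrable f μ := by
    refine Integrable.of_bound (C := C) hf.1.aestronglyMeasurable ?_
    filter_upwards [hμm] with x hx using hC x ⟨hx.1.le, hx.2⟩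
  have hi2 : Integrable (fun x => delayResolvent ν h β t x * f x) μ := by
    refine hi1.bdd_mul (c := B) ?_ (Eventually.of_forall fun x => ?_)
    · exact (hRm.comp (measurable_const.prodMk measurable_id)).aestronglyMeasurable
    · exact abs_delayResolvent_le hh hK hβ le_rfl x
  have hR : ∀ x ∈ Ioc 0 t, volterra ν h β (fun v => delayResolvent ν h β v x) t =
      delayResolvent ν h β t x - 1 := fun x hx => by
    have := delayResolvent_eq hh hK hβm hβ ht x
    rw [indicator_of_mem (show t ∈ Ici x from hx.2)] at this
    linarith
  rw [houter, intervalIntegral.integral_of_le ht, hY t ht le_rfl, ← hμ, ← sub_eq_iff_eq_add,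
    ← integral_sub hi2 hi1]
  refine integral_congr_ae ?_
  filter_upwards [hμm] with x hx
  rw [hR x hx]; ring

/-- With `e = 1_{[s,∞)}`, variation of constants shows that `Y = ∫ R g` solves `Y = A Y + A e`,
because `∫_0^u g = A e (u)`. So `e + Y` solves the same equation as `R(·, s)`, and uniqueness
identifies them. -/
theorem delayResolvent_eq_right (hh : IsDelayDensity τ ν h) (hK : 0 ≤ K) (hβm : Measurable β)
    (hβ : ∀ v, 0 ≤ v → |β v| ≤ K) {t s : ℝ} (ht : 0 ≤ t) :
    delayResolvent ν h β t s = (Ici s).indicator (fun _ => 1) t + resolventInt ν h β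
      (delayInt ν h ((Ici 0).indicator (fun v => β v * (Ici s).indicator (fun _ => 1) v))) t := by
  set e : ℝ → ℝ := (Ici s).indicator fun _ => 1 with he
  have heb : LocBdd e := locBdd_indicator s
  set g := delayInt ν h ((Ici 0).indicator (fun v => β v * e v)) with hg
  have hgb : LocBdd g := (heb.delay hh hK hβm hβ).2.2
  set Y := resolventInt ν h β g with hY
  have hYb : LocBdd Y := locBdd_resolventInt hh hK hβm hβ hgb
  have hyb : LocBdd (fun v => e v + Y v) := by
    refine ⟨heb.1.add hYb.1, fun T => ?_⟩
    obtain ⟨A, hA⟩ := heb.2 T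
    obtain ⟨B, hB⟩ := hYb.2 T
    exact ⟨A + B, fun t ht => (abs_add_le _ _).trans (add_le_add (hA t ht) (hB t ht))⟩
  refine eq_of_volterra_eq (N := e) (T := t) (w := fun v => delayResolvent ν h β v s)
    (w' := fun v => e v + Y v) hh hK hβm hβ (locBdd_delayResolvent hh hK hβm hβ s) hyb
    (fun u hu => delayResolvent_eq hh hK hβm hβ hu.1 s) (fun u hu => ?_) t ⟨ht, le_rfl⟩
  have h1 := volterra_sub hh hK hβm hβ hyb heb hu.1
  simp only [add_sub_cancel_left] at h1
  have h2 := volterra_resolventInt hh hK hβm hβ hgb hu.1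
  have h3 : ∫ x in (0 : ℝ)..u, g x = volterra ν h β e u := rfl
  rw [h3] at h2
  linarith
end

/-- Passage between the two conventions: truncation of the delay at `u`, and extension of the path
by `0` to negative times. They agree because `ν` charges only `r ≥ 0`. -/
theorem setIntegral_Icc_delay (hh : IsDelayDensity τ ν h) (F : ℝ → ℝ) (u : ℝ) :
    ∫ r in Icc 0 u, h r * F (u - r) ∂ν = delayInt ν h ((Ici 0).indicator F) u := by
  rw [← integral_indicator measurableSet_Icc, delayInt]
  refine integral_congr_ae ?_
  filter_upwards [hh.supp] with r hr
  by_cases h0 : r ≤ u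
  · rw [indicator_of_mem (show r ∈ Icc 0 u from ⟨hr.1, h0⟩),
      indicator_of_mem (show u - r ∈ Ici (0:ℝ) from sub_nonneg.2 h0)]
  · rw [indicator_of_notMem (fun hc : r ∈ Icc 0 u => h0 hc.2),
      indicator_of_notMem (fun hc : u - r ∈ Ici (0:ℝ) => h0 (sub_nonneg.1 hc)), mul_zero]

theorem setIntegral_Icc_supp (hh : IsDelayDensity τ ν h) (F : ℝ → ℝ) :
    ∫ r in Icc 0 τ, F r ∂ν = ∫ r, F r ∂ν := by
  rw [Measure.restrict_eq_self_of_ae_mem hh.supp]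

theorem isDifferentialResolvent_delayResolvent {η : SignedMeasure ℝ}
    (hην : ∀ (s : Set ℝ) (f : ℝ → ℝ), MeasurableSet s →
        (∫ᵛ r in s, f r ∂<•η) = ∫ r in s, h r * f r ∂ν)
    (hh : IsDelayDensity τ ν h) {β : ℝ → ℝ} {K : ℝ} (hK : 0 ≤ K) (hβm : Measurable β)
    (hβ : ∀ v, 0 ≤ v → |β v| ≤ K) : IsDifferentialResolvent η β (delayResolvent ν h β) where
  measurable := by
    have hRm := (measurable_delayResolvent hh (S := Unit) (β := fun _ => β)
      (hβm.comp measurable_snd)).comp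
      (measurable_const (a := ()).prodMk (measurable_id (α := ℝ × ℝ)))
    have : Measurable (fun q : ℝ≥0 × ℝ≥0 => ((q.1 : ℝ), (q.2 : ℝ))) := by fun_prop
    exact hRm.comp this
  locallyBounded T := ⟨_, fun t ht s _ => abs_delayResolvent_le hh hK hβ ht.2 s⟩
  eq_zero t s ht hts := delayResolvent_eq_zero hh hK hβm hβ ht hts
  eq_one t ht := delayResolvent_self hh hK hβm hβ ht
  eqn_left t s hs hst := by
    rw [delayResolvent_eq hh hK hβm hβ (hs.trans hst), indicator_of_mem (show t ∈ Ici s from hst),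
      add_comm]
    congr 1
    refine intervalIntegral.integral_congr fun u _ => ?_
    rw [hην _ _ measurableSet_Icc,
      setIntegral_Icc_delay hh (fun v => β v * delayResolvent ν h β v s)]
  eqn_right t s hs hst := by
    rw [delayResolvent_eq_right hh hK hβm hβ (hs.trans hst), indicator_of_mem (show t ∈ Ici s from hst)]
    congr 1
    refine intervalIntegral.integral_congr fun u _ => ?_
    rw [hην _ _ measurableSet_Icc, setIntegral_Icc_delay hh
      (fun v => β v * (Iic v).indicator (fun _ => 1) s)]
    rfl

theorem IsDifferentialResolvent.congr {η : SignedMeasure ℝ} {β β' : ℝ → ℝ} {R : ℝ → ℝ → ℝ}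
    (hR : IsDifferentialResolvent η β R) (hβ : ∀ v, 0 ≤ v → β v = β' v) :
    IsDifferentialResolvent η β' R where
  measurable := hR.measurable
  locallyBounded := hR.locallyBounded
  eq_zero := hR.eq_zero
  eq_one := hR.eq_one
  eqn_left t s hs hst := by
    rw [hR.eqn_left t s hs hst]
    congr 1
    refine intervalIntegral.integral_congr fun u _ => ?_
    refine VectorMeasure.setIntegral_congr_fun fun r hr => ?_
    simp only [hβ _ (sub_nonneg.2 hr.2)]
  eqn_right t s hs hst := by
    rw [hR.eqn_right t s hs hst]
    congr 1
    refine intervalIntegral.integral_congr fun u _ => ?_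
    congr 1
    refine VectorMeasure.setIntegral_congr_fun fun r hr => ?_
    simp only [hβ _ (sub_nonneg.2 hr.2)]

/-- For fixed `s` the left equation, together with vanishing for `t < s`, is the Volterra equation
with forcing `1_{[s,∞)}`; its locally bounded solution is unique. The right equation plays no role
here. -/
theorem IsDifferentialResolvent.eq_delayResolvent {η : SignedMeasure ℝ}
    (hην : ∀ (s : Set ℝ) (f : ℝ → ℝ), MeasurableSet s →
        (∫ᵛ r in s, f r ∂<•η) = ∫ r in s, h r * f r ∂ν)
    (hh : IsDelayDensity τ ν h) {β : ℝ → ℝ} {K : ℝ} (hK : 0 ≤ K) (hβm : Measurable β)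
    (hβ : ∀ v, 0 ≤ v → |β v| ≤ K) {R : ℝ → ℝ → ℝ} (hR : IsDifferentialResolvent η β R)
    {t s : ℝ} (ht : 0 ≤ t) (hs : 0 ≤ s) : R t s = delayResolvent ν h β t s := by
  -- Measurability is known only on nonnegative arguments, so the section is extended by `0` and
  -- factored through `Real.toNNReal`.
  have hm : Measurable ((Ici (0 : ℝ)).indicator fun v => R v s) := by
    have h1 : Measurable (fun v : ℝ => R (v.toNNReal : ℝ) ((⟨s, hs⟩ : ℝ≥0) : ℝ)) :=
      hR.measurable.comp (measurable_real_toNNReal.prodMk measurable_const)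
    have h2 : (Ici (0 : ℝ)).indicator (fun v => R v s) = (Ici (0 : ℝ)).indicator
        (fun v : ℝ => R (v.toNNReal : ℝ) ((⟨s, hs⟩ : ℝ≥0) : ℝ)) := by
      ext v
      by_cases h0 : v ∈ Ici (0 : ℝ)
      · simp only [indicator_of_mem h0, Real.coe_toNNReal v h0]
      · simp [indicator_of_notMem h0]
    rw [h2]
    exact h1.indicator measurableSet_Ici
  have hb : LocBdd ((Ici (0 : ℝ)).indicator fun v => R v s) := by
    refine ⟨hm, fun T => ?_⟩
    obtain ⟨C, hC⟩ := hR.locallyBounded (max T s)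
    refine ⟨C, fun t ht => ?_⟩
    rw [indicator_of_mem (show t ∈ Ici (0:ℝ) from ht.1)]
    exact hC t ⟨ht.1, ht.2.trans (le_max_left _ _)⟩ s ⟨hs, le_max_right _ _⟩
  have key := eq_of_volterra_eq (N := (Ici s).indicator fun _ => 1) (T := t)
    (w := (Ici (0 : ℝ)).indicator fun v => R v s)
    (w' := fun v => delayResolvent ν h β v s) hh hK hβm hβ hb (locBdd_delayResolvent hh hK hβm hβ s)
    (fun u hu => ?_) (fun u hu => delayResolvent_eq hh hK hβm hβ hu.1 s) t ⟨ht, le_rfl⟩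
  · rwa [indicator_of_mem (show t ∈ Ici (0:ℝ) from ht)] at key
  · rw [indicator_of_mem (show u ∈ Ici (0:ℝ) from hu.1)]
    have hvol : volterra ν h β ((Ici (0 : ℝ)).indicator fun v => R v s) u =
        ∫ x in (0 : ℝ)..u, ∫ᵛ r in Icc 0 x, β (x - r) * R (x - r) s ∂<•η := by
      refine intervalIntegral.integral_congr fun x _ => ?_
      rw [hην _ _ measurableSet_Icc, setIntegral_Icc_delay hh (fun v => β v * R v s)]
      congr 1
      ext v
      by_cases h0 : v ∈ Ici (0 : ℝ)
      · simp only [indicator_of_mem h0]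
      · simp only [indicator_of_notMem h0]
    by_cases hsu : s ≤ u
    · rw [hvol, indicator_of_mem (show u ∈ Ici s from hsu), hR.eqn_left u s hs hsu, add_comm]
    -- Before time `s` the whole history of `R(·, s)` is zero, so causality makes the Volterra term
    -- vanish as well.
    · rw [indicator_of_notMem (show u ∉ Ici s from hsu), hR.eq_zero u s hu.1 (not_le.1 hsu),
        add_zero]
      symm
      have hz : volterra ν h β ((Ici (0 : ℝ)).indicator fun v => R v s) u =
          volterra ν h β (fun _ => 0) u := by
        refine volterra_congr hh hu.1 fun v hv => ?_
        rw [indicator_of_mem (show v ∈ Ici (0:ℝ) from hv.1),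
          hR.eq_zero v s hv.1 (hv.2.trans_lt (not_le.1 hsu))]
      rw [hz]
      simp [volterra, delayInt]

theorem IsSemilinearSolution.eq_volterraSol {η : SignedMeasure ℝ}
    (hην : ∀ (s : Set ℝ) (f : ℝ → ℝ), MeasurableSet s →
        (∫ᵛ r in s, f r ∂<•η) = ∫ r in s, h r * f r ∂ν)
    (hh : IsDelayDensity τ ν h) {β N : ℝ → ℝ} {K : ℝ} (hK : 0 ≤ K) (hβm : Measurable β)
    (hβ : ∀ v, 0 ≤ v → |β v| ≤ K) (hN : LocBdd N) {w : ℝ → ℝ}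
    (hw : IsSemilinearSolution τ η β N w) {t : ℝ} (ht : -τ ≤ t) :
    w t = volterraSol ν h β N t := by
  by_cases h0 : 0 ≤ t
  swap
  · rw [hw.init t ht (not_le.1 h0), volterraSol,
      indicator_of_notMem (show t ∉ Ici (0:ℝ) from h0)]
  have hm : Measurable ((Ici (0 : ℝ)).indicator w) := by
    have h1 : Continuous (fun v : ℝ => w (max v 0)) :=
      hw.cont.comp_continuous (by fun_prop) (fun v => le_max_right v 0)
    have h2 : (Ici (0 : ℝ)).indicator w = (Ici (0 : ℝ)).indicator (fun v => w (max v 0)) := by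
      ext v
      by_cases h0 : v ∈ Ici (0 : ℝ)
      · simp only [indicator_of_mem h0, max_eq_left (mem_Ici.1 h0)]
      · simp [indicator_of_notMem h0]
    rw [h2]
    exact h1.measurable.indicator measurableSet_Ici
  have hb : LocBdd ((Ici (0 : ℝ)).indicator w) := by
    refine ⟨hm, fun T => ?_⟩
    obtain ⟨C, hC⟩ := isCompact_Icc.exists_bound_of_continuousOn
      (hw.cont.mono (Icc_subset_Ici_self (a := T) (b := (0 : ℝ))))
    exact ⟨C, fun t ht => by
      rw [indicator_of_mem (show t ∈ Ici (0:ℝ) from ht.1)]; exact hC t ht⟩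
  have key := eq_of_volterra_eq (N := N) (T := t) (w := (Ici (0 : ℝ)).indicator w)
    (w' := volterraSol ν h β N) hh hK hβm hβ hb (hN.volterraSol hh hK hβm hβ)
    (fun u hu => ?_) (fun u hu => volterraSol_eq hh hK hβm hβ hN hu.1) t ⟨h0, le_rfl⟩
  · rwa [indicator_of_mem (show t ∈ Ici (0:ℝ) from h0)] at key
  · rw [indicator_of_mem (show u ∈ Ici (0:ℝ) from hu.1), hw.eqn u hu.1]
    congr 1
    refine intervalIntegral.integral_congr fun x _ => ?_
    rw [hην _ _ measurableSet_Icc, setIntegral_Icc_delay hh (fun v => β v * w v)]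
    congr 1
    ext v
    by_cases h0 : v ∈ Ici (0 : ℝ)
    · simp only [indicator_of_mem h0]
    · simp only [indicator_of_notMem h0]

theorem continuousOn_volterra (hh : IsDelayDensity τ ν h) {β f : ℝ → ℝ} {K : ℝ}
    (hK : 0 ≤ K) (hβm : Measurable β) (hβ : ∀ v, 0 ≤ v → |β v| ≤ K) (hf : LocBdd f) :
    ContinuousOn (volterra ν h β f) (Ici 0) := by
  obtain ⟨-, -, lf⟩ := hf.delay hh hK hβm hβ
  intro t ht
  obtain ⟨C, hC⟩ := lf.2 (t + 1)
  have hc : ContinuousOn (volterra ν h β f) (uIcc 0 (t + 1)) := by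
    refine intervalIntegral.continuousOn_primitive_interval ?_
    have ht0 : (0 : ℝ) ≤ t + 1 := by linarith [mem_Ici.1 ht]
    rw [uIcc_of_le ht0, integrableOn_Icc_iff_integrableOn_Ioc,
      ← intervalIntegrable_iff_integrableOn_Ioc_of_le ht0]
    exact intervalIntegrable_of_bdd lf.1 ht0 hC
  have ht0 : (0 : ℝ) ≤ t + 1 := by linarith [mem_Ici.1 ht]
  rw [uIcc_of_le ht0] at hc
  refine (hc t ⟨ht, by linarith⟩).mono_of_mem_nhdsWithin ?_
  rw [mem_nhdsWithin]
  exact ⟨Iio (t + 1), isOpen_Iio, by simp, fun x hx => ⟨hx.2, le_of_lt hx.1⟩⟩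

theorem isSemilinearSolution_volterraSol {η : SignedMeasure ℝ}
    (hην : ∀ (s : Set ℝ) (f : ℝ → ℝ), MeasurableSet s →
        (∫ᵛ r in s, f r ∂<•η) = ∫ r in s, h r * f r ∂ν)
    (hh : IsDelayDensity τ ν h) {β N : ℝ → ℝ} {K : ℝ} (hK : 0 ≤ K) (hβm : Measurable β)
    (hβ : ∀ v, 0 ≤ v → |β v| ≤ K) (hN : LocBdd N) (hNc : ContinuousOn N (Ici 0)) :
    IsSemilinearSolution τ η β N (volterraSol ν h β N) where
  cont := by
    refine ((continuousOn_volterra hh hK hβm hβ (hN.volterraSol hh hK hβm hβ)).add hNc).congr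
      fun t ht => volterraSol_eq hh hK hβm hβ hN ht
  init t _ ht := by
    rw [volterraSol, indicator_of_notMem (show t ∉ Ici (0:ℝ) from not_le.2 ht)]
  eqn t ht := by
    rw [volterraSol_eq hh hK hβm hβ hN ht]
    congr 1
    refine intervalIntegral.integral_congr fun u _ => ?_
    rw [hην _ _ measurableSet_Icc, setIntegral_Icc_delay hh
      (fun v => β v * volterraSol ν h β N v)]

end
-- Minkowski's inequality and the calculus of `L^q` bounds
noncomputable section

variable {Ω : Type*} [MeasurableSpace Ω] {P : Measure Ω} [IsProbabilityMeasure P] {q : ℝ≥0∞}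

/-- Minkowski's integral inequality in the form needed for uniform bounds: Hölder in `s` against the
total mass, followed by Tonelli. -/
theorem eLpNorm_lintegral_le_of_forall {S : Type*} [MeasurableSpace S] {μ : Measure S} [SFinite μ]
    {F : S → Ω → ℝ≥0∞} (hF : Measurable (Function.uncurry F)) (hq1 : 1 ≤ q) (hqt : q ≠ ∞)
    {C : ℝ≥0∞} (hC : ∀ᵐ s ∂μ, eLpNorm (F s) q P ≤ C) :
    eLpNorm (fun ω => ∫⁻ s, F s ω ∂μ) q P ≤ μ univ * C := by
  have hq0 : q ≠ 0 := (zero_lt_one.trans_le hq1).ne'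
  set p := q.toReal with hp
  have hp1 : 1 ≤ p := by
    rw [hp, ← ENNReal.toReal_one]; exact ENNReal.toReal_mono hqt hq1
  have hp0 : 0 < p := by linarith
  have hpt : ∀ ω, (∫⁻ s, F s ω ∂μ) ^ p ≤ (μ univ ^ (1 - 1 / p)) ^ p * ∫⁻ s, F s ω ^ p ∂μ := by
    intro ω
    have hm : Measurable (fun s => F s ω) := hF.comp (measurable_id.prodMk measurable_const)
    have h1 := eLpNorm_le_eLpNorm_mul_rpow_measure_univ (μ := μ) hq1 hm.aestronglyMeasurable
    rw [eLpNorm_one_eq_lintegral_enorm, eLpNorm_eq_lintegral_rpow_enorm_toReal hq0 hqt] at h1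
    simp only [enorm_eq_self, ENNReal.toReal_one, div_one, ← hp] at h1
    have h2 := ENNReal.rpow_le_rpow h1 hp0.le
    rw [ENNReal.mul_rpow_of_nonneg _ _ hp0.le, ← ENNReal.rpow_mul, one_div_mul_cancel hp0.ne',
      ENNReal.rpow_one, mul_comm] at h2
    exact h2
  rw [eLpNorm_eq_lintegral_rpow_enorm_toReal hq0 hqt]
  simp only [enorm_eq_self, ← hp]
  have hFp : Measurable (Function.uncurry fun ω s => F s ω ^ p) :=
    (hF.comp measurable_swap).pow_const p
  have h3 : ∫⁻ ω, (∫⁻ s, F s ω ∂μ) ^ p ∂P ≤ (μ univ ^ (1 - 1 / p)) ^ p * (C ^ p * μ univ) := by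
    refine (lintegral_mono hpt).trans ?_
    have hFm : Measurable (fun ω => ∫⁻ s, F s ω ^ p ∂μ) := Measurable.lintegral_prod_right' hFp
    rw [lintegral_const_mul _ hFm, lintegral_lintegral_swap hFp.aemeasurable]
    gcongr
    rw [← lintegral_const]
    refine lintegral_mono_ae ?_
    filter_upwards [hC] with s hs
    rw [eLpNorm_eq_lintegral_rpow_enorm_toReal hq0 hqt] at hs
    simp only [enorm_eq_self, ← hp] at hs
    have := ENNReal.rpow_le_rpow hs hp0.le
    rwa [← ENNReal.rpow_mul, one_div_mul_cancel hp0.ne', ENNReal.rpow_one] at this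
  refine (ENNReal.rpow_le_rpow h3 (by positivity)).trans (le_of_eq ?_)
  have h4 : 0 ≤ 1 - 1 / p := by
    rw [sub_nonneg, div_le_one hp0]; exact hp1
  rw [ENNReal.mul_rpow_of_nonneg _ _ (by positivity), ENNReal.mul_rpow_of_nonneg _ _ (by positivity),
    ← ENNReal.rpow_mul, ← ENNReal.rpow_mul C, mul_one_div_cancel hp0.ne', ENNReal.rpow_one,
    ENNReal.rpow_one, mul_comm C, ← mul_assoc, ← ENNReal.rpow_add_of_nonneg _ _ h4 (by positivity),
    sub_add_cancel, ENNReal.rpow_one]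

theorem eLpNorm_const_mul_ennreal (hq1 : 1 ≤ q) (hqt : q ≠ ∞) (c : ℝ≥0∞) {f : Ω → ℝ≥0∞}
    (hf : Measurable f) : eLpNorm (fun ω => c * f ω) q P = c * eLpNorm f q P := by
  have hq0 : q ≠ 0 := (zero_lt_one.trans_le hq1).ne'
  have hpos : 0 < q.toReal := ENNReal.toReal_pos hq0 hqt
  rw [eLpNorm_eq_lintegral_rpow_enorm_toReal hq0 hqt,
    eLpNorm_eq_lintegral_rpow_enorm_toReal hq0 hqt]
  simp only [enorm_eq_self, ENNReal.mul_rpow_of_nonneg _ _ hpos.le]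
  rw [lintegral_const_mul _ (hf.pow_const _), ENNReal.mul_rpow_of_nonneg _ _ (by positivity),
    ← ENNReal.rpow_mul, mul_one_div_cancel hpos.ne', ENNReal.rpow_one]

/-- The unweighted inequality applied to `F / ρ` and the measure `ρ μ`. The weight `ρ` keeps the
exponential factor inside the integral, which is what preserves the contraction constant `1 / 2` in
`L^q`. -/
theorem eLpNorm_lintegral_le_weighted {S : Type*} [MeasurableSpace S] {μ : Measure S}
    [SFinite μ] {F : S → Ω → ℝ≥0∞} (hF : Measurable (Function.uncurry F)) (hq1 : 1 ≤ q)
    (hqt : q ≠ ∞) {C : ℝ≥0∞} {ρ : S → ℝ≥0∞} (hρ : Measurable ρ) (hρ0 : ∀ s, ρ s ≠ 0)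
    (hρt : ∀ s, ρ s ≠ ∞) (hC : ∀ᵐ s ∂μ, eLpNorm (F s) q P ≤ C * ρ s) :
    eLpNorm (fun ω => ∫⁻ s, F s ω ∂μ) q P ≤ (∫⁻ s, ρ s ∂μ) * C := by
  have e : (fun ω => ∫⁻ s, F s ω ∂μ) = fun ω => ∫⁻ s, (ρ s)⁻¹ * F s ω ∂(μ.withDensity ρ) := by
    ext ω
    have hm : Measurable (fun s => F s ω) := hF.comp (measurable_id.prodMk measurable_const)
    have hm' : Measurable (fun s => (ρ s)⁻¹ * F s ω) := hρ.inv.mul hm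
    rw [lintegral_withDensity_eq_lintegral_mul _ hρ hm']
    refine lintegral_congr fun s => ?_
    simp only [Pi.mul_apply, ← mul_assoc]
    rw [ENNReal.mul_inv_cancel (hρ0 s) (hρt s), one_mul]
  rw [e]
  have := eLpNorm_lintegral_le_of_forall (P := P) (μ := μ.withDensity ρ)
    (F := fun s ω => (ρ s)⁻¹ * F s ω) (C := C) ?_ hq1 hqt ?_
  · rwa [withDensity_apply _ MeasurableSet.univ, setLIntegral_univ] at this
  · exact (hρ.inv.comp measurable_fst).mul hF
  · refine (withDensity_absolutelyContinuous μ ρ).ae_le ?_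
    filter_upwards [hC] with s hs
    have hm : Measurable (F s) := hF.comp (measurable_const.prodMk measurable_id)
    rw [eLpNorm_const_mul_ennreal hq1 hqt _ hm]
    refine (mul_le_mul_right hs (ρ s)⁻¹).trans (le_of_eq ?_)
    rw [mul_comm C, ← mul_assoc, ENNReal.inv_mul_cancel (hρ0 s) (hρt s), one_mul]

/-- `f` is a.e. strongly measurable with `L^q` norm at most `C`. -/
def LpBdd (P : Measure Ω) (q : ℝ≥0∞) (f : Ω → ℝ) (C : ℝ) : Prop :=
  AEStronglyMeasurable f P ∧ eLpNorm f q P ≤ ENNReal.ofReal C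

namespace LpBdd

variable {f g : Ω → ℝ} {C D : ℝ}

theorem memLp (hf : LpBdd P q f C) : MemLp f q P :=
  ⟨hf.1, hf.2.trans_lt ENNReal.ofReal_lt_top⟩

theorem mono (hf : LpBdd P q f C) (h : C ≤ D) : LpBdd P q f D :=
  ⟨hf.1, hf.2.trans (ENNReal.ofReal_le_ofReal h)⟩

theorem congr (hf : LpBdd P q f C) (h : f =ᵐ[P] g) : LpBdd P q g C :=
  ⟨hf.1.congr h, by rw [← eLpNorm_congr_ae h]; exact hf.2⟩

theorem add (hq1 : 1 ≤ q) (hC : 0 ≤ C) (hD : 0 ≤ D) (hf : LpBdd P q f C) (hg : LpBdd P q g D) :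
    LpBdd P q (fun ω => f ω + g ω) (C + D) := by
  refine ⟨hf.1.add hg.1, (eLpNorm_add_le hf.1 hg.1 hq1).trans ?_⟩
  rw [ENNReal.ofReal_add hC hD]
  exact add_le_add hf.2 hg.2

theorem neg (hf : LpBdd P q f C) : LpBdd P q (fun ω => -f ω) C :=
  ⟨hf.1.neg, by rw [show (fun ω => -f ω) = -f from rfl, eLpNorm_neg]; exact hf.2⟩

theorem sub (hq1 : 1 ≤ q) (hC : 0 ≤ C) (hD : 0 ≤ D) (hf : LpBdd P q f C) (hg : LpBdd P q g D) :
    LpBdd P q (fun ω => f ω - g ω) (C + D) := by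
  simpa only [sub_eq_add_neg] using hf.add hq1 hC hD hg.neg

theorem const_mul (hf : LpBdd P q f C) (c : ℝ) : LpBdd P q (fun ω => c * f ω) (|c| * C) := by
  refine ⟨hf.1.const_mul c, ?_⟩
  rw [show (fun ω => c * f ω) = c • f from rfl, eLpNorm_const_smul,
    ENNReal.ofReal_mul (abs_nonneg c), ← Real.norm_eq_abs, ofReal_norm]
  gcongr; exact hf.2

theorem of_abs_le (hf : LpBdd P q f C) (hg : AEStronglyMeasurable g P)
    (h : ∀ᵐ ω ∂P, |g ω| ≤ |f ω|) : LpBdd P q g C :=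
  ⟨hg, (eLpNorm_mono_ae h).trans hf.2⟩

theorem of_bound (hf : AEStronglyMeasurable f P) (h : ∀ᵐ ω ∂P, |f ω| ≤ C) : LpBdd P q f C := by
  refine ⟨hf, (eLpNorm_le_of_ae_bound (C := C) h).trans ?_⟩
  simp

theorem const (c : ℝ) : LpBdd P q (fun _ => c) |c| :=
  of_bound aestronglyMeasurable_const (Eventually.of_forall fun _ => le_rfl)

theorem zero : LpBdd P q (fun _ => 0) 0 := by
  simpa using const (P := P) (q := q) 0

theorem sum (hq1 : 1 ≤ q) {ι : Type*} (s : Finset ι) {F : ι → Ω → ℝ} {c : ι → ℝ}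
    (hc : ∀ i ∈ s, 0 ≤ c i) (hF : ∀ i ∈ s, LpBdd P q (F i) (c i)) :
    LpBdd P q (fun ω => ∑ i ∈ s, F i ω) (∑ i ∈ s, c i) := by
  classical
  induction s using Finset.induction_on with
  | empty => simpa using zero
  | insert i s hi ih =>
    simp only [Finset.sum_insert hi]
    exact (hF i (Finset.mem_insert_self i s)).add hq1 (hc i (Finset.mem_insert_self i s))
      (Finset.sum_nonneg fun j hj => hc j (Finset.mem_insert_of_mem hj))
      (ih (fun j hj => hc j (Finset.mem_insert_of_mem hj))
        (fun j hj => hF j (Finset.mem_insert_of_mem hj)))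

/-- Hölder with both exponents equal to `2 q`. This is why second-order estimates in `L^q` below
start from first-order ones in `L^{2q}`. -/
theorem mul (hC : 0 ≤ C) (hf : LpBdd P (2 * q) f C) (hg : LpBdd P (2 * q) g D) :
    LpBdd P q (fun ω => f ω * g ω) (C * D) := by
  refine ⟨hf.1.mul hg.1, ?_⟩
  have : (2 * q).HolderTriple (2 * q) q := ⟨by
    rw [ENNReal.mul_inv (by simp) (by simp), ← two_mul, ← mul_assoc,
      ENNReal.mul_inv_cancel (by simp) (by simp), one_mul]⟩
  rw [ENNReal.ofReal_mul hC]
  exact (eLpNorm_smul_le_mul_eLpNorm (p := 2 * q) (q := 2 * q) hg.1 hf.1).trans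
    (mul_le_mul' hf.2 hg.2)

theorem bdd_mul (hf : AEStronglyMeasurable f P) (hC : 0 ≤ C) (h : ∀ᵐ ω ∂P, |f ω| ≤ C)
    (hg : LpBdd P q g D) : LpBdd P q (fun ω => f ω * g ω) (C * D) := by
  have h1 := hg.const_mul C
  rw [abs_of_nonneg hC] at h1
  refine h1.of_abs_le (hf.mul hg.1) ?_
  filter_upwards [h] with ω hω
  rw [abs_mul, abs_mul, abs_of_nonneg hC]
  gcongr

theorem integral (hq1 : 1 ≤ q) (hqt : q ≠ ∞) {S : Type*} [MeasurableSpace S] {μ : Measure S}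
    [IsFiniteMeasure μ] {F : S → Ω → ℝ} (hF : Measurable (Function.uncurry F))
    (hC : ∀ᵐ s ∂μ, LpBdd P q (F s) C) :
    LpBdd P q (fun ω => ∫ s, F s ω ∂μ) (μ.real univ * C) := by
  refine ⟨(StronglyMeasurable.integral_prod_right (f := fun ω s => F s ω)
    (hF.comp measurable_swap).stronglyMeasurable).aestronglyMeasurable, ?_⟩
  have h1 := eLpNorm_lintegral_le_of_forall (P := P) (μ := μ) (F := fun s ω => ‖F s ω‖ₑ)
    (C := ENNReal.ofReal C) hF.enorm hq1 hqt
    (by filter_upwards [hC] with s hs using by rw [eLpNorm_enorm]; exact hs.2)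
  refine (eLpNorm_mono_enorm fun ω => ?_).trans (h1.trans (le_of_eq ?_))
  · rw [enorm_eq_self]; exact enorm_integral_le_lintegral_enorm _
  · rw [ENNReal.ofReal_mul measureReal_nonneg, ofReal_measureReal]

theorem intervalIntegral (hq1 : 1 ≤ q) (hqt : q ≠ ∞) {F : ℝ → Ω → ℝ}
    (hF : Measurable (Function.uncurry F)) {a c : ℝ} (hac : a ≤ c)
    (hC : ∀ s ∈ Ioc a c, LpBdd P q (F s) C) :
    LpBdd P q (fun ω => ∫ s in a..c, F s ω) ((c - a) * C) := by
  simp only [intervalIntegral.integral_of_le hac]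
  have := LpBdd.integral (P := P) (μ := volume.restrict (Ioc a c)) hq1 hqt hF
    (by filter_upwards [ae_restrict_mem measurableSet_Ioc] with s hs using hC s hs)
  simpa [Measure.real, hac] using this

end LpBdd

/-! ### Grönwall's inequality in `L^q` -/

section Gronwall

variable {τ : ℝ} {ν : Measure ℝ} [IsFiniteMeasure ν]

/-- The positive delay operator `f ↦ K ∫_0^t ∫ 1_{a(s, r) ≥ 0} f(a(s, r)) ν(dr) ds`. -/
def eDelay (ν : Measure ℝ) (K : ℝ) (a : ℝ → ℝ → ℝ) (f : ℝ → ℝ≥0∞) (t : ℝ) : ℝ≥0∞ :=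
  ENNReal.ofReal K * ∫⁻ s in Ioc 0 t, ∫⁻ r, (Ici 0).indicator f (a s r) ∂ν

theorem enorm_integral_le_eDelay {K : ℝ} {a : ℝ → ℝ → ℝ} {f : ℝ → ℝ≥0∞} {t : ℝ} (ht : 0 ≤ t)
    {G : ℝ → ℝ → ℝ} (hG : ∀ s ∈ Ioc 0 t, ∀ᵐ r ∂ν,
      ‖G s r‖ₑ ≤ ENNReal.ofReal K * (Ici 0).indicator f (a s r)) :
    ‖∫ s in (0 : ℝ)..t, ∫ r, G s r ∂ν‖ₑ ≤ eDelay ν K a f t := by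
  rw [intervalIntegral.integral_of_le ht, eDelay]
  refine (enorm_integral_le_lintegral_enorm _).trans ?_
  rw [← lintegral_const_mul' _ _ ENNReal.ofReal_ne_top]
  refine setLIntegral_mono' measurableSet_Ioc fun s hs => ?_
  refine (enorm_integral_le_lintegral_enorm _).trans ?_
  rw [← lintegral_const_mul' _ _ ENNReal.ofReal_ne_top]
  exact lintegral_mono_ae (hG s hs)

theorem measurable_eDelay {K : ℝ} {a : ℝ → ℝ → ℝ} (ha : Measurable (Function.uncurry a))
    {f : ℝ → Ω → ℝ≥0∞} (hf : Measurable (Function.uncurry f)) :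
    Measurable (Function.uncurry fun t ω => eDelay ν K a (fun v => f v ω) t) := by
  have h1 : Measurable (fun z : ((ℝ × Ω) × ℝ) × ℝ =>
      (Ici (0 : ℝ)).indicator (fun v => f v z.1.1.2) (a z.1.2 z.2)) := by
    have m1 : Measurable (fun z : ((ℝ × Ω) × ℝ) × ℝ => a z.1.2 z.2) :=
      ha.comp ((measurable_snd.comp measurable_fst).prodMk measurable_snd)
    have m2 : Measurable (fun z : ((ℝ × Ω) × ℝ) × ℝ => f (a z.1.2 z.2) z.1.1.2) :=
      hf.comp (m1.prodMk (measurable_snd.comp (measurable_fst.comp measurable_fst)))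
    exact m2.indicator (s := {z : ((ℝ × Ω) × ℝ) × ℝ | a z.1.2 z.2 ∈ Ici (0:ℝ)}) (m1 measurableSet_Ici)
  have h2 := h1.lintegral_prod_right' (ν := ν)
  have h3 : Measurable (fun z : (ℝ × Ω) × ℝ => (Ioc 0 z.1.1).indicator
      (fun s => ∫⁻ r, (Ici (0 : ℝ)).indicator (fun v => f v z.1.2) (a s r) ∂ν) z.2) :=
    h2.indicator (s := {z : (ℝ × Ω) × ℝ | z.2 ∈ Ioc 0 z.1.1})
      ((measurableSet_lt measurable_const measurable_snd).inter
        (measurableSet_le measurable_snd (measurable_fst.comp measurable_fst)))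
  have h4 := h3.lintegral_prod_right' (ν := (volume : Measure ℝ))
  simp only [lintegral_indicator measurableSet_Ioc] at h4
  exact h4.const_mul _

theorem eDelay_add {K : ℝ} {a : ℝ → ℝ → ℝ} (ha : Measurable (Function.uncurry a))
    {f g : ℝ → ℝ≥0∞} (hf : Measurable f) (t : ℝ) :
    eDelay ν K a (fun v => f v + g v) t = eDelay ν K a f t + eDelay ν K a g t := by
  have h1 : Measurable (fun z : ℝ × ℝ => (Ici (0 : ℝ)).indicator f (a z.1 z.2)) :=
    (hf.indicator measurableSet_Ici).comp ha
  rw [eDelay, eDelay, eDelay, ← mul_add, ← lintegral_add_left (h1.lintegral_prod_right' (ν := ν))]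
  congr 1
  refine lintegral_congr fun s => ?_
  have h2 : Measurable (fun r => (Ici (0 : ℝ)).indicator f (a s r)) :=
    h1.comp (measurable_const.prodMk measurable_id)
  rw [← lintegral_add_left h2]
  refine lintegral_congr fun r => ?_
  exact congrFun (indicator_add (Ici (0:ℝ)) f g) (a s r)

theorem eDelay_mono {K : ℝ} {a : ℝ → ℝ → ℝ} (hν : ∀ᵐ r ∂ν, r ∈ Icc 0 τ)
    (ha : ∀ s, ∀ r ∈ Icc 0 τ, a s r ≤ s) {f g : ℝ → ℝ≥0∞} {T t : ℝ} (ht : t ≤ T)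
    (hfg : ∀ v ∈ Icc 0 T, f v ≤ g v) : eDelay ν K a f t ≤ eDelay ν K a g t := by
  unfold eDelay
  gcongr 1
  refine setLIntegral_mono' measurableSet_Ioc fun s hs => ?_
  refine lintegral_mono_ae ?_
  filter_upwards [hν] with r hr
  by_cases h0 : a s r ∈ Ici (0 : ℝ)
  · rw [indicator_of_mem h0, indicator_of_mem h0]
    exact hfg _ ⟨h0, (ha s r hr).trans (hs.2.trans ht)⟩
  · simp [indicator_of_notMem h0]

/-- The integral of the exponential weight, isolated because both the pathwise and the `L^q`
contraction estimates end with it. -/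
theorem weight_eDelay {K M t : ℝ} (hK : 0 ≤ K) (hM : 0 ≤ M) (ht : 0 ≤ t) :
    ENNReal.ofReal K * ((∫⁻ s in Ioc 0 t, ENNReal.ofReal (Real.exp (volterraRate ν K * s))) *
      (ν univ * ENNReal.ofReal M)) ≤ ENNReal.ofReal (M / 2 * Real.exp (volterraRate ν K * t)) := by
  have hl := volterraRate_pos (ν := ν) hK
  set lam := volterraRate ν K with hlam
  have h1 := integral_exp_rate_le (lam := lam) (L := K * ν.real univ) (M := M) (t := t) hl
    (by rw [hlam, volterraRate]; linarith) hM
  have hi : IntegrableOn (fun s => Real.exp (lam * s)) (Ioc 0 t) :=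
    (Continuous.integrableOn_Icc (by fun_prop)).mono_set Ioc_subset_Icc_self
  rw [← ofReal_integral_eq_lintegral_ofReal hi (Eventually.of_forall fun _ => (Real.exp_pos _).le),
    ← intervalIntegral.integral_of_le ht, ← ofReal_measureReal (μ := ν) (s := univ),
    ← ENNReal.ofReal_mul measureReal_nonneg, ← ENNReal.ofReal_mul, ← ENNReal.ofReal_mul hK]
  · refine ENNReal.ofReal_le_ofReal ?_
    rw [intervalIntegral.integral_const_mul, intervalIntegral.integral_const_mul] at h1
    have : 0 ≤ K * ν.real univ * M / lam := by positivity
    nlinarith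
  · exact intervalIntegral.integral_nonneg ht fun _ _ => (Real.exp_pos _).le

theorem eDelay_le {K M T t : ℝ} {a : ℝ → ℝ → ℝ} (hν : ∀ᵐ r ∂ν, r ∈ Icc 0 τ)
    (ha : ∀ s, ∀ r ∈ Icc 0 τ, a s r ≤ s) (hK : 0 ≤ K) (hM : 0 ≤ M) {f : ℝ → ℝ≥0∞}
    (hf : ∀ v ∈ Icc 0 T, f v ≤ ENNReal.ofReal (M * Real.exp (volterraRate ν K * v)))
    (ht : t ∈ Icc 0 T) :
    eDelay ν K a f t ≤ ENNReal.ofReal (M / 2 * Real.exp (volterraRate ν K * t)) := by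
  have hl := volterraRate_pos (ν := ν) hK
  refine le_trans ?_ (weight_eDelay (ν := ν) hK hM ht.1)
  unfold eDelay
  gcongr 1
  rw [← lintegral_mul_const' _ _ (ENNReal.mul_ne_top (measure_ne_top _ _) ENNReal.ofReal_ne_top)]
  refine setLIntegral_mono' measurableSet_Ioc fun s hs => ?_
  have : ENNReal.ofReal (Real.exp (volterraRate ν K * s)) * (ν univ * ENNReal.ofReal M) =
      ∫⁻ _, ENNReal.ofReal (M * Real.exp (volterraRate ν K * s)) ∂ν := by
    rw [lintegral_const, ENNReal.ofReal_mul hM]; ring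
  rw [this]
  refine lintegral_mono_ae ?_
  filter_upwards [hν] with r hr
  by_cases h0 : a s r ∈ Ici (0 : ℝ)
  · rw [indicator_of_mem h0]
    refine (hf _ ⟨h0, (ha s r hr).trans (hs.2.trans ht.2)⟩).trans (ENNReal.ofReal_le_ofReal ?_)
    gcongr; exact ha s r hr
  · simp [indicator_of_notMem h0]

/-- The factor `1 / 2` survives in `L^q`: weighted Minkowski in `s` and plain Minkowski in `r`, with
`a s r ≤ s` controlling the weight. The condition on `a` covers both the exact lag `s - r` and its
discretization. -/
theorem eLpNorm_eDelay_le {K M T t : ℝ} {a : ℝ → ℝ → ℝ} (ham : Measurable (Function.uncurry a))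
    (hν : ∀ᵐ r ∂ν, r ∈ Icc 0 τ)
    (ha : ∀ s, ∀ r ∈ Icc 0 τ, a s r ≤ s) (hq1 : 1 ≤ q) (hqt : q ≠ ∞) (hK : 0 ≤ K) (hM : 0 ≤ M)
    {f : ℝ → Ω → ℝ≥0∞} (hfm : Measurable (Function.uncurry f))
    (hf : ∀ v ∈ Icc 0 T, eLpNorm (f v) q P ≤
      ENNReal.ofReal (M * Real.exp (volterraRate ν K * v))) (ht : t ∈ Icc 0 T) :
    eLpNorm (fun ω => eDelay ν K a (fun v => f v ω) t) q P ≤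
      ENNReal.ofReal (M / 2 * Real.exp (volterraRate ν K * t)) := by
  have hl := volterraRate_pos (ν := ν) hK
  refine le_trans ?_ (weight_eDelay (ν := ν) hK hM ht.1)
  have m3 : Measurable (Function.uncurry fun (z : ℝ × ℝ) ω =>
      (Ici (0 : ℝ)).indicator (fun v => f v ω) (a z.1 z.2)) := by
    have m1 : Measurable (fun z : (ℝ × ℝ) × Ω => a z.1.1 z.1.2) := ham.comp measurable_fst
    have m2 : Measurable (fun z : (ℝ × ℝ) × Ω => f (a z.1.1 z.1.2) z.2) :=
      hfm.comp (m1.prodMk measurable_snd)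
    exact m2.indicator (s := {z : (ℝ × ℝ) × Ω | a z.1.1 z.1.2 ∈ Ici (0:ℝ)})
      (m1 measurableSet_Ici)
  have m4 : Measurable (Function.uncurry fun (s : ℝ) (ω : Ω) =>
      ∫⁻ r, (Ici (0 : ℝ)).indicator (fun v => f v ω) (a s r) ∂ν) := by
    have : Measurable (fun z : (ℝ × Ω) × ℝ => ((z.1.1, z.2), z.1.2)) := by fun_prop
    exact (m3.comp this).lintegral_prod_right' (ν := ν)
  have e : eLpNorm (fun ω => eDelay ν K a (fun v => f v ω) t) q P = ENNReal.ofReal K *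
      eLpNorm (fun ω => ∫⁻ s in Ioc 0 t, ∫⁻ r, (Ici (0 : ℝ)).indicator (fun v => f v ω)
        (a s r) ∂ν) q P := by
    exact eLpNorm_const_mul_ennreal hq1 hqt _ (m4.comp measurable_swap).lintegral_prod_right'
  rw [e]
  gcongr 1
  refine eLpNorm_lintegral_le_weighted m4 hq1 hqt (by fun_prop)
    (fun s => (ENNReal.ofReal_pos.2 (Real.exp_pos _)).ne') (fun s => ENNReal.ofReal_ne_top) ?_
  filter_upwards [ae_restrict_mem measurableSet_Ioc] with s hs
  rw [mul_assoc, ← ENNReal.ofReal_mul hM]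
  have m5 : Measurable (fun z : ℝ × Ω => ((s, z.1), z.2)) := by fun_prop
  refine eLpNorm_lintegral_le_of_forall (F := fun r ω => (Ici (0 : ℝ)).indicator
    (fun v => f v ω) (a s r)) (m3.comp m5) hq1 hqt ?_
  filter_upwards [hν] with r hr
  by_cases h0 : a s r ∈ Ici (0 : ℝ)
  · simp only [indicator_of_mem h0]
    refine (hf _ ⟨h0, (ha s r hr).trans (hs.2.trans ht.2)⟩).trans (ENNReal.ofReal_le_ofReal ?_)
    gcongr; exact ha s r hr
  · simp [indicator_of_notMem h0]

/-- Grönwall's inequality in `L^q`, uniformly in time and without an a priori moment bound. -/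
theorem LpBdd.gronwall {K T ε : ℝ} {a : ℝ → ℝ → ℝ} (ham : Measurable (Function.uncurry a))
    (hν : ∀ᵐ r ∂ν, r ∈ Icc 0 τ)
    (ha : ∀ s, ∀ r ∈ Icc 0 τ, a s r ≤ s) (hq1 : 1 ≤ q) (hqt : q ≠ ∞) (hK : 0 ≤ K) (hε : 0 ≤ ε)
    {w g : ℝ → Ω → ℝ} (hw : Measurable (Function.uncurry w))
    (hg : Measurable (Function.uncurry g))
    (hwb : ∀ᵐ ω ∂P, ∃ C, ∀ t ∈ Icc 0 T, |w t ω| ≤ C)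
    (hineq : ∀ᵐ ω ∂P, ∀ t ∈ Icc 0 T,
      ‖w t ω‖ₑ ≤ ‖g t ω‖ₑ + eDelay ν K a (fun v => ‖w v ω‖ₑ) t)
    (hgb : ∀ t ∈ Icc 0 T, LpBdd P q (g t) ε) {t : ℝ} (ht : t ∈ Icc 0 T) :
    LpBdd P q (w t) (ε * 2 * Real.exp (volterraRate ν K * T)) := by
  have hl := volterraRate_pos (ν := ν) hK
  set lam := volterraRate ν K with hlam
  -- With `D` the positive delay operator, `G k = D^k |g|` and `Q k = D^k |w|`. The `G k` are
  -- controlled in `L^q`, the `Q k` only path by path; this is why no moment of `w` is needed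
  -- beforehand.
  let G : ℕ → ℝ → Ω → ℝ≥0∞ := fun k => Nat.rec (fun t ω => ‖g t ω‖ₑ)
    (fun _ f t ω => eDelay ν K a (fun v => f v ω) t) k
  let Q : ℕ → ℝ → Ω → ℝ≥0∞ := fun k => Nat.rec (fun t ω => ‖w t ω‖ₑ)
    (fun _ f t ω => eDelay ν K a (fun v => f v ω) t) k
  have hGm : ∀ k, Measurable (Function.uncurry (G k)) := by
    intro k
    induction k with
    | zero => exact hg.enorm
    | succ k ih => exact measurable_eDelay ham ih
  have hGb : ∀ k, ∀ v ∈ Icc 0 T, eLpNorm (G k v) q P ≤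
      ENNReal.ofReal (ε * (1 / 2) ^ k * Real.exp (lam * v)) := by
    intro k
    induction k with
    | zero =>
      intro v hv
      rw [show G 0 v = fun ω => ‖g v ω‖ₑ from rfl, eLpNorm_enorm]
      refine (hgb v hv).2.trans (ENNReal.ofReal_le_ofReal ?_)
      simpa using le_mul_of_one_le_right hε (Real.one_le_exp (mul_nonneg hl.le hv.1))
    | succ k ih =>
      intro v hv
      refine (eLpNorm_eDelay_le ham hν ha hq1 hqt hK (by positivity) (hGm k) ih hv).trans
        (ENNReal.ofReal_le_ofReal (le_of_eq ?_))
      rw [pow_succ]; ring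
  have hpath : ∀ᵐ ω ∂P, ∀ v ∈ Icc 0 T, ‖w v ω‖ₑ ≤ ∑' k, G k v ω := by
    filter_upwards [hwb, hineq] with ω hbω hω
    obtain ⟨C, hC⟩ := hbω
    -- Iterating the inequality gives `|w| ≤ Σ_{k<n} D^k |g| + D^n |w|`; by the pathwise contraction
    -- the last term tends to `0`.
    have h1 : ∀ n, ∀ v ∈ Icc 0 T, ‖w v ω‖ₑ ≤ ∑ k ∈ Finset.range n, G k v ω + Q n v ω := by
      intro n
      induction n with
      | zero => intro v hv; simp [Q]
      | succ n ih =>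
        intro v hv
        have hsum : ∀ m, Measurable (fun v => ∑ k ∈ Finset.range m, G k v ω) := fun m =>
          Finset.measurable_fun_sum _ fun k _ =>
            (hGm k).comp (measurable_id.prodMk measurable_const)
        have h2 : ∀ m, eDelay ν K a (fun v => ∑ k ∈ Finset.range m, G k v ω) v =
            ∑ k ∈ Finset.range m, G (k + 1) v ω := by
          intro m
          induction m with
          | zero => simp [eDelay]
          | succ m ihm =>
            simp only [Finset.sum_range_succ]
            rw [eDelay_add ham (hsum m), ihm]
        calc ‖w v ω‖ₑ ≤ ‖g v ω‖ₑ + eDelay ν K a (fun v => ‖w v ω‖ₑ) v := hω v hv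
          _ ≤ ‖g v ω‖ₑ + eDelay ν K a
              (fun v => ∑ k ∈ Finset.range n, G k v ω + Q n v ω) v := by
            gcongr 1
            exact eDelay_mono hν ha hv.2 ih
          _ = ∑ k ∈ Finset.range (n + 1), G k v ω + Q (n + 1) v ω := by
            rw [eDelay_add ham (hsum n), h2, Finset.sum_range_succ']
            rw [show Q (n + 1) v ω = eDelay ν K a (fun v => Q n v ω) v from rfl,
              show G 0 v ω = ‖g v ω‖ₑ from rfl]
            ring
    have h2 : ∀ n, ∀ v ∈ Icc 0 T, Q n v ω ≤
        ENNReal.ofReal (|C| * (1 / 2) ^ n * Real.exp (lam * v)) := by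
      intro n
      induction n with
      | zero =>
        intro v hv
        rw [show Q 0 v ω = ‖w v ω‖ₑ from rfl, ← ofReal_norm]
        refine ENNReal.ofReal_le_ofReal (((hC v hv).trans (le_abs_self C)).trans ?_)
        simpa using le_mul_of_one_le_right (abs_nonneg C)
          (Real.one_le_exp (mul_nonneg hl.le hv.1))
      | succ n ih =>
        intro v hv
        refine (eDelay_le hν ha hK (by positivity) ih hv).trans
          (ENNReal.ofReal_le_ofReal (le_of_eq ?_))
        rw [pow_succ]; ring
    intro v hv
    have hlim : Tendsto (fun n : ℕ => ∑' k, G k v ω +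
        ENNReal.ofReal (|C| * (1 / 2) ^ n * Real.exp (lam * v))) atTop
        (𝓝 (∑' k, G k v ω + ENNReal.ofReal (|C| * 0 * Real.exp (lam * v)))) := by
      refine tendsto_const_nhds.add (ENNReal.tendsto_ofReal ?_)
      exact ((tendsto_pow_atTop_nhds_zero_of_lt_one (by norm_num)
        (by norm_num)).const_mul _).mul_const _
    simp only [mul_zero, zero_mul, ENNReal.ofReal_zero, add_zero] at hlim
    refine ge_of_tendsto' hlim fun n => (h1 n v hv).trans (add_le_add ?_ (h2 n v hv))
    exact ENNReal.sum_le_tsum _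
  refine ⟨(hw.comp (measurable_const.prodMk measurable_id)).aestronglyMeasurable, ?_⟩
  have hsumb : ∀ n, eLpNorm (fun ω => ∑ k ∈ Finset.range n, G k t ω) q P ≤
      ENNReal.ofReal (ε * 2 * Real.exp (lam * T)) := by
    intro n
    have hm : ∀ k, AEStronglyMeasurable (G k t) P := fun k =>
      ((hGm k).comp (measurable_const.prodMk measurable_id)).aestronglyMeasurable
    have h3 : eLpNorm (fun ω => ∑ k ∈ Finset.range n, G k t ω) q P ≤
        ∑ k ∈ Finset.range n, ENNReal.ofReal (ε * (1 / 2) ^ k * Real.exp (lam * t)) := by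
      have := eLpNorm_sum_le (s := Finset.range n) (f := fun k => G k t) (fun k _ => hm k) hq1
      rw [show (∑ k ∈ Finset.range n, G k t) = fun ω => ∑ k ∈ Finset.range n, G k t ω from by
        ext ω; simp] at this
      exact this.trans (Finset.sum_le_sum fun k _ => hGb k t ht)
    refine h3.trans ?_
    rw [← ENNReal.ofReal_sum_of_nonneg (fun k _ => by positivity)]
    refine ENNReal.ofReal_le_ofReal ?_
    rw [← Finset.sum_mul, ← Finset.mul_sum]
    have h4 : ∑ k ∈ Finset.range n, (1 / 2 : ℝ) ^ k ≤ 2 := by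
      have := summable_geometric_two.sum_le_tsum (Finset.range n) (fun _ _ => by positivity)
      rwa [tsum_geometric_two] at this
    gcongr; exact ht.2
  have hq0 : q ≠ 0 := (zero_lt_one.trans_le hq1).ne'
  have hpos : 0 < q.toReal := ENNReal.toReal_pos hq0 hqt
  calc eLpNorm (w t) q P ≤ eLpNorm (fun ω => ∑' k, G k t ω) q P := by
        refine eLpNorm_mono_enorm_ae ?_
        filter_upwards [hpath] with ω hω
        simpa using hω t ht
    _ ≤ ENNReal.ofReal (ε * 2 * Real.exp (lam * T)) := by
        rw [eLpNorm_eq_lintegral_rpow_enorm_toReal hq0 hqt, one_div,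
          ENNReal.rpow_inv_le_iff hpos]
        simp only [enorm_eq_self]
        -- Monotone convergence transfers the uniform `L^q` bound from the partial sums to the
        -- series.
        have e : ∀ ω, (∑' k, G k t ω) ^ q.toReal =
            ⨆ n, (∑ k ∈ Finset.range n, G k t ω) ^ q.toReal := by
          intro ω
          rw [ENNReal.tsum_eq_iSup_nat]
          exact (ENNReal.orderIsoRpow q.toReal hpos).map_iSup _
        simp only [e]
        rw [lintegral_iSup]
        · refine iSup_le fun n => ?_
          have := hsumb n
          rw [eLpNorm_eq_lintegral_rpow_enorm_toReal hq0 hqt, one_div,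
            ENNReal.rpow_inv_le_iff hpos] at this
          simpa only [enorm_eq_self] using this
        · intro n
          exact (Finset.measurable_fun_sum _ fun k _ =>
            (hGm k).comp (measurable_const.prodMk measurable_id)).pow_const _
        · intro n m hnm ω
          refine ENNReal.rpow_le_rpow ?_ hpos.le
          exact Finset.sum_le_sum_of_subset (Finset.range_mono hnm)

end Gronwall

end
noncomputable section

variable {Ω : Type*} [MeasurableSpace Ω] {P : Measure Ω} [IsProbabilityMeasure P] {q : ℝ≥0∞}

/-! ### A discrete sewing lemma -/

section Sewing

/-- A discrete sewing lemma in `L^q`, for blocks of length at most `2 ^ N`. -/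
theorem LpBdd.sewing_dyadic {f G : ℕ → Ω → ℝ} {A B α β : ℝ} {m : ℕ} (hq1 : 1 ≤ q) (hA : 0 ≤ A)
    (hB : 0 ≤ B) (hβ : 0 ≤ β) (hαβ : 1 < α + β)
    (hf : ∀ i j, i ≤ j → j ≤ m → LpBdd P (2 * q) (fun ω => f j ω - f i ω)
      (A * ((j - i : ℕ) : ℝ) ^ α))
    (hG : ∀ i j, i ≤ j → j ≤ m → LpBdd P (2 * q) (fun ω => ∑ k ∈ Finset.Ico i j, G k ω)
      (B * ((j - i : ℕ) : ℝ) ^ β)) (N : ℕ) :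
    ∀ i j, i ≤ j → j ≤ m → j - i ≤ 2 ^ N →
      LpBdd P q (fun ω => ∑ k ∈ Finset.Ico i j, f k ω * G k ω -
        f i ω * ∑ k ∈ Finset.Ico i j, G k ω)
        (1 / (2 ^ (α + β) - 2) * (A * B) * ((2 : ℝ) ^ N) ^ (α + β)) := by
  have h2 : (2 : ℝ) < 2 ^ (α + β) := by
    simpa using Real.rpow_lt_rpow_of_exponent_lt (x := 2) (by norm_num) hαβ
  have hc : 0 < 1 / ((2 : ℝ) ^ (α + β) - 2) := by
    apply one_div_pos.2; linarith
  set c := 1 / ((2 : ℝ) ^ (α + β) - 2) with hcdef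
  -- The constant is chosen so that two half blocks plus the cross term of size `1` reproduce
  -- exactly the bound for a block of double length; this requires `α + β > 1`.
  have hcc : 2 * c + 1 = c * 2 ^ (α + β) := by
    rw [hcdef]; field_simp [(sub_pos.2 h2).ne']; ring
  induction N with
  | zero =>
    intro i j hij hjm hle
    have : (fun ω => ∑ k ∈ Finset.Ico i j, f k ω * G k ω -
        f i ω * ∑ k ∈ Finset.Ico i j, G k ω) = fun _ => 0 := by
      ext ω
      rcases Nat.eq_or_lt_of_le hij with rfl | hlt
      · simp
      · have : j = i + 1 := by simp at hle; omega
        subst this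
        simp
    rw [this]
    exact LpBdd.zero.mono (by positivity)
  | succ N ih =>
    intro i j hij hjm hle
    by_cases hs : j - i ≤ 2 ^ N
    · refine (ih i j hij hjm hs).mono ?_
      gcongr 3
      · norm_num
      · omega
    · set u := i + 2 ^ N with hu
      have huj : u ≤ j := by omega
      have hju : j - u ≤ 2 ^ N := by rw [pow_succ] at hle; omega
      -- Splitting at `u` makes the defect additive up to the cross term `(f u - f i) Σ_{[u,j)} G`,
      -- whose two factors are bounded in `L^{2q}`.
      have e : (fun ω => ∑ k ∈ Finset.Ico i j, f k ω * G k ω -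
          f i ω * ∑ k ∈ Finset.Ico i j, G k ω) = fun ω =>
          ((∑ k ∈ Finset.Ico i u, f k ω * G k ω - f i ω * ∑ k ∈ Finset.Ico i u, G k ω) +
          (∑ k ∈ Finset.Ico u j, f k ω * G k ω - f u ω * ∑ k ∈ Finset.Ico u j, G k ω)) +
          (f u ω - f i ω) * ∑ k ∈ Finset.Ico u j, G k ω := by
        ext ω
        rw [← Finset.sum_Ico_consecutive _ (show i ≤ u by omega) huj,
          ← Finset.sum_Ico_consecutive _ (show i ≤ u by omega) huj]
        ring
      rw [e]
      have b1 := ih i u (by omega) (by omega) (by omega)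
      have b2 := ih u j huj hjm hju
      have b3 := (hf i u (by omega) (by omega)).mul (by positivity) (hG u j huj hjm)
      refine ((b1.add hq1 (by positivity) (by positivity) b2).add hq1 (by positivity)
        (by positivity) b3).mono ?_
      have e1 : ((u - i : ℕ) : ℝ) = 2 ^ N := by
        rw [hu, Nat.add_sub_cancel_left]; push_cast; rfl
      have e2 : ((j - u : ℕ) : ℝ) ≤ 2 ^ N := by exact_mod_cast hju
      have e3 : ((j - u : ℕ) : ℝ) ^ β ≤ ((2 : ℝ) ^ N) ^ β := by gcongr
      rw [e1]
      have e4 : ((2 : ℝ) ^ (N + 1)) ^ (α + β) = 2 ^ (α + β) * ((2 : ℝ) ^ N) ^ (α + β) := by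
        rw [pow_succ, mul_comm, Real.mul_rpow (by norm_num) (by positivity)]
      have e5 : A * ((2 : ℝ) ^ N) ^ α * (B * ((j - u : ℕ) : ℝ) ^ β) ≤
          A * B * ((2 : ℝ) ^ N) ^ (α + β) := by
        rw [Real.rpow_add (by positivity)]
        calc A * ((2 : ℝ) ^ N) ^ α * (B * ((j - u : ℕ) : ℝ) ^ β)
            ≤ A * ((2 : ℝ) ^ N) ^ α * (B * ((2 : ℝ) ^ N) ^ β) := by gcongr
          _ = _ := by ring
      rw [e4]
      calc _ ≤ c * (A * B) * ((2 : ℝ) ^ N) ^ (α + β) + c * (A * B) * ((2 : ℝ) ^ N) ^ (α + β) +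
            A * B * ((2 : ℝ) ^ N) ^ (α + β) := by gcongr
        _ = (2 * c + 1) * (A * B * ((2 : ℝ) ^ N) ^ (α + β)) := by ring
        _ = _ := by rw [hcc]; ring

/-- A discrete sewing lemma in `L^q`. -/
theorem LpBdd.sewing {f G : ℕ → Ω → ℝ} {A B α β : ℝ} {m : ℕ} (hq1 : 1 ≤ q) (hA : 0 ≤ A)
    (hB : 0 ≤ B) (hβ : 0 ≤ β) (hαβ : 1 < α + β)
    (hf : ∀ i j, i ≤ j → j ≤ m → LpBdd P (2 * q) (fun ω => f j ω - f i ω)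
      (A * ((j - i : ℕ) : ℝ) ^ α))
    (hG : ∀ i j, i ≤ j → j ≤ m → LpBdd P (2 * q) (fun ω => ∑ k ∈ Finset.Ico i j, G k ω)
      (B * ((j - i : ℕ) : ℝ) ^ β)) :
    LpBdd P q (fun ω => ∑ k ∈ Finset.range m, f k ω * G k ω -
      f 0 ω * ∑ k ∈ Finset.range m, G k ω)
      (2 ^ (α + β) / (2 ^ (α + β) - 2) * (A * B) * (m : ℝ) ^ (α + β)) := by
  have h2 : (2 : ℝ) < 2 ^ (α + β) := by
    simpa using Real.rpow_lt_rpow_of_exponent_lt (x := 2) (by norm_num) hαβ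
  rcases Nat.eq_zero_or_pos m with rfl | hm
  · simp only [Finset.range_zero, Finset.sum_empty, mul_zero, sub_zero]
    refine LpBdd.zero.mono ?_
    have : 0 ≤ (2 : ℝ) ^ (α + β) - 2 := by linarith
    positivity
  have key := LpBdd.sewing_dyadic hq1 hA hB hβ hαβ hf hG (Nat.clog 2 m) 0 m (Nat.zero_le _)
    le_rfl (by rw [Nat.sub_zero]; exact Nat.le_pow_clog (by norm_num) m)
  rw [← Finset.range_eq_Ico] at key
  refine key.mono ?_
  -- The least power of two above `m` is at most `2 m`, so rounding up costs only the factor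
  -- `2^{α+β}`.
  have h3 : (2 : ℝ) ^ (Nat.clog 2 m) ≤ 2 * m := by
    have : 2 ^ (Nat.clog 2 m) ≤ 2 * m := by
      rcases Nat.eq_or_lt_of_le (show 1 ≤ m from hm) with rfl | h1
      · simp
      · have h4 := Nat.pow_pred_clog_lt_self (b := 2) (by norm_num) h1
        have h5 : 0 < Nat.clog 2 m := Nat.clog_pos (by norm_num) h1
        have h6 : 2 ^ (Nat.clog 2 m) = 2 * 2 ^ (Nat.clog 2 m).pred := by
          rw [← pow_succ', ← Nat.succ_eq_add_one, Nat.succ_pred_eq_of_pos h5]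
        omega
    exact_mod_cast this
  have h4 : ((2 : ℝ) ^ (Nat.clog 2 m)) ^ (α + β) ≤ 2 ^ (α + β) * (m : ℝ) ^ (α + β) := by
    rw [← Real.mul_rpow (by norm_num) (by positivity)]
    gcongr
  have h5 : 0 ≤ 1 / ((2 : ℝ) ^ (α + β) - 2) := one_div_nonneg.2 (by linarith)
  calc 1 / ((2 : ℝ) ^ (α + β) - 2) * (A * B) * ((2 : ℝ) ^ (Nat.clog 2 m)) ^ (α + β)
      ≤ 1 / ((2 : ℝ) ^ (α + β) - 2) * (A * B) * (2 ^ (α + β) * (m : ℝ) ^ (α + β)) := by gcongr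
    _ = _ := by ring

end Sewing

/-! ### Convexity of power functions -/

section Convexity

/-- The points `x + δ` and `y - δ` are convex combinations of `x` and `y` with complementary
weights, so adding the two convexity inequalities gives the claim. -/
theorem ConvexOn.add_symm_le {s : Set ℝ} {f : ℝ → ℝ} (hf : ConvexOn ℝ s f) {x y δ : ℝ}
    (hx : x ∈ s) (hy : y ∈ s) (h0 : 0 ≤ δ) (h1 : δ ≤ y - x) :
    f (x + δ) + f (y - δ) ≤ f x + f y := by
  rcases eq_or_lt_of_le (h0.trans h1) with h | h
  · have hxy : y = x := by linarith
    have : δ = 0 := by linarith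
    subst hxy this; simp
  set a := δ / (y - x) with ha
  have ha0 : 0 ≤ a := div_nonneg h0 h.le
  have ha1 : a ≤ 1 := (div_le_one h).2 h1
  have haδ : a * (y - x) = δ := div_mul_cancel₀ _ h.ne'
  have e1 := hf.2 hx hy (show 0 ≤ 1 - a by linarith) ha0 (by ring)
  have e2 := hf.2 hx hy ha0 (show 0 ≤ 1 - a by linarith) (by ring)
  simp only [smul_eq_mul] at e1 e2
  rw [show (1 - a) * x + a * y = x + δ by rw [← haδ]; ring] at e1
  rw [show a * x + (1 - a) * y = y - δ by rw [← haδ]; ring] at e2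
  linarith

theorem convexOn_rpow_of_neg {e : ℝ} (he : e < 0) : ConvexOn ℝ (Ioi 0) fun x : ℝ => x ^ e := by
  refine convexOn_of_hasDerivWithinAt2_nonneg (f' := fun x => e * x ^ (e - 1))
    (f'' := fun x => e * ((e - 1) * x ^ (e - 1 - 1))) (convex_Ioi 0) ?_ ?_ ?_ ?_
  · exact fun x hx => (Real.continuousAt_rpow_const x e (Or.inl hx.ne')).continuousWithinAt
  · intro x hx
    rw [interior_Ioi] at hx
    exact (Real.hasDerivAt_rpow_const (Or.inl (ne_of_gt hx))).hasDerivWithinAt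
  · intro x hx
    rw [interior_Ioi] at hx
    exact ((Real.hasDerivAt_rpow_const (Or.inl (ne_of_gt hx))).const_mul e).hasDerivWithinAt
  · intro x hx
    rw [interior_Ioi] at hx
    have := Real.rpow_pos_of_pos hx (e - 1 - 1)
    have h2 : 0 ≤ e * (e - 1) := by nlinarith
    nlinarith [mul_nonneg h2 this.le]

/-- The second derivative is `e (e - 1)` times the same second difference of `x ^ (e - 2)`. That
power is convex because `e < 2`, so moving the outer points inward decreases the sum. -/
theorem concaveOn_second_difference_rpow {e δ Δ : ℝ} (he1 : 1 < e) (he2 : e < 2) (h0 : 0 ≤ δ)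
    (h1 : δ ≤ Δ) : ConcaveOn ℝ (Ici 0) fun x : ℝ =>
      (x + δ) ^ e + (x + Δ - δ) ^ e - x ^ e - (x + Δ) ^ e := by
  have hd : ∀ (e : ℝ) (y : ℝ) (x : ℝ), 0 < x + y →
      HasDerivAt (fun x : ℝ => (x + y) ^ e) (e * (x + y) ^ (e - 1)) x := by
    intro e y x hx
    simpa using ((hasDerivAt_id x).add_const y).rpow_const (p := e) (Or.inl hx.ne')
  have hd0 : ∀ (e : ℝ) (x : ℝ), 0 < x →
      HasDerivAt (fun x : ℝ => x ^ e) (e * x ^ (e - 1)) x := fun e x hx =>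
    Real.hasDerivAt_rpow_const (Or.inl hx.ne')
  refine concaveOn_of_hasDerivWithinAt2_nonpos
    (f' := fun x => e * (x + δ) ^ (e - 1) + e * (x + (Δ - δ)) ^ (e - 1) - e * x ^ (e - 1) -
      e * (x + Δ) ^ (e - 1))
    (f'' := fun x => e * ((e - 1) * (x + δ) ^ (e - 1 - 1)) +
      e * ((e - 1) * (x + (Δ - δ)) ^ (e - 1 - 1)) -
      e * ((e - 1) * x ^ (e - 1 - 1)) - e * ((e - 1) * (x + Δ) ^ (e - 1 - 1)))
    (convex_Ici 0) ?_ ?_ ?_ ?_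
  · have hc : ∀ y : ℝ, Continuous fun x : ℝ => (x + y) ^ e := fun y =>
      (continuous_id.add continuous_const).rpow_const fun _ => Or.inr (by linarith)
    have e1 := hc δ
    have e2 := hc (Δ - δ)
    have e3 := hc 0
    have e4 := hc Δ
    simp only [add_zero, ← add_sub_assoc] at e1 e2 e3 e4
    exact (((e1.add e2).sub e3).sub e4).continuousOn
  · intro x hx
    rw [interior_Ici, mem_Ioi] at hx
    have := (((hd e δ x (by linarith)).add (hd e (Δ - δ) x (by linarith))).sub (hd0 e x hx)).sub
      (hd e Δ x (by linarith))
    simp only [← add_sub_assoc] at this ⊢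
    exact this.hasDerivWithinAt
  · intro x hx
    rw [interior_Ici, mem_Ioi] at hx
    exact (((((hd (e - 1) δ x (by linarith)).const_mul e).add
      ((hd (e - 1) (Δ - δ) x (by linarith)).const_mul e)).sub ((hd0 (e - 1) x hx).const_mul e)).sub
      ((hd (e - 1) Δ x (by linarith)).const_mul e)).hasDerivWithinAt
  · intro x hx
    rw [interior_Ici, mem_Ioi] at hx
    have := (convexOn_rpow_of_neg (e := e - 1 - 1) (by linarith)).add_symm_le (x := x)
      (y := x + Δ) (δ := δ) hx (show 0 < x + Δ by linarith) h0 (by linarith)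
    rw [show x + Δ - δ = x + (Δ - δ) by ring] at this
    have h3 : 0 ≤ e * (e - 1) := by nlinarith
    nlinarith [mul_le_mul_of_nonneg_left this h3]

end Convexity

/-! ### Second differences of fractional Brownian motion -/

section FractionalBrownianMotion

/-- The `L^q` norm of a standard Gaussian variable. -/
def gaussianLpNorm (q : ℝ≥0∞) : ℝ := (eLpNorm id q (gaussianReal 0 1)).toReal

theorem gaussianLpNorm_nonneg : 0 ≤ gaussianLpNorm q := ENNReal.toReal_nonneg

/-- A centred Gaussian variable is distributed as its standard deviation times a standard one, so
every `L^q` bound reduces to a variance bound. -/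
theorem LpBdd.of_hasGaussianLaw {Y : Ω → ℝ} (hY : HasGaussianLaw Y P) (h0 : ∫ ω, Y ω ∂P = 0)
    (hqt : q ≠ ∞) {v : ℝ} (hv : Var[Y; P] ≤ v) :
    LpBdd P q Y (Real.sqrt v * gaussianLpNorm q) := by
  refine ⟨hY.aemeasurable.aestronglyMeasurable, ?_⟩
  have hV := variance_nonneg Y P
  have h1 := hY.map_eq_gaussianReal
  rw [h0] at h1
  have h2 : gaussianReal 0 (Var[Y; P]).toNNReal =
      (gaussianReal 0 1).map (fun x => Real.sqrt (Var[Y; P]) * x) := by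
    rw [gaussianReal_map_const_mul, mul_zero]
    congr 1
    ext
    simp [Real.sq_sqrt hV, hV]
  have hfin : eLpNorm id q (gaussianReal 0 1) ≠ ∞ := by
    have := (memLp_id_gaussianReal (μ := 0) (v := 1) q.toNNReal).2.ne
    rwa [ENNReal.coe_toNNReal hqt] at this
  have h3 : eLpNorm Y q P = eLpNorm id q (P.map Y) := by
    rw [eLpNorm_map_measure aestronglyMeasurable_id hY.aemeasurable]; rfl
  rw [h3, h1, h2, eLpNorm_map_measure aestronglyMeasurable_id (by fun_prop)]
  have h4 : (id ∘ fun x : ℝ => Real.sqrt (Var[Y; P]) * x) = Real.sqrt (Var[Y; P]) • id := rfl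
  rw [h4, eLpNorm_const_smul, ENNReal.ofReal_mul (Real.sqrt_nonneg _), gaussianLpNorm,
    ENNReal.ofReal_toReal hfin, ← ofReal_norm, Real.norm_of_nonneg (Real.sqrt_nonneg _)]
  gcongr

variable {H c : ℝ} {Z : ℝ → Ω → ℝ}

theorem IsFractionalBrownianMotion.memLp (hZ : IsFractionalBrownianMotion H c Z P) {t : ℝ}
    (ht : 0 ≤ t) (hqt : q ≠ ∞) : MemLp (Z t) q P :=
  (hZ.gaussian.hasGaussianLaw_eval ⟨t, ht⟩).memLp hqt

theorem IsFractionalBrownianMotion.variance_sub (hZ : IsFractionalBrownianMotion H c Z P)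
    (hH : 0 < H) {s t : ℝ} (hs : 0 ≤ s) (ht : 0 ≤ t) :
    Var[fun ω => Z t ω - Z s ω; P] = c * |t - s| ^ (2 * H) := by
  have ms := hZ.memLp hs (q := 2) (by simp)
  have mt := hZ.memLp ht (q := 2) (by simp)
  rw [variance_fun_sub mt ms, ← covariance_self mt.1.aemeasurable,
    ← covariance_self ms.1.aemeasurable,
    hZ.covariance_eq s s hs hs, hZ.covariance_eq t t ht ht, hZ.covariance_eq t s ht hs]
  have : (0 : ℝ) ^ (2 * H) = 0 := Real.zero_rpow (by positivity)
  simp only [sub_self, abs_zero, this, abs_sub_comm s t]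
  ring

theorem IsFractionalBrownianMotion.lpBdd_sub (hZ : IsFractionalBrownianMotion H c Z P)
    (hH : 0 < H) (hqt : q ≠ ∞) {s t : ℝ} (hs : 0 ≤ s) (ht : 0 ≤ t) :
    LpBdd P q (fun ω => Z t ω - Z s ω) (Real.sqrt c * gaussianLpNorm q * |t - s| ^ H) := by
  have h1 : HasGaussianLaw (fun ω => Z t ω - Z s ω) P :=
    hZ.gaussian.hasGaussianLaw_fun_sub (s := ⟨t, ht⟩) (t := ⟨s, hs⟩)
  have h2 : ∫ ω, (Z t ω - Z s ω) ∂P = 0 := by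
    rw [integral_sub ((hZ.memLp ht (q := 1) (by simp)).integrable le_rfl)
      ((hZ.memLp hs (q := 1) (by simp)).integrable le_rfl), hZ.centered t ht, hZ.centered s hs,
      sub_zero]
  refine (LpBdd.of_hasGaussianLaw h1 h2 hqt (hZ.variance_sub hH hs ht).le).mono (le_of_eq ?_)
  have : |t - s| ^ (2 * H) = (|t - s| ^ H) ^ 2 := by
    rw [mul_comm, Real.rpow_mul (abs_nonneg _)]; norm_num
  rw [this, Real.sqrt_mul' _ (by positivity), Real.sqrt_sq (by positivity)]
  ring

/-- The symmetric second difference of a path over the `k`-th cell of the grid of step `Δ`. -/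
def secondDiff (Δ δ : ℝ) (z : ℝ → ℝ) (k : ℕ) : ℝ :=
  z (k * Δ + δ) + z ((k + 1) * Δ - δ) - z (k * Δ) - z ((k + 1) * Δ)

theorem IsFractionalBrownianMotion.hasGaussianLaw_sum_secondDiff
    (hZ : IsFractionalBrownianMotion H c Z P) {Δ δ : ℝ} (h0 : 0 ≤ δ) (h1 : δ ≤ Δ)
    (s : Finset ℕ) :
    HasGaussianLaw (fun ω => ∑ k ∈ s, secondDiff Δ δ (fun t => Z t ω) k) P := by
  classical
  have hΔ : 0 ≤ Δ := h0.trans h1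
  have hpos : ∀ k : ℕ, 0 ≤ (k : ℝ) * Δ + δ ∧ 0 ≤ ((k : ℝ) + 1) * Δ - δ ∧ 0 ≤ (k : ℝ) * Δ ∧
      0 ≤ ((k : ℝ) + 1) * Δ := fun k => by
    have : 0 ≤ (k : ℝ) * Δ := by positivity
    refine ⟨by linarith, by linarith, this, by linarith⟩
  have hproc : IsGaussianProcess (fun (k : ℕ) ω => secondDiff Δ δ (fun t => Z t ω) k) P := by
    refine hZ.gaussian.of_isGaussianProcess fun k => ?_
    let p1 : ℝ≥0 := ⟨_, (hpos k).1⟩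
    let p2 : ℝ≥0 := ⟨_, (hpos k).2.1⟩
    let p3 : ℝ≥0 := ⟨_, (hpos k).2.2.1⟩
    let p4 : ℝ≥0 := ⟨_, (hpos k).2.2.2⟩
    let I : Finset ℝ≥0 := {p1, p2, p3, p4}
    refine ⟨I, ContinuousLinearMap.proj (R := ℝ) (φ := fun _ : I => ℝ) ⟨p1, by simp [I]⟩ +
      ContinuousLinearMap.proj (R := ℝ) (φ := fun _ : I => ℝ) ⟨p2, by simp [I]⟩ -
      ContinuousLinearMap.proj (R := ℝ) (φ := fun _ : I => ℝ) ⟨p3, by simp [I]⟩ -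
      ContinuousLinearMap.proj (R := ℝ) (φ := fun _ : I => ℝ) ⟨p4, by simp [I]⟩, fun ω => ?_⟩
    rfl
  exact hproc.hasGaussianLaw_fun_sum

theorem covariance_four_left {A B C D E : Ω → ℝ} (hA : MemLp A 2 P) (hB : MemLp B 2 P)
    (hC : MemLp C 2 P) (hD : MemLp D 2 P) (hE : MemLp E 2 P) :
    cov[fun ω => A ω + B ω - C ω - D ω, E; P] =
      cov[A, E; P] + cov[B, E; P] - cov[C, E; P] - cov[D, E; P] := by
  rw [show (fun ω => A ω + B ω - C ω - D ω) = A + B - C - D from rfl,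
    covariance_sub_left ((hA.add hB).sub hC) hD hE, covariance_sub_left (hA.add hB) hC hE,
    covariance_add_left hA hB hE]

/-- Second differences of a fractional Brownian motion with `H ∈ (1/2, 1)` over distinct cells
are negatively correlated. -/
theorem IsFractionalBrownianMotion.covariance_secondDiff_nonpos
    (hZ : IsFractionalBrownianMotion H c Z P) (hH : 1 / 2 < H) (hH1 : H < 1) (hc : 0 < c)
    {Δ δ : ℝ} (h0 : 0 ≤ δ) (h1 : δ ≤ Δ) {i j : ℕ} (hij : i < j) :
    cov[fun ω => secondDiff Δ δ (fun t => Z t ω) i,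
      fun ω => secondDiff Δ δ (fun t => Z t ω) j; P] ≤ 0 := by
  have hΔ : 0 ≤ Δ := h0.trans h1
  have hi : 0 ≤ (i : ℝ) * Δ := by positivity
  have hj : 0 ≤ (j : ℝ) * Δ := by positivity
  have hij' : ((i : ℝ) + 1) * Δ ≤ j * Δ := by
    gcongr; exact_mod_cast hij
  have hm : ∀ t, 0 ≤ t → MemLp (Z t) 2 P := fun t ht => hZ.memLp ht (by simp)
  have hcov : ∀ s t, 0 ≤ s → s ≤ t →
      cov[Z s, Z t; P] = c / 2 * (s ^ (2 * H) + t ^ (2 * H) - (t - s) ^ (2 * H)) := by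
    intro s t hs hst
    rw [hZ.covariance_eq s t hs (hs.trans hst), abs_of_nonneg (sub_nonneg.2 hst)]
  set s1 := (i : ℝ) * Δ + δ
  set s2 := ((i : ℝ) + 1) * Δ - δ
  set s3 := (i : ℝ) * Δ
  set s4 := ((i : ℝ) + 1) * Δ
  set t1 := (j : ℝ) * Δ + δ
  set t2 := ((j : ℝ) + 1) * Δ - δ
  set t3 := (j : ℝ) * Δ
  set t4 := ((j : ℝ) + 1) * Δ
  have es4 : s4 = s3 + Δ := by simp only [s4, s3]; ring
  have et4 : t4 = t3 + Δ := by simp only [t4, t3]; ring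
  have es2 : s2 = s3 + Δ - δ := by simp only [s2, s3]; ring
  have et2 : t2 = t3 + Δ - δ := by simp only [t2, t3]; ring
  have es1 : s1 = s3 + δ := rfl
  have et1 : t1 = t3 + δ := rfl
  have ht3 : s4 ≤ t3 := hij'
  have mS : ∀ E : Ω → ℝ, MemLp E 2 P →
      cov[fun ω => secondDiff Δ δ (fun t => Z t ω) i, E; P] =
      cov[Z s1, E; P] + cov[Z s2, E; P] - cov[Z s3, E; P] - cov[Z s4, E; P] := fun E hE =>
    covariance_four_left (hm s1 (by linarith)) (hm s2 (by linarith)) (hm s3 (by linarith))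
      (hm s4 (by linarith)) hE
  have mT : ∀ E : Ω → ℝ, MemLp E 2 P →
      cov[E, fun ω => secondDiff Δ δ (fun t => Z t ω) j; P] =
      cov[E, Z t1; P] + cov[E, Z t2; P] - cov[E, Z t3; P] - cov[E, Z t4; P] := fun E hE => by
    rw [covariance_comm, covariance_comm E, covariance_comm E, covariance_comm E,
      covariance_comm E]
    exact covariance_four_left (hm t1 (by linarith)) (hm t2 (by linarith)) (hm t3 (by linarith))
      (hm t4 (by linarith)) hE
  have mm : MemLp (fun ω => secondDiff Δ δ (fun t => Z t ω) j) 2 P :=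
    (((hm t1 (by linarith)).add (hm t2 (by linarith))).sub (hm t3 (by linarith))).sub
      (hm t4 (by linarith))
  rw [mS _ mm, mT _ (hm s1 (by linarith)), mT _ (hm s2 (by linarith)), mT _ (hm s3 (by linarith)),
    mT _ (hm s4 (by linarith))]
  -- In the sixteen covariances the terms depending on `s` alone or `t` alone cancel. What remains
  -- is `-c/2` times a second difference, in the `s`-points, of `g(t3 - s)` with `g` the concave
  -- second difference of `x ^ (2 H)`. The inner points `t3 - s2`, `t3 - s1` come from the outer
  -- ones `t3 - s4`, `t3 - s3` by moving inward by `δ`.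
  have hg := (concaveOn_second_difference_rpow (e := 2 * H) (by linarith) (by linarith) h0 h1).neg
  have key := hg.add_symm_le (x := t3 - s4) (y := t3 - s3) (δ := δ)
    (show 0 ≤ t3 - s4 by linarith) (show 0 ≤ t3 - s3 by linarith) h0 (by linarith)
  rw [show t3 - s4 + δ = t3 - s2 by linarith, show t3 - s3 - δ = t3 - s1 by linarith] at key
  have hgs : ∀ s, (-fun x : ℝ => (x + δ) ^ (2 * H) + (x + Δ - δ) ^ (2 * H) - x ^ (2 * H) -
      (x + Δ) ^ (2 * H)) (t3 - s) = -((t1 - s) ^ (2 * H) + (t2 - s) ^ (2 * H) -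
      (t3 - s) ^ (2 * H) - (t4 - s) ^ (2 * H)) := fun s => by
    rw [Pi.neg_apply, show t3 - s + δ = t1 - s by linarith,
      show t3 - s + Δ - δ = t2 - s by linarith, show t3 - s + Δ = t4 - s by linarith]
  rw [hgs, hgs, hgs, hgs] at key
  rw [hcov s1 t1 (by linarith) (by linarith), hcov s1 t2 (by linarith) (by linarith),
    hcov s1 t3 (by linarith) (by linarith), hcov s1 t4 (by linarith) (by linarith),
    hcov s2 t1 (by linarith) (by linarith), hcov s2 t2 (by linarith) (by linarith),
    hcov s2 t3 (by linarith) (by linarith), hcov s2 t4 (by linarith) (by linarith),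
    hcov s3 t1 (by linarith) (by linarith), hcov s3 t2 (by linarith) (by linarith),
    hcov s3 t3 (by linarith) (by linarith), hcov s3 t4 (by linarith) (by linarith),
    hcov s4 t1 (by linarith) (by linarith), hcov s4 t2 (by linarith) (by linarith),
    hcov s4 t3 (by linarith) (by linarith), hcov s4 t4 (by linarith) (by linarith)]
  have key' := mul_le_mul_of_nonneg_left key (half_pos hc).le
  linarith

/-- The second difference is a difference of two increments over length `δ`, and `Var(A - B) ≤ 2 Var
A + 2 Var B`, which follows from `Var(A + B) ≥ 0`. -/
theorem IsFractionalBrownianMotion.variance_secondDiff_le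
    (hZ : IsFractionalBrownianMotion H c Z P) (hH : 0 < H) (hc : 0 < c)
    {Δ δ : ℝ} (h0 : 0 ≤ δ) (h1 : δ ≤ Δ) (i : ℕ) :
    Var[fun ω => secondDiff Δ δ (fun t => Z t ω) i; P] ≤ 4 * c * Δ ^ (2 * H) := by
  have hΔ : 0 ≤ Δ := h0.trans h1
  have hi : 0 ≤ (i : ℝ) * Δ := by positivity
  have hm : ∀ t, 0 ≤ t → MemLp (Z t) 2 P := fun t ht => hZ.memLp ht (by simp)
  set s3 := (i : ℝ) * Δ
  have e4 : ((i : ℝ) + 1) * Δ = s3 + Δ := by simp only [s3]; ring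
  let A : Ω → ℝ := fun ω => Z (s3 + δ) ω - Z s3 ω
  let B : Ω → ℝ := fun ω => Z (s3 + Δ) ω - Z (s3 + Δ - δ) ω
  have mA : MemLp A 2 P := (hm _ (by linarith)).sub (hm _ hi)
  have mB : MemLp B 2 P := (hm _ (by linarith)).sub (hm _ (by linarith))
  have e : (fun ω => secondDiff Δ δ (fun t => Z t ω) i) = fun ω => A ω - B ω := by
    ext ω; simp only [secondDiff, e4, A, B, s3]; ring
  rw [e, variance_fun_sub mA mB]
  have h3 := variance_nonneg (fun ω => A ω + B ω) P
  rw [variance_fun_add mA mB] at h3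
  have vA : Var[A; P] ≤ c * Δ ^ (2 * H) := by
    rw [hZ.variance_sub hH hi (by linarith)]
    gcongr
    rwa [add_sub_cancel_left, abs_of_nonneg h0]
  have vB : Var[B; P] ≤ c * Δ ^ (2 * H) := by
    rw [hZ.variance_sub hH (by linarith) (by linarith)]
    gcongr
    rwa [sub_sub_cancel, abs_of_nonneg h0]
  linarith

/-- The decisive cancellation. The off-diagonal covariances are nonpositive and can be dropped, so
the variance of the sum is at most the number of cells times the variance of one; Gaussianity
converts this to `L^q`. The growth exponent is `1 / 2` instead of the trivial `1`. -/
theorem IsFractionalBrownianMotion.lpBdd_sum_secondDiff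
    (hZ : IsFractionalBrownianMotion H c Z P) (hH : 1 / 2 < H) (hH1 : H < 1) (hc : 0 < c)
    (hqt : q ≠ ∞) {Δ δ : ℝ} (h0 : 0 ≤ δ) (h1 : δ ≤ Δ) (i j : ℕ) :
    LpBdd P q (fun ω => ∑ k ∈ Finset.Ico i j, secondDiff Δ δ (fun t => Z t ω) k)
      (2 * Real.sqrt c * gaussianLpNorm q * Δ ^ H * ((j - i : ℕ) : ℝ) ^ (1 / 2 : ℝ)) := by
  have hΔ : 0 ≤ Δ := h0.trans h1
  have hm : ∀ t, 0 ≤ t → MemLp (Z t) 2 P := fun t ht => hZ.memLp ht (by simp)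
  have hmG : ∀ k : ℕ, MemLp (fun ω => secondDiff Δ δ (fun t => Z t ω) k) 2 P := fun k => by
    have hk : 0 ≤ (k : ℝ) * Δ := by positivity
    exact (((hm _ (by linarith)).add (hm _ (by linarith))).sub (hm _ hk)).sub
      (hm _ (by linarith))
  have hZint : ∀ t, 0 ≤ t → Integrable (Z t) P := fun t ht => (hm t ht).integrable (by norm_num)
  have hmean : ∫ ω, ∑ k ∈ Finset.Ico i j, secondDiff Δ δ (fun t => Z t ω) k ∂P = 0 := by
    rw [integral_finsetSum _ fun k _ => (hmG k).integrable (by norm_num)]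
    refine Finset.sum_eq_zero fun k _ => ?_
    have hk : 0 ≤ (k : ℝ) * Δ := by positivity
    have p1 : 0 ≤ (k : ℝ) * Δ + δ := by linarith
    have p2 : 0 ≤ ((k : ℝ) + 1) * Δ - δ := by linarith
    have p4 : 0 ≤ ((k : ℝ) + 1) * Δ := by linarith
    simp only [secondDiff]
    have i2 : Integrable (fun ω => Z (k * Δ + δ) ω + Z ((k + 1) * Δ - δ) ω) P :=
      (hZint _ p1).add (hZint _ p2)
    have i3 : Integrable (fun ω => Z (k * Δ + δ) ω + Z ((k + 1) * Δ - δ) ω - Z (k * Δ) ω) P :=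
      i2.sub (hZint _ hk)
    rw [integral_sub i3 (hZint _ p4), integral_sub i2 (hZint _ hk), integral_add (hZint _ p1) (hZint _ p2),
      hZ.centered _ p1, hZ.centered _ p2, hZ.centered _ hk, hZ.centered _ p4]
    simp
  have hvar : Var[fun ω => ∑ k ∈ Finset.Ico i j, secondDiff Δ δ (fun t => Z t ω) k; P] ≤
      ((j - i : ℕ) : ℝ) * (4 * c * Δ ^ (2 * H)) := by
    have e := variance_fun_sum' (μ := P) (s := Finset.Ico i j)
      (X := fun k ω => secondDiff Δ δ (fun t => Z t ω) k) (fun k _ => hmG k)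
    rw [e]
    have h2 : ∀ k ∈ Finset.Ico i j, ∑ l ∈ Finset.Ico i j,
        cov[fun ω => secondDiff Δ δ (fun t => Z t ω) k,
          fun ω => secondDiff Δ δ (fun t => Z t ω) l; P] ≤ 4 * c * Δ ^ (2 * H) := by
      intro k hk
      rw [← Finset.add_sum_erase _ _ hk, covariance_self (hmG k).1.aemeasurable]
      have h3 := hZ.variance_secondDiff_le (by linarith) hc h0 h1 k
      have h4 : ∑ l ∈ (Finset.Ico i j).erase k, cov[fun ω => secondDiff Δ δ (fun t => Z t ω) k,
          fun ω => secondDiff Δ δ (fun t => Z t ω) l; P] ≤ 0 := by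
        refine Finset.sum_nonpos fun l hl => ?_
        rcases lt_or_gt_of_ne (Finset.ne_of_mem_erase hl) with hlt | hlt
        · rw [covariance_comm]
          exact hZ.covariance_secondDiff_nonpos hH hH1 hc h0 h1 hlt
        · exact hZ.covariance_secondDiff_nonpos hH hH1 hc h0 h1 hlt
      linarith
    refine (Finset.sum_le_sum h2).trans (le_of_eq ?_)
    rw [Finset.sum_const, Nat.card_Ico, nsmul_eq_mul]
  refine (LpBdd.of_hasGaussianLaw (hZ.hasGaussianLaw_sum_secondDiff h0 h1 _) hmean hqt hvar).mono
    (le_of_eq ?_)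
  have e1 : ((j - i : ℕ) : ℝ) * (4 * c * Δ ^ (2 * H)) =
      c * (2 * Δ ^ H * Real.sqrt ((j - i : ℕ) : ℝ)) ^ 2 := by
    rw [mul_pow, mul_pow, Real.sq_sqrt (Nat.cast_nonneg _), mul_comm 2 H, Real.rpow_mul hΔ]
    norm_num; ring
  rw [e1, Real.sqrt_mul hc.le, Real.sqrt_sq (by positivity), ← Real.sqrt_eq_rpow]
  ring

end FractionalBrownianMotion

end
-- The grid and the trapezoidal rule
noncomputable section

section GridFloor

variable {Δ s : ℝ}

theorem gridFloor_le (hΔ : 0 < Δ) (s : ℝ) : gridFloor Δ s ≤ s := by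
  have := Int.floor_le (s / Δ)
  rw [le_div_iff₀ hΔ] at this
  exact this

theorem lt_gridFloor_add (hΔ : 0 < Δ) (s : ℝ) : s < gridFloor Δ s + Δ := by
  have := Int.lt_floor_add_one (s / Δ)
  rw [div_lt_iff₀ hΔ] at this
  unfold gridFloor
  linarith

theorem abs_sub_gridFloor_le (hΔ : 0 < Δ) (s : ℝ) : |s - gridFloor Δ s| ≤ Δ := by
  rw [abs_of_nonneg (by linarith [gridFloor_le hΔ s])]
  linarith [lt_gridFloor_add hΔ s]

theorem measurable_gridFloor : Measurable (gridFloor Δ) := by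
  unfold gridFloor
  exact ((measurable_from_top (f := fun k : ℤ => (k : ℝ))).comp
    (Int.measurable_floor.comp (measurable_id.div_const Δ))).mul_const Δ

theorem gridFloor_sub_natCast_mul (hΔ : 0 < Δ) (n : ℕ) (s : ℝ) :
    gridFloor Δ (s - n * Δ) = gridFloor Δ s - n * Δ := by
  unfold gridFloor
  rw [sub_div, mul_div_assoc, div_self hΔ.ne', mul_one, Int.floor_sub_natCast]
  push_cast; ring

theorem gridFloor_eq_of_mem (hΔ : 0 < Δ) {k : ℕ} (hs : s ∈ Ico (k * Δ) ((k + 1) * Δ)) :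
    gridFloor Δ s = k * Δ := by
  unfold gridFloor
  have : ⌊s / Δ⌋ = (k : ℤ) := by
    rw [Int.floor_eq_iff]
    exact ⟨by rw [le_div_iff₀ hΔ]; exact_mod_cast hs.1,
      by rw [div_lt_iff₀ hΔ]; exact_mod_cast hs.2⟩
  rw [this]; simp

theorem gridFloor_nonneg (hΔ : 0 < Δ) (hs : 0 ≤ s) : 0 ≤ gridFloor Δ s := by
  unfold gridFloor
  have : 0 ≤ ⌊s / Δ⌋ := Int.floor_nonneg.2 (div_nonneg hs hΔ.le)
  positivity

end GridFloor

section Trapezoid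

variable {Δ δ : ℝ} {y : ℝ → ℝ}

/-- A second difference is the increment over the first `δ` of the cell minus the increment over its
last `δ`; for a primitive this compares the derivative at two points of the same cell. -/
theorem secondDiff_primitive {a : ℝ → ℝ} {T : ℝ}
    (ha : ∀ u ∈ Icc 0 T, ∀ v ∈ Icc 0 T, IntervalIntegrable a volume u v) (c : ℝ) (h0 : 0 ≤ δ)
    (h1 : δ ≤ Δ) {k : ℕ} (hk : (k + 1) * Δ ≤ T) :
    secondDiff Δ δ (fun t => c + ∫ s in (0 : ℝ)..t, a s) k =
      ∫ x in (0 : ℝ)..δ, (a (k * Δ + x) - a ((k + 1) * Δ - δ + x)) := by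
  have hΔ : 0 ≤ Δ := h0.trans h1
  have hk0 : 0 ≤ (k : ℝ) * Δ := by positivity
  have m0 : (0 : ℝ) ∈ Icc 0 T := ⟨le_rfl, by linarith⟩
  have m1 : (k : ℝ) * Δ ∈ Icc 0 T := ⟨hk0, by linarith⟩
  have m2 : (k : ℝ) * Δ + δ ∈ Icc 0 T := ⟨by linarith, by linarith⟩
  have m3 : ((k : ℝ) + 1) * Δ - δ ∈ Icc 0 T := ⟨by linarith, by linarith⟩
  have m4 : ((k : ℝ) + 1) * Δ ∈ Icc 0 T := ⟨by linarith, by linarith⟩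
  have i1 : IntervalIntegrable (fun x => a (k * Δ + x)) volume 0 δ := by
    have := (ha _ m1 _ m2).comp_add_left ((k : ℝ) * Δ)
    simpa using this
  have i2 : IntervalIntegrable (fun x => a ((k + 1) * Δ - δ + x)) volume 0 δ := by
    have := (ha _ m3 _ m4).comp_add_left (((k : ℝ) + 1) * Δ - δ)
    simpa using this
  rw [intervalIntegral.integral_sub i1 i2, intervalIntegral.integral_comp_add_left,
    intervalIntegral.integral_comp_add_left, add_zero, add_zero, sub_add_cancel,
    ← intervalIntegral.integral_interval_sub_left (ha _ m0 _ m2) (ha _ m0 _ m1),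
    ← intervalIntegral.integral_interval_sub_left (ha _ m0 _ m4) (ha _ m0 _ m3)]
  simp only [secondDiff]
  ring

/-- The difference between the error of the left-point rule for `∫_0^v y` and the main term
`Δ / 2 * (y v - y 0)`. -/
def gridError (Δ : ℝ) (y : ℝ → ℝ) (v : ℝ) : ℝ :=
  (∫ s in (0 : ℝ)..v, (y s - y (gridFloor Δ s))) - Δ / 2 * (y v - y 0)

theorem intervalIntegrable_comp_gridFloor (hΔ : 0 < Δ) (hy : Continuous y) (u v : ℝ) :
    IntervalIntegrable (fun s => y (gridFloor Δ s)) volume u v := by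
  obtain ⟨C, hC⟩ := (isCompact_Icc (a := min u v - Δ) (b := max u v)).exists_bound_of_continuousOn
    hy.continuousOn
  rw [intervalIntegrable_iff]
  refine Measure.integrableOn_of_bounded (M := C) (by simp)
    (hy.measurable.comp measurable_gridFloor).aestronglyMeasurable ?_
  filter_upwards [ae_restrict_mem measurableSet_uIoc] with s hs
  rw [uIoc, mem_Ioc] at hs
  exact hC _ ⟨by linarith [lt_gridFloor_add hΔ s], by linarith [gridFloor_le hΔ s]⟩

theorem intervalIntegrable_sub_gridFloor (hΔ : 0 < Δ) (hy : Continuous y) (u v : ℝ) :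
    IntervalIntegrable (fun s => y s - y (gridFloor Δ s)) volume u v :=
  (hy.intervalIntegrable u v).sub (intervalIntegrable_comp_gridFloor hΔ hy u v)

theorem gridError_eq_add (hΔ : 0 < Δ) (hy : Continuous y) (u v : ℝ) :
    gridError Δ y v = gridError Δ y u +
      ((∫ s in u..v, (y s - y (gridFloor Δ s))) - Δ / 2 * (y v - y u)) := by
  have := intervalIntegral.integral_add_adjacent_intervals
    (intervalIntegrable_sub_gridFloor hΔ hy 0 u) (intervalIntegrable_sub_gridFloor hΔ hy u v)
  unfold gridError
  rw [← this]
  ring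

theorem continuous_secondDiff (hy : Continuous y) (k : ℕ) :
    Continuous fun δ => secondDiff Δ δ y k := by
  unfold secondDiff; fun_prop

/-- The error of the trapezoidal rule in terms of symmetric second differences. -/
theorem gridError_natCast_mul (hΔ : 0 < Δ) (hy : Continuous y) (m : ℕ) :
    gridError Δ y (m * Δ) =
      1 / 2 * ∫ δ in (0 : ℝ)..Δ, ∑ k ∈ Finset.range m, secondDiff Δ δ y k := by
  induction m with
  | zero => simp [gridError]
  | succ m ih =>
    have hc : Continuous fun δ => ∑ k ∈ Finset.range m, secondDiff Δ δ y k :=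
      continuous_finsetSum _ fun k _ => continuous_secondDiff hy k
    simp only [Finset.sum_range_succ]
    rw [intervalIntegral.integral_add (hc.intervalIntegrable _ _)
      ((continuous_secondDiff hy m).intervalIntegrable _ _), mul_add, ← ih,
      gridError_eq_add hΔ hy (m * Δ)]
    congr 1
    push_cast
    -- On a cell the left-point value is constant, except at the right endpoint, which is a null
    -- set.
    have e1 : ∫ s in (m * Δ)..((m + 1) * Δ), (y s - y (gridFloor Δ s)) =
        (∫ s in (m * Δ)..((m + 1) * Δ), y s) - Δ * y (m * Δ) := by
      have : ∫ s in (m * Δ)..((m + 1) * Δ), (y s - y (gridFloor Δ s)) =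
          ∫ s in (m * Δ)..((m + 1) * Δ), (y s - y (m * Δ)) := by
        refine intervalIntegral.integral_congr_ae ?_
        have hne : ∀ᵐ s : ℝ, s ≠ (m + 1) * Δ := by simp [ae_iff, measure_singleton]
        filter_upwards [hne] with s hs hsm
        rw [uIoc_of_le (by nlinarith)] at hsm
        rw [gridFloor_eq_of_mem hΔ ⟨hsm.1.le, lt_of_le_of_ne hsm.2 hs⟩]
      rw [this, intervalIntegral.integral_sub (hy.intervalIntegrable _ _) (by simp),
        intervalIntegral.integral_const, smul_eq_mul]
      ring
    have c1 : Continuous fun δ => y (m * Δ + δ) := by fun_prop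
    have c2 : Continuous fun δ => y ((m + 1) * Δ - δ) := by fun_prop
    have e2 : ∫ δ in (0 : ℝ)..Δ, secondDiff Δ δ y m =
        2 * (∫ s in (m * Δ)..((m + 1) * Δ), y s) - Δ * (y (m * Δ) + y ((m + 1) * Δ)) := by
      have : ∀ δ, secondDiff Δ δ y m =
          (y (m * Δ + δ) + y ((m + 1) * Δ - δ)) - (y (m * Δ) + y ((m + 1) * Δ)) := fun δ => by
        unfold secondDiff; ring
      simp only [this]
      have c3 : Continuous fun δ => y (m * Δ + δ) + y ((m + 1) * Δ - δ) := c1.add c2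
      rw [intervalIntegral.integral_sub (c3.intervalIntegrable _ _) (by simp),
        intervalIntegral.integral_add (c1.intervalIntegrable _ _) (c2.intervalIntegrable _ _),
        intervalIntegral.integral_comp_add_left, intervalIntegral.integral_comp_sub_left,
        intervalIntegral.integral_const, smul_eq_mul, add_zero, sub_zero, sub_zero]
      rw [show (m : ℝ) * Δ + Δ = (m + 1) * Δ by ring, show ((m : ℝ) + 1) * Δ - Δ = m * Δ by ring]
      ring
    rw [e1, e2]
    ring

/-- Translation by a multiple of `Δ` preserves the grid. With `n Δ = τ` it moves `[-τ, 0]` to `[0,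
τ]`; the difference appears because `gridError` is anchored at time `0`. -/
theorem gridError_sub_natCast_mul (hΔ : 0 < Δ) (hy : Continuous y) (n : ℕ) (v : ℝ) :
    gridError Δ y v = gridError Δ (fun t => y (t - n * Δ)) (v + n * Δ) -
      gridError Δ (fun t => y (t - n * Δ)) (n * Δ) := by
  have hy' : Continuous fun t => y (t - n * Δ) := by fun_prop
  have e := intervalIntegral.integral_interval_sub_left
    (intervalIntegrable_sub_gridFloor hΔ hy' 0 (v + n * Δ))
    (intervalIntegrable_sub_gridFloor hΔ hy' 0 (n * Δ))
  simp only [← gridFloor_sub_natCast_mul hΔ] at e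
  have e2 : ∫ s in (n * Δ)..(v + n * Δ), (y (s - n * Δ) - y (gridFloor Δ (s - n * Δ))) =
      ∫ s in (0 : ℝ)..v, (y s - y (gridFloor Δ s)) := by
    rw [intervalIntegral.integral_comp_sub_right (fun s => y s - y (gridFloor Δ s)), sub_self,
      add_sub_cancel_right]
  simp only [gridError, ← gridFloor_sub_natCast_mul hΔ]
  rw [← e2, ← e]
  simp only [sub_self, add_sub_cancel_right]
  ring

/-- A function of class `C^1` on a compact interval is a primitive of a continuous function. -/
theorem ContDiffOn.exists_eq_primitive {f : ℝ → ℝ} {a c : ℝ} (hac : a < c)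
    (hf : ContDiffOn ℝ 1 f (Icc a c)) :
    ∃ d : ℝ → ℝ, Continuous d ∧ ∀ t ∈ Icc a c, f t = f a + ∫ s in a..t, d s := by
  have hd : ContinuousOn (derivWithin f (Icc a c)) (Icc a c) :=
    hf.continuousOn_derivWithin (uniqueDiffOn_Icc hac) le_rfl
  refine ⟨IccExtend hac.le ((Icc a c).domRestrict (derivWithin f (Icc a c))),
    (continuousOn_iff_continuous_domRestrict.1 hd).Icc_extend', fun t ht => ?_⟩
  rw [intervalIntegral.integral_eq_sub_of_hasDerivAt_of_le ht.1
    (hf.continuousOn.mono (Icc_subset_Icc_right ht.2)) (fun x hx => ?_)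
    ((continuousOn_iff_continuous_domRestrict.1 hd).Icc_extend'.intervalIntegrable _ _)]
  · ring
  · have hx' : x ∈ Icc a c := ⟨hx.1.le, hx.2.le.trans ht.2⟩
    rw [IccExtend_of_mem hac.le _ hx']
    have h1 := (hf.differentiableOn one_ne_zero x hx').hasDerivWithinAt
    exact h1.hasDerivAt (Icc_mem_nhds hx.1 (hx.2.trans_le ht.2))

/-- The trapezoidal rule on a uniform grid has error `o(Δ)` for functions of class `C^1`,
uniformly over paths agreeing with the function on the interval. -/
theorem gridError_le_of_contDiffOn {f : ℝ → ℝ} {τ : ℝ} (hτ : 0 < τ)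
    (hf : ContDiffOn ℝ 1 f (Icc 0 τ)) {ε : ℝ} (hε : 0 < ε) :
    ∀ᶠ n : ℕ in atTop, ∀ y : ℝ → ℝ, Continuous y → (∀ t ∈ Icc 0 τ, y t = f t) →
      ∀ v ∈ Icc 0 τ, |gridError (τ / n) y v| ≤ ε * (τ / n) := by
  obtain ⟨d, hd, hfd⟩ := hf.exists_eq_primitive hτ
  -- The full cells contribute `ε' τ / 2` and the last incomplete cell `ε' + ε' / 2`, each times
  -- `Δ`.
  set ε' := ε / (τ + 2) with hε'
  have hε'0 : 0 < ε' := by positivity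
  obtain ⟨ρ, hρ, hdρ⟩ := Metric.uniformContinuousOn_iff.1
    ((isCompact_Icc (a := (0:ℝ)) (b := τ)).uniformContinuousOn_of_continuous hd.continuousOn)
    ε' hε'0
  obtain ⟨ρ', hρ', hfρ⟩ := Metric.uniformContinuousOn_iff.1
    ((isCompact_Icc (a := (0:ℝ)) (b := τ)).uniformContinuousOn_of_continuous hf.continuousOn)
    ε' hε'0
  have hlim : Tendsto (fun n : ℕ => τ / (n : ℝ)) atTop (𝓝 0) :=
    tendsto_const_div_atTop_nhds_zero_nat τ
  filter_upwards [hlim.eventually (gt_mem_nhds hρ), hlim.eventually (gt_mem_nhds hρ'),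
    eventually_ge_atTop 1] with n hn1 hn2 hn y hy hyf v hv
  set Δ := τ / (n : ℝ) with hΔdef
  have hn0 : (0 : ℝ) < n := by exact_mod_cast hn
  have hΔ : 0 < Δ := by positivity
  set m := ⌊v / Δ⌋₊ with hm
  have hmv : m * Δ ≤ v := by
    have := Nat.floor_le (div_nonneg hv.1 hΔ.le)
    rwa [le_div_iff₀ hΔ] at this
  have hvm : v < (m + 1) * Δ := by
    have := Nat.lt_floor_add_one (v / Δ)
    rwa [div_lt_iff₀ hΔ] at this
  have hm0 : 0 ≤ m * Δ := by positivity
  -- Here the derivative is compared at points of one cell, hence at distance at most `Δ < ρ`;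
  -- uniform continuity gives `ε' Δ` per cell, and `m Δ ≤ τ`.
  have hsd : ∀ k ∈ Finset.range m, ∀ δ ∈ Icc 0 Δ, |secondDiff Δ δ y k| ≤ ε' * Δ := by
    intro k hk δ hδ
    have hkm : ((k : ℝ) + 1) * Δ ≤ m * Δ := by
      gcongr; exact_mod_cast Finset.mem_range.1 hk
    have hk0 : 0 ≤ k * Δ := by positivity
    have e : secondDiff Δ δ y k = secondDiff Δ δ (fun t => f 0 + ∫ s in (0:ℝ)..t, d s) k := by
      have : ∀ t ∈ Icc 0 τ, y t = f 0 + ∫ s in (0:ℝ)..t, d s := fun t ht => by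
        rw [hyf t ht, hfd t ht]
      simp only [secondDiff]
      rw [this _ ⟨by linarith [hδ.1], by linarith [hδ.2, hv.2]⟩,
        this _ ⟨by linarith [hδ.2], by linarith [hδ.1, hv.2]⟩, this _ ⟨hk0, by linarith [hv.2]⟩,
        this _ ⟨by linarith, by linarith [hv.2]⟩]
    rw [e, secondDiff_primitive (T := τ) (fun _ _ _ _ => hd.intervalIntegrable _ _) _ hδ.1 hδ.2
      (by linarith [hv.2])]
    have := intervalIntegral.norm_integral_le_of_norm_le_const (a := 0) (b := δ) (C := ε')
      (f := fun x => d (k * Δ + x) - d ((k + 1) * Δ - δ + x)) (fun x hx => by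
        rw [uIoc_of_le hδ.1] at hx
        rw [← dist_eq_norm]
        refine (hdρ _ ⟨by linarith [hx.1], by linarith [hx.2, hδ.2, hv.2]⟩ _
          ⟨by linarith [hx.1, hδ.2], by linarith [hx.2, hv.2]⟩ ?_).le
        rw [Real.dist_eq, abs_lt]
        constructor <;> linarith [hδ.1, hδ.2])
    rw [Real.norm_eq_abs, sub_zero, abs_of_nonneg hδ.1] at this
    exact this.trans (by gcongr; exact hδ.2)
  have hF1 : |gridError Δ y (m * Δ)| ≤ 1 / 2 * (ε' * τ * Δ) := by
    rw [gridError_natCast_mul hΔ hy, abs_mul, abs_of_pos (by norm_num : (0:ℝ) < 1 / 2)]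
    gcongr
    have := intervalIntegral.norm_integral_le_of_norm_le_const (a := 0) (b := Δ) (C := ε' * τ)
      (f := fun δ => ∑ k ∈ Finset.range m, secondDiff Δ δ y k) (fun δ hδ => by
        rw [uIoc_of_le hΔ.le] at hδ
        refine (norm_sum_le_of_le _ fun k hk => hsd k hk δ ⟨hδ.1.le, hδ.2⟩).trans ?_
        rw [Finset.sum_const, Finset.card_range, nsmul_eq_mul]
        calc m * (ε' * Δ) = ε' * (m * Δ) := by ring
          _ ≤ ε' * τ := by gcongr; linarith [hv.2])
    rwa [Real.norm_eq_abs, sub_zero, abs_of_pos hΔ] at this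
  have hy' : ∀ s ∈ Icc (m * Δ) v, |y s - y (m * Δ)| ≤ ε' := by
    intro s hs
    rw [hyf s ⟨by linarith [hs.1], by linarith [hs.2, hv.2]⟩,
      hyf (m * Δ) ⟨hm0, by linarith [hv.2]⟩, ← Real.dist_eq]
    refine (hfρ _ ⟨by linarith [hs.1], by linarith [hs.2, hv.2]⟩ _
      ⟨hm0, by linarith [hv.2]⟩ ?_).le
    rw [Real.dist_eq, abs_lt]
    constructor <;> linarith [hs.1, hs.2]
  have hF2 : |∫ s in (m * Δ)..v, (y s - y (gridFloor Δ s))| ≤ ε' * Δ := by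
    have := intervalIntegral.norm_integral_le_of_norm_le_const (a := m * Δ) (b := v) (C := ε')
      (f := fun s => y s - y (gridFloor Δ s)) (fun s hs => by
        rw [uIoc_of_le hmv] at hs
        rw [gridFloor_eq_of_mem hΔ ⟨hs.1.le, hs.2.trans_lt hvm⟩]
        exact hy' s ⟨hs.1.le, hs.2⟩)
    rw [Real.norm_eq_abs, abs_of_nonneg (sub_nonneg.2 hmv)] at this
    exact this.trans (by gcongr; linarith)
  rw [gridError_eq_add hΔ hy (m * Δ) v]
  have h3 : |Δ / 2 * (y v - y (m * Δ))| ≤ Δ / 2 * ε' := by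
    rw [abs_mul, abs_of_pos (half_pos hΔ)]
    gcongr
    exact hy' v ⟨hmv, le_rfl⟩
  have h4 := abs_add_le (gridError Δ y (m * Δ))
    ((∫ s in (m * Δ)..v, (y s - y (gridFloor Δ s))) - Δ / 2 * (y v - y (m * Δ)))
  have h5 := abs_sub (∫ s in (m * Δ)..v, (y s - y (gridFloor Δ s))) (Δ / 2 * (y v - y (m * Δ)))
  have h6 : ε' * (τ + 2) = ε := by rw [hε']; field_simp
  have h7 : 0 < ε' * τ * Δ := by positivity
  have h8 : 0 < ε' * Δ := by positivity
  calc _ ≤ 1 / 2 * (ε' * τ * Δ) + (ε' * Δ + Δ / 2 * ε') := by linarith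
    _ ≤ (ε' * (τ + 2)) * Δ := by nlinarith
    _ = ε * Δ := by rw [h6]

end Trapezoid

end
-- Moments and Hölder regularity of the solution
noncomputable section

variable {Ω : Type*} [MeasurableSpace Ω] {P : Measure Ω} [IsProbabilityMeasure P] {q : ℝ≥0∞}
  {τ : ℝ} {ν : Measure ℝ} [IsFiniteMeasure ν] {h b x₀ : ℝ → ℝ} {K H c : ℝ} {Z Y : ℝ → Ω → ℝ}

/-- The data of the delay equation with fractional noise, for a jointly measurable version `Y` of
the solution all of whose paths are continuous. -/
structure IsDelayModel (P : Measure Ω) (τ : ℝ) (ν : Measure ℝ) (h b x₀ : ℝ → ℝ) (K H c : ℝ)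
    (Z Y : ℝ → Ω → ℝ) : Prop where
  delay_pos : 0 < τ
  density : IsDelayDensity τ ν h
  contDiff : ContDiff ℝ 2 b
  bound_nonneg : 0 ≤ K
  abs_deriv_le : ∀ x, |deriv b x| ≤ K
  abs_deriv_deriv_le : ∀ x, |deriv (deriv b) x| ≤ K
  contDiffOn : ContDiffOn ℝ 1 x₀ (Icc (-τ) 0)
  half_lt : 1 / 2 < H
  lt_one : H < 1
  scale_pos : 0 < c
  fbm : IsFractionalBrownianMotion H c Z P
  measurable : Measurable (Function.uncurry Y)
  continuous : ∀ ω, Continuous fun t => Y t ω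
  init : ∀ ω, ∀ t ∈ Icc (-τ) 0, Y t ω = x₀ t
  eqn : ∀ᵐ ω ∂P, ∀ t, 0 ≤ t →
    Y t ω = x₀ 0 + (∫ s in (0 : ℝ)..t, delayInt ν h (fun v => b (Y v ω)) s) + Z t ω

theorem LpBdd.sub_comp {φ : ℝ → ℝ} (hφ : Measurable φ) (hK : 0 ≤ K)
    (hφK : ∀ x y, |φ x - φ y| ≤ K * |x - y|) {f g : Ω → ℝ} (hf : Measurable f) (hg : Measurable g)
    {C : ℝ} (hfg : LpBdd P q (fun ω => f ω - g ω) C) :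
    LpBdd P q (fun ω => φ (f ω) - φ (g ω)) (K * C) := by
  have h1 := hfg.const_mul K
  rw [abs_of_nonneg hK] at h1
  refine h1.of_abs_le ((hφ.comp hf).sub (hφ.comp hg)).aestronglyMeasurable
    (Eventually.of_forall fun ω => ?_)
  rw [abs_mul, abs_of_nonneg hK]
  exact hφK _ _

theorem LpBdd.abs {f : Ω → ℝ} {C : ℝ} (hf : LpBdd P q f C) : LpBdd P q (fun ω => |f ω|) C :=
  hf.of_abs_le hf.1.norm (Eventually.of_forall fun ω => by simp)

theorem enorm_integral_le_add_eDelay {K C₀ T : ℝ} {a : ℝ → ℝ → ℝ} {f : ℝ → ℝ≥0∞} {t : ℝ}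
    (ht : 0 ≤ t) (htT : t ≤ T) (hC : 0 ≤ C₀) {G : ℝ → ℝ → ℝ} (hG : ∀ s ∈ Ioc 0 t, ∀ᵐ r ∂ν,
      ‖G s r‖ₑ ≤ ENNReal.ofReal C₀ + ENNReal.ofReal K * (Ici 0).indicator f (a s r)) :
    ‖∫ s in (0 : ℝ)..t, ∫ r, G s r ∂ν‖ₑ ≤
      ENNReal.ofReal (C₀ * ν.real univ * T) + eDelay ν K a f t := by
  rw [intervalIntegral.integral_of_le ht, eDelay]
  refine (enorm_integral_le_lintegral_enorm _).trans ?_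
  have h1 : ∀ s ∈ Ioc 0 t, ‖∫ r, G s r ∂ν‖ₑ ≤ ENNReal.ofReal C₀ * ν univ +
      ENNReal.ofReal K * ∫⁻ r, (Ici 0).indicator f (a s r) ∂ν := fun s hs => by
    refine (enorm_integral_le_lintegral_enorm _).trans ((lintegral_mono_ae (hG s hs)).trans ?_)
    rw [lintegral_add_left measurable_const, lintegral_const,
      lintegral_const_mul' _ _ ENNReal.ofReal_ne_top]
  refine (setLIntegral_mono' measurableSet_Ioc h1).trans ?_
  rw [lintegral_add_left measurable_const, lintegral_const,
    lintegral_const_mul' _ _ ENNReal.ofReal_ne_top]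
  gcongr
  rw [Measure.restrict_apply_univ, Real.volume_Ioc, sub_zero, ENNReal.ofReal_mul (by positivity),
    ENNReal.ofReal_mul hC, Measure.real, ENNReal.ofReal_toReal (measure_ne_top _ _)]
  gcongr

/-- The drift `∫ b(Y_{s - r}) η(dr)`. -/
def delayDrift (ν : Measure ℝ) (h b : ℝ → ℝ) (Y : ℝ → Ω → ℝ) (s : ℝ) (ω : Ω) : ℝ :=
  delayInt ν h (fun v => b (Y v ω)) s

/-- The noise driving `Y`. -/
def delayNoise (ν : Measure ℝ) (h b : ℝ → ℝ) (Y : ℝ → Ω → ℝ) (t : ℝ) (ω : Ω) : ℝ :=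
  Y t ω - Y 0 ω - ∫ s in (0 : ℝ)..t, delayDrift ν h b Y s ω

namespace IsDelayModel

variable (hM : IsDelayModel P τ ν h b x₀ K H c Z Y)

section Drift
include hM

theorem differentiable : Differentiable ℝ b := hM.contDiff.differentiable two_ne_zero

theorem contDiff_deriv : ContDiff ℝ 1 (deriv b) :=
  ((contDiff_succ_iff_deriv (n := 1)).1 hM.contDiff).2.2

theorem measurable_b : Measurable b := hM.contDiff.continuous.measurable

theorem measurable_deriv_b : Measurable (deriv b) := hM.contDiff_deriv.continuous.measurable

theorem abs_sub_le (x y : ℝ) : |b x - b y| ≤ K * |x - y| :=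
  convex_univ.norm_image_sub_le_of_norm_deriv_le (𝕜 := ℝ) (fun z _ => hM.differentiable z)
    (fun z _ => hM.abs_deriv_le z) (mem_univ y) (mem_univ x)

theorem abs_deriv_sub_le (x y : ℝ) : |deriv b x - deriv b y| ≤ K * |x - y| :=
  convex_univ.norm_image_sub_le_of_norm_deriv_le (𝕜 := ℝ)
    (fun z _ => hM.contDiff_deriv.differentiable one_ne_zero z)
    (fun z _ => hM.abs_deriv_deriv_le z) (mem_univ y) (mem_univ x)

/-- The mean value inequality for `z ↦ b z - b'(x) z`, whose derivative on the segment is at most `K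
|y - x|`. -/
theorem abs_taylor_le (x y : ℝ) : |b y - b x - deriv b x * (y - x)| ≤ K * |y - x| ^ 2 := by
  have h1 := (convex_uIcc x y).norm_image_sub_le_of_norm_hasDerivWithin_le (𝕜 := ℝ)
    (f := fun z => b z - deriv b x * z) (f' := fun z => deriv b z - deriv b x) (C := K * |y - x|)
    (fun z _ => by
      have := ((hM.differentiable z).hasDerivAt.sub
        ((hasDerivAt_id z).const_mul (deriv b x))).hasDerivWithinAt (s := uIcc x y)
      rw [mul_one] at this
      exact this)
    (fun z hz => (hM.abs_deriv_sub_le z x).trans (by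
      have := hM.bound_nonneg
      gcongr 1
      exact abs_sub_left_of_mem_uIcc hz)) left_mem_uIcc right_mem_uIcc
  simp only [Real.norm_eq_abs] at h1
  calc |b y - b x - deriv b x * (y - x)|
      = |b y - deriv b x * y - (b x - deriv b x * x)| := by congr 1; ring
    _ ≤ _ := h1.trans (le_of_eq (by ring))

theorem abs_b_le (x : ℝ) : |b x| ≤ |b 0| + K * |x| := by
  have h1 := hM.abs_sub_le x 0
  rw [sub_zero] at h1
  have h2 := abs_sub_abs_le_abs_sub (b x) (b 0)
  linarith

theorem measurable_path (ω : Ω) : Measurable fun t => Y t ω := (hM.continuous ω).measurable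

theorem measurable_eval (t : ℝ) : Measurable (Y t) :=
  hM.measurable.comp (measurable_const.prodMk measurable_id)

theorem measurable_swap : Measurable (fun p : Ω × ℝ => Y p.2 p.1) :=
  hM.measurable.comp _root_.measurable_swap

theorem path_bdd (ω : Ω) (T : ℝ) : ∃ C, 0 ≤ C ∧ ∀ t ∈ Icc (-τ) T, |Y t ω| ≤ C := by
  obtain ⟨C, hC⟩ := (isCompact_Icc (a := -τ) (b := T)).exists_bound_of_continuousOn
    (hM.continuous ω).continuousOn
  exact ⟨|C|, abs_nonneg C, fun t ht => (hC t ht).trans (le_abs_self C)⟩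

theorem path_bdd_b (ω : Ω) (T : ℝ) : ∃ C, 0 ≤ C ∧ ∀ t ∈ Icc (-τ) T, |b (Y t ω)| ≤ C := by
  obtain ⟨C, hC0, hC⟩ := hM.path_bdd ω T
  have := hM.bound_nonneg
  refine ⟨|b 0| + K * C, by positivity, fun t ht => (hM.abs_b_le _).trans ?_⟩
  gcongr
  exact hC t ht

theorem measurable_drift : Measurable (Function.uncurry (delayDrift ν h b Y)) := by
  have h1 : Measurable (fun p : Ω × ℝ => b (Y p.2 p.1)) := hM.measurable_b.comp hM.measurable_swap
  exact (measurable_delayInt hM.density (g := fun ω v => b (Y v ω)) h1).comp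
    _root_.measurable_swap

theorem measurable_drift_path (ω : Ω) : Measurable fun s => delayDrift ν h b Y s ω :=
  hM.measurable_drift.comp (measurable_id.prodMk measurable_const)

theorem drift_bdd (ω : Ω) (T : ℝ) : ∃ C, ∀ s ∈ Icc 0 T, |delayDrift ν h b Y s ω| ≤ C := by
  obtain ⟨C, -, hC⟩ := hM.path_bdd_b ω T
  exact ⟨C * ν.real univ, fun s hs => abs_delayInt_le hM.density fun v h1 h2 =>
    hC v ⟨by linarith [hs.1], h2.trans hs.2⟩⟩

theorem intervalIntegrable_drift (ω : Ω) {T : ℝ} : ∀ u ∈ Icc 0 T, ∀ v ∈ Icc 0 T,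
    IntervalIntegrable (fun s => delayDrift ν h b Y s ω) volume u v := by
  intro u hu v hv
  obtain ⟨C, hC⟩ := hM.drift_bdd ω T
  exact (intervalIntegrable_of_bdd (hM.measurable_drift_path ω) hu.1
    fun s hs => hC s ⟨hs.1, hs.2.trans hu.2⟩).symm.trans
    (intervalIntegrable_of_bdd (hM.measurable_drift_path ω) hv.1
    fun s hs => hC s ⟨hs.1, hs.2.trans hv.2⟩)

theorem measurable_noise : Measurable (Function.uncurry (delayNoise ν h b Y)) := by
  have h0 : Measurable (fun p : ℝ × Ω => Y 0 p.2) := (hM.measurable_eval 0).comp measurable_snd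
  have h1 : Measurable (fun p : (ℝ × Ω) × ℝ => delayDrift ν h b Y p.2 p.1.2) :=
    hM.measurable_drift.comp (measurable_snd.prodMk (measurable_snd.comp measurable_fst))
  exact (hM.measurable.sub h0).sub (measurable_intervalIntegral_param
    (F := fun (p : ℝ × Ω) s => delayDrift ν h b Y s p.2) h1 measurable_const measurable_fst)

theorem eval_eq (t : ℝ) (ω : Ω) :
    Y t ω = Y 0 ω + (∫ s in (0 : ℝ)..t, delayDrift ν h b Y s ω) + delayNoise ν h b Y t ω := by
  unfold delayNoise; ring

theorem eval_zero (ω : Ω) : Y 0 ω = x₀ 0 := hM.init ω 0 ⟨by linarith [hM.delay_pos], le_rfl⟩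

/-- Joint measurability of `Z` is not assumed. Recovering the noise from `Y` gives a jointly
measurable process for which the equation holds for every `ω`, and which agrees with `Z` almost
surely at all times. -/
theorem noise_eq : ∀ᵐ ω ∂P, ∀ t, 0 ≤ t → delayNoise ν h b Y t ω = Z t ω := by
  filter_upwards [hM.eqn] with ω hω t ht
  have h1 := hω t ht
  have h2 := hM.eval_eq t ω
  rw [hM.eval_zero] at h2
  simp only [delayDrift] at h2
  linarith

/-- The noise has the `L^q`-Hölder property of fractional Brownian motion. -/
theorem lpBdd_noise_sub (hqt : q ≠ ∞) {s t : ℝ} (hs : 0 ≤ s) (ht : 0 ≤ t) :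
    LpBdd P q (fun ω => delayNoise ν h b Y t ω - delayNoise ν h b Y s ω)
      (Real.sqrt c * gaussianLpNorm q * |t - s| ^ H) := by
  refine (hM.fbm.lpBdd_sub (by linarith [hM.half_lt]) hqt hs ht).congr ?_
  filter_upwards [hM.noise_eq] with ω hω
  rw [hω s hs, hω t ht]

theorem lpBdd_noise (hqt : q ≠ ∞) {t T : ℝ} (ht : t ∈ Icc 0 T) :
    LpBdd P q (delayNoise ν h b Y t) (Real.sqrt c * gaussianLpNorm q * T ^ H) := by
  have h1 := hM.lpBdd_noise_sub hqt le_rfl ht.1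
  have h2 : ∀ ω, delayNoise ν h b Y 0 ω = 0 := fun ω => by simp [delayNoise]
  simp only [h2, sub_zero, abs_of_nonneg ht.1] at h1
  refine h1.mono ?_
  have := gaussianLpNorm_nonneg (q := q)
  have := hM.half_lt
  gcongr
  · exact ht.1
  · exact ht.2

end Drift

section Moments
include hM

theorem exists_init_bound : ∃ C, 0 ≤ C ∧ ∀ ω, ∀ t ∈ Icc (-τ) 0, |Y t ω| ≤ C := by
  obtain ⟨C, hC⟩ := (isCompact_Icc (a := -τ) (b := 0)).exists_bound_of_continuousOn
    hM.contDiffOn.continuousOn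
  exact ⟨|C|, abs_nonneg C, fun ω t ht => by
    rw [hM.init ω t ht]; exact (hC t ht).trans (le_abs_self C)⟩

/-- Linear growth of `b` and the Gaussian moments of the noise feed Grönwall's inequality, for which
pathwise continuity of `Y` is enough a priori. -/
theorem exists_lpBdd (hq1 : 1 ≤ q) (hqt : q ≠ ∞) (T : ℝ) :
    ∃ C, 0 ≤ C ∧ ∀ t ∈ Icc (-τ) T, LpBdd P q (Y t) C := by
  obtain ⟨C₀, hC₀, hC⟩ := hM.exists_init_bound
  have hK := hM.bound_nonneg
  set T' := max T 0 with hT'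
  have hT'0 : 0 ≤ T' := le_max_right _ _
  set B := |b 0| + K * C₀ with hB
  have hB0 : 0 ≤ B := by positivity
  set A := |x₀ 0| + B * ν.real univ * T' with hA
  have hA0 : 0 ≤ A := by positivity
  have hgn := gaussianLpNorm_nonneg (q := q)
  set D := A + Real.sqrt c * gaussianLpNorm q * T' ^ H with hD
  have hgm : Measurable (Function.uncurry fun t ω => A + |delayNoise ν h b Y t ω|) :=
    measurable_const.add hM.measurable_noise.abs
  have main : ∀ t ∈ Icc 0 T', LpBdd P q (Y t) (D * 2 * Real.exp (volterraRate ν K * T')) := by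
    intro t ht
    refine LpBdd.gronwall (τ := τ) (a := fun s r => s - r) (by fun_prop) hM.density.supp
      (fun s r hr => by linarith [hr.1]) hq1 hqt hK (by positivity) hM.measurable hgm
      (Eventually.of_forall fun ω => ?_) (Eventually.of_forall fun ω u hu => ?_)
      (fun u hu => ?_) ht
    · obtain ⟨C, -, hC⟩ := hM.path_bdd ω T'
      exact ⟨C, fun u hu => hC u ⟨by linarith [hM.delay_pos, hu.1], hu.2⟩⟩
    · have h1 := enorm_integral_le_add_eDelay (ν := ν) (K := K) (C₀ := B) (T := T')
        (a := fun s r => s - r) (f := fun v => ‖Y v ω‖ₑ) hu.1 hu.2 hB0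
        (G := fun s r => h r * b (Y (s - r) ω)) (fun s hs => by
          filter_upwards [hM.density.supp] with r hr
          have e1 : ‖h r * b (Y (s - r) ω)‖ₑ = ENNReal.ofReal |b (Y (s - r) ω)| := by
            rw [← ofReal_norm, Real.norm_eq_abs, abs_mul, hM.density.abs_eq_one, one_mul]
          rw [e1]
          -- At negative times the path is bounded by the deterministic `C₀`, already absorbed in
          -- `B`; only nonnegative times enter the delay operator.
          by_cases h0 : 0 ≤ s - r
          · rw [indicator_of_mem (show s - r ∈ Ici (0:ℝ) from h0), ← ofReal_norm,
              ← ENNReal.ofReal_mul hK, ← ENNReal.ofReal_add hB0 (by positivity)]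
            refine ENNReal.ofReal_le_ofReal ((hM.abs_b_le _).trans ?_)
            rw [Real.norm_eq_abs, hB]
            linarith [mul_nonneg hK hC₀]
          · rw [indicator_of_notMem (show s - r ∉ Ici (0:ℝ) from h0), mul_zero, add_zero]
            refine ENNReal.ofReal_le_ofReal ((hM.abs_b_le _).trans ?_)
            rw [hB]
            gcongr
            exact hC ω _ ⟨by linarith [hr.2, hs.1], by linarith⟩)
      have e2 : Y u ω = (x₀ 0 + delayNoise ν h b Y u ω) +
          ∫ s in (0 : ℝ)..u, ∫ r, h r * b (Y (s - r) ω) ∂ν := by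
        rw [hM.eval_eq u ω, hM.eval_zero]; unfold delayDrift delayInt; ring
      have e3 : ‖Y u ω‖ₑ ≤ ‖x₀ 0 + delayNoise ν h b Y u ω‖ₑ +
          ‖∫ s in (0 : ℝ)..u, ∫ r, h r * b (Y (s - r) ω) ∂ν‖ₑ := by
        conv_lhs => rw [e2]
        exact enorm_add_le _ _
      refine e3.trans ((add_le_add_right h1 _).trans ?_)
      rw [← add_assoc]
      gcongr
      rw [← ofReal_norm, ← ofReal_norm, ← ENNReal.ofReal_add (norm_nonneg _) (by positivity)]
      refine ENNReal.ofReal_le_ofReal ?_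
      rw [Real.norm_eq_abs, Real.norm_eq_abs, abs_of_nonneg (a := A + _) (by positivity), hA]
      linarith [abs_add_le (x₀ 0) (delayNoise ν h b Y u ω)]
    · have := (LpBdd.const (P := P) (q := q) A).add hq1 (abs_nonneg A) (by positivity)
        (hM.lpBdd_noise hqt hu).abs
      rwa [abs_of_nonneg hA0] at this
  refine ⟨max C₀ (D * 2 * Real.exp (volterraRate ν K * T')), le_max_of_le_left hC₀,
    fun t ht => ?_⟩
  by_cases h0 : 0 ≤ t
  · exact (main t ⟨h0, ht.2.trans (le_max_left _ _)⟩).mono (le_max_right _ _)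
  · exact (LpBdd.of_bound (hM.measurable_eval t).aestronglyMeasurable
      (Eventually.of_forall fun ω => hC ω t ⟨ht.1, (not_le.1 h0).le⟩)).mono (le_max_left _ _)

theorem exists_lpBdd_b (hq1 : 1 ≤ q) (hqt : q ≠ ∞) (T : ℝ) :
    ∃ C, 0 ≤ C ∧ ∀ t ∈ Icc (-τ) T, LpBdd P q (fun ω => b (Y t ω)) C := by
  obtain ⟨C, hC0, hC⟩ := hM.exists_lpBdd hq1 hqt T
  have hK := hM.bound_nonneg
  refine ⟨|b 0| + K * C, by positivity, fun t ht => ?_⟩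
  have h1 := ((hC t ht).abs.const_mul K)
  rw [abs_of_nonneg hK] at h1
  have h2 := ((LpBdd.const (P := P) (q := q) (b 0)).abs.add hq1 (abs_nonneg _) (by positivity) h1)
  refine h2.of_abs_le (hM.measurable_b.comp (hM.measurable_eval t)).aestronglyMeasurable
    (Eventually.of_forall fun ω => ?_)
  exact (hM.abs_b_le _).trans (le_abs_self _)

theorem lpBdd_delayInt (hq1 : 1 ≤ q) (hqt : q ≠ ∞) {F : ℝ → Ω → ℝ}
    (hF : Measurable (Function.uncurry F)) {C : ℝ} (hC : ∀ r ∈ Icc 0 τ, LpBdd P q (F r) C) :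
    LpBdd P q (fun ω => ∫ r, h r * F r ω ∂ν) (ν.real univ * C) := by
  have hm : Measurable (Function.uncurry fun r ω => h r * F r ω) :=
    (hM.density.measurable.comp measurable_fst).mul hF
  refine LpBdd.integral hq1 hqt hm ?_
  filter_upwards [hM.density.supp] with r hr
  have := (hC r hr).const_mul (h r)
  rwa [hM.density.abs_eq_one, one_mul] at this

/-- The solution is `L^q`-Hölder continuous with exponent `H`. -/
theorem exists_lpBdd_sub (hq1 : 1 ≤ q) (hqt : q ≠ ∞) (T : ℝ) :
    ∃ C, 0 ≤ C ∧ ∀ s ∈ Icc (-τ) T, ∀ t ∈ Icc (-τ) T,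
      LpBdd P q (fun ω => Y t ω - Y s ω) (C * |t - s| ^ H) := by
  obtain ⟨B, hB0, hB⟩ := hM.exists_lpBdd_b hq1 hqt T
  have hτ := hM.delay_pos
  have hH := hM.half_lt
  have hH1 := hM.lt_one
  have hgn := gaussianLpNorm_nonneg (q := q)
  obtain ⟨d, hd, hfd⟩ := hM.contDiffOn.exists_eq_primitive (by linarith : -τ < 0)
  obtain ⟨L, hL⟩ := (isCompact_Icc (a := -τ) (b := 0)).exists_bound_of_continuousOn hd.continuousOn
  set S := τ + |T| with hS
  have hS0 : 0 ≤ S := by positivity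
  -- On a bounded interval Lipschitz bounds are `H`-Hölder bounds. This handles the initial segment
  -- and the drift; only the noise has genuine regularity `H`.
  have hpow : ∀ x, 0 ≤ x → x ≤ S → x ≤ S ^ (1 - H) * x ^ H := by
    intro x hx hxS
    calc x = x ^ (1 - H) * x ^ H := by
          rw [← Real.rpow_add' hx (by norm_num), sub_add_cancel, Real.rpow_one]
      _ ≤ S ^ (1 - H) * x ^ H := by
          gcongr
  set C₁ := |L| * S ^ (1 - H) with hC₁
  set C₂ := ν.real univ * B * S ^ (1 - H) + Real.sqrt c * gaussianLpNorm q with hC₂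
  have hC₁0 : 0 ≤ C₁ := by positivity
  have hC₂0 : 0 ≤ C₂ := by positivity
  have neg : ∀ s t, -τ ≤ s → s ≤ t → t ≤ 0 →
      LpBdd P q (fun ω => Y t ω - Y s ω) (C₁ * |t - s| ^ H) := by
    intro s t hs hst ht
    refine LpBdd.of_bound ((hM.measurable_eval t).sub (hM.measurable_eval s)).aestronglyMeasurable
      (Eventually.of_forall fun ω => ?_)
    rw [hM.init ω t ⟨hs.trans hst, ht⟩, hM.init ω s ⟨hs, hst.trans ht⟩,
      hfd t ⟨hs.trans hst, ht⟩, hfd s ⟨hs, hst.trans ht⟩, add_sub_add_left_eq_sub,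
      intervalIntegral.integral_interval_sub_left (hd.intervalIntegrable _ _)
        (hd.intervalIntegrable _ _)]
    have := intervalIntegral.norm_integral_le_of_norm_le_const (a := s) (b := t) (C := |L|)
      (f := d) (fun x hx => by
        rw [uIoc_of_le hst] at hx
        exact (hL x ⟨by linarith [hx.1], by linarith [hx.2]⟩).trans (le_abs_self L))
    refine this.trans ?_
    rw [hC₁, mul_assoc]
    gcongr
    exact hpow _ (abs_nonneg _) (by rw [abs_of_nonneg (sub_nonneg.2 hst)]; linarith [abs_nonneg T])
  have pos : ∀ s t, 0 ≤ s → s ≤ t → t ≤ T →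
      LpBdd P q (fun ω => Y t ω - Y s ω) (C₂ * |t - s| ^ H) := by
    intro s t hs hst ht
    have e : (fun ω => Y t ω - Y s ω) = fun ω => (∫ u in s..t, delayDrift ν h b Y u ω) +
        (delayNoise ν h b Y t ω - delayNoise ν h b Y s ω) := by
      ext ω
      rw [hM.eval_eq t ω, hM.eval_eq s ω, ← intervalIntegral.integral_interval_sub_left
        (hM.intervalIntegrable_drift ω (T := t) 0 ⟨le_rfl, hs.trans hst⟩ t ⟨hs.trans hst, le_rfl⟩)
        (hM.intervalIntegrable_drift ω (T := t) 0 ⟨le_rfl, hs.trans hst⟩ s ⟨hs, hst⟩)]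
      ring
    rw [e]
    have hdr := LpBdd.intervalIntegral (P := P) (q := q) (C := ν.real univ * B) hq1 hqt
      hM.measurable_drift hst (fun u hu => by
        have hm : Measurable (Function.uncurry fun r ω => b (Y (u - r) ω)) :=
          hM.measurable_b.comp (hM.measurable.comp
            ((measurable_const.sub measurable_fst).prodMk measurable_snd))
        exact hM.lpBdd_delayInt hq1 hqt hm fun r hr =>
          hB _ ⟨by linarith [hu.1, hr.2], by linarith [hu.2, hr.1]⟩)
    refine (hdr.add hq1 (mul_nonneg (sub_nonneg.2 hst) (by positivity)) (by positivity)
      (hM.lpBdd_noise_sub hqt hs (hs.trans hst))).mono ?_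
    have h1 := hpow (t - s) (sub_nonneg.2 hst) (by linarith [le_abs_self T])
    rw [abs_of_nonneg (sub_nonneg.2 hst), hC₂, add_mul]
    have h2 : (t - s) * (ν.real univ * B) ≤ (S ^ (1 - H) * (t - s) ^ H) * (ν.real univ * B) := by
      gcongr
    linarith
  have main : ∀ s t, -τ ≤ s → s ≤ t → t ≤ T →
      LpBdd P q (fun ω => Y t ω - Y s ω) ((C₁ + C₂) * |t - s| ^ H) := by
    intro s t hs hst ht
    by_cases h1 : t ≤ 0
    · exact (neg s t hs hst h1).mono (by gcongr; linarith)
    by_cases h2 : 0 ≤ s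
    · exact (pos s t h2 hst ht).mono (by gcongr; linarith)
    push Not at h1 h2
    have e : (fun ω => Y t ω - Y s ω) = fun ω => (Y 0 ω - Y s ω) + (Y t ω - Y 0 ω) := by
      ext ω; ring
    rw [e, add_mul]
    refine ((neg s 0 hs h2.le le_rfl).add hq1 (by positivity) (by positivity)
      (pos 0 t le_rfl h1.le ht)).mono ?_
    gcongr 2
    · gcongr 1
      rw [abs_of_nonneg (by linarith), abs_of_nonneg (by linarith)]
      linarith
    · gcongr 1
      rw [abs_of_nonneg (by linarith), abs_of_nonneg (by linarith)]
      linarith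
  refine ⟨C₁ + C₂, by positivity, fun s hs t ht => ?_⟩
  rcases le_total s t with hst | hst
  · exact main s t hs.1 hst ht.2
  · have := (main t s ht.1 hst hs.2).neg
    simp only [neg_sub] at this
    rwa [abs_sub_comm] at this

end Moments

end IsDelayModel

end
-- Sums of second differences along the solution
noncomputable section

variable {Ω : Type*} [MeasurableSpace Ω] {P : Measure Ω} [IsProbabilityMeasure P] {q : ℝ≥0∞}
  {τ : ℝ} {ν : Measure ℝ} [IsFiniteMeasure ν] {h b x₀ : ℝ → ℝ} {K H c : ℝ} {Z Y : ℝ → Ω → ℝ}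

theorem one_le_two_mul_ennreal (hq1 : 1 ≤ q) : 1 ≤ 2 * q :=
  hq1.trans (by rw [two_mul]; exact le_self_add)

theorem natCast_rpow_le {Δ T e : ℝ} (hΔ : 0 < Δ) (he : 0 ≤ e) {m : ℕ} (hm : m * Δ ≤ T) :
    (m : ℝ) ^ e ≤ T ^ e * Δ ^ (-e) := by
  have hT : 0 ≤ T := le_trans (by positivity) hm
  rw [Real.rpow_neg hΔ.le, ← div_eq_mul_inv, ← Real.div_rpow hT hΔ.le]
  gcongr
  rwa [le_div_iff₀ hΔ]

namespace IsDelayModel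

variable (hM : IsDelayModel P τ ν h b x₀ K H c Z Y)
include hM

theorem lpBdd_taylor {s t C : ℝ} (hC : 0 ≤ C) (hst : LpBdd P (2 * q) (fun ω => Y t ω - Y s ω) C) :
    LpBdd P q (fun ω => b (Y t ω) - b (Y s ω) - deriv b (Y s ω) * (Y t ω - Y s ω))
      (K * (C * C)) := by
  have h1 := (hst.mul hC hst).const_mul K
  rw [abs_of_nonneg hM.bound_nonneg] at h1
  have mt := hM.measurable_eval t
  have ms := hM.measurable_eval s
  refine h1.of_abs_le (((hM.measurable_b.comp mt).sub (hM.measurable_b.comp ms)).sub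
    ((hM.measurable_deriv_b.comp ms).mul (mt.sub ms))).aestronglyMeasurable
    (Eventually.of_forall fun ω => (hM.abs_taylor_le _ _).trans ?_)
  rw [abs_mul, abs_mul, abs_of_nonneg hM.bound_nonneg, sq]

theorem lpBdd_drift_sub (hq1 : 1 ≤ q) (hqt : q ≠ ∞) {T C : ℝ}
    (hC : ∀ s ∈ Icc (-τ) T, ∀ t ∈ Icc (-τ) T,
      LpBdd P q (fun ω => Y t ω - Y s ω) (C * |t - s| ^ H)) {s t : ℝ} (hs : s ∈ Icc 0 T)
    (ht : t ∈ Icc 0 T) :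
    LpBdd P q (fun ω => delayDrift ν h b Y t ω - delayDrift ν h b Y s ω)
      (ν.real univ * (K * (C * |t - s| ^ H))) := by
  have e : (fun ω => delayDrift ν h b Y t ω - delayDrift ν h b Y s ω) =
      fun ω => ∫ r, h r * (b (Y (t - r) ω) - b (Y (s - r) ω)) ∂ν := by
    ext ω
    have hi : ∀ u ∈ Icc 0 T, Integrable (fun r => h r * b (Y (u - r) ω)) ν := fun u hu => by
      obtain ⟨D, -, hD⟩ := hM.path_bdd_b ω T
      exact integrable_delay (g := fun v => b (Y v ω)) hM.density
        (hM.measurable_b.comp (hM.measurable_path ω))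
        fun v h1 h2 => hD v ⟨by linarith [hu.1], by linarith [hu.2]⟩
    simp only [mul_sub]
    exact (integral_sub (hi t ht) (hi s hs)).symm
  rw [e]
  have hm : ∀ u : ℝ, Measurable (fun p : ℝ × Ω => b (Y (u - p.1) p.2)) := fun u =>
    hM.measurable_b.comp (hM.measurable.comp
      ((measurable_const.sub measurable_fst).prodMk measurable_snd))
  refine hM.lpBdd_delayInt (F := fun r ω => b (Y (t - r) ω) - b (Y (s - r) ω)) hq1 hqt
    ((hm t).sub (hm s)) fun r hr => ?_
  have h1 := hC (s - r) ⟨by linarith [hs.1, hr.2], by linarith [hs.2, hr.1]⟩ (t - r)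
    ⟨by linarith [ht.1, hr.2], by linarith [ht.2, hr.1]⟩
  rw [sub_sub_sub_cancel_right] at h1
  exact h1.sub_comp hM.measurable_b hM.bound_nonneg hM.abs_sub_le (hM.measurable_eval _)
    (hM.measurable_eval _)

theorem lpBdd_sum_secondDiff_noise (hqt : q ≠ ∞) {Δ δ : ℝ} (h0 : 0 ≤ δ) (h1 : δ ≤ Δ) (i j : ℕ) :
    LpBdd P q (fun ω => ∑ k ∈ Finset.Ico i j,
      secondDiff Δ δ (fun t => delayNoise ν h b Y t ω) k)
      (2 * Real.sqrt c * gaussianLpNorm q * Δ ^ H * ((j - i : ℕ) : ℝ) ^ (1 / 2 : ℝ)) := by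
  refine (hM.fbm.lpBdd_sum_secondDiff hM.half_lt hM.lt_one hM.scale_pos hqt h0 h1 i j).congr ?_
  have hΔ : 0 ≤ Δ := h0.trans h1
  filter_upwards [hM.noise_eq] with ω hω
  refine Finset.sum_congr rfl fun k _ => ?_
  have hk : 0 ≤ (k : ℝ) * Δ := by positivity
  simp only [secondDiff]
  rw [hω _ (by linarith), hω _ (by linarith), hω _ hk, hω _ (by linarith)]

/-- Weighted sums of the second differences of the noise are small, by sewing. -/
theorem exists_lpBdd_sum_noise (hq1 : 1 ≤ q) (hqt : q ≠ ∞) (T : ℝ) :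
    ∃ C, 0 ≤ C ∧ ∀ Δ, 0 < Δ → ∀ δ ∈ Icc 0 Δ, ∀ m : ℕ, m * Δ ≤ T →
      LpBdd P q (fun ω => ∑ k ∈ Finset.range m, deriv b (Y (k * Δ) ω) *
        secondDiff Δ δ (fun t => delayNoise ν h b Y t ω) k) (C * Δ ^ (H - 1 / 2)) := by
  have hK := hM.bound_nonneg
  have hH := hM.half_lt
  have hτ := hM.delay_pos
  have h2t : 2 * q ≠ ∞ := ENNReal.mul_ne_top (by simp) hqt
  by_cases hT : 0 ≤ T
  swap
  · refine ⟨0, le_rfl, fun Δ hΔ δ _ m hm => ?_⟩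
    exact absurd (le_trans (by positivity) hm) hT
  obtain ⟨A, hA0, hA⟩ := hM.exists_lpBdd_sub (one_le_two_mul_ennreal hq1) h2t T
  have hg1 := gaussianLpNorm_nonneg (q := q)
  have hg2 := gaussianLpNorm_nonneg (q := 2 * q)
  set B := 2 * Real.sqrt c * gaussianLpNorm (2 * q) with hB
  set B' := 2 * Real.sqrt c * gaussianLpNorm q with hB'
  have h2 : (2 : ℝ) < 2 ^ (H + 1 / 2) := by
    simpa using Real.rpow_lt_rpow_of_exponent_lt (x := 2) (y := 1) (by norm_num)
      (by linarith : 1 < H + 1 / 2)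
  set S := (2 : ℝ) ^ (H + 1 / 2) / (2 ^ (H + 1 / 2) - 2) with hS
  have hS0 : 0 ≤ S := div_nonneg (by positivity) (by linarith)
  refine ⟨S * (K * A * B) * T ^ (H + 1 / 2) + K * B' * T ^ (1 / 2 : ℝ), by positivity,
    fun Δ hΔ δ hδ m hm => ?_⟩
  have hf : ∀ i j, i ≤ j → j ≤ m → LpBdd P (2 * q)
      (fun ω => deriv b (Y (j * Δ) ω) - deriv b (Y (i * Δ) ω))
      (K * A * Δ ^ H * ((j - i : ℕ) : ℝ) ^ H) := by
    intro i j hij hj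
    have hi' : (i : ℝ) * Δ ≤ m * Δ := by gcongr; exact_mod_cast hij.trans hj
    have hj' : (j : ℝ) * Δ ≤ m * Δ := by gcongr
    have := (hA (i * Δ) ⟨by nlinarith [(Nat.cast_nonneg i : (0:ℝ) ≤ i)], by linarith⟩ (j * Δ)
      ⟨by nlinarith [(Nat.cast_nonneg j : (0:ℝ) ≤ j)], by linarith⟩).sub_comp
      hM.measurable_deriv_b hK hM.abs_deriv_sub_le (hM.measurable_eval _) (hM.measurable_eval _)
    refine this.mono (le_of_eq ?_)
    rw [← sub_mul, ← Nat.cast_sub hij, abs_of_nonneg (by positivity),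
      Real.mul_rpow (by positivity) hΔ.le]
    ring
  have hG : ∀ i j, i ≤ j → j ≤ m → LpBdd P (2 * q) (fun ω => ∑ k ∈ Finset.Ico i j,
      secondDiff Δ δ (fun t => delayNoise ν h b Y t ω) k)
      (B * Δ ^ H * ((j - i : ℕ) : ℝ) ^ (1 / 2 : ℝ)) := fun i j _ _ =>
    hM.lpBdd_sum_secondDiff_noise h2t hδ.1 hδ.2 i j
  -- Hölder exponent `H` of the weights and growth exponent `1 / 2` of the noise sums: `H + 1 / 2 >
  -- 1`.
  have key := LpBdd.sewing (P := P) (f := fun k ω => deriv b (Y (k * Δ) ω))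
    (G := fun k ω => secondDiff Δ δ (fun t => delayNoise ν h b Y t ω) k) hq1
    (by positivity) (by positivity) (by norm_num : (0:ℝ) ≤ 1 / 2) (by linarith : 1 < H + 1 / 2) hf hG
  -- Sewing compares with the sum whose weight is frozen at time `0`; that sum is bounded directly,
  -- since `b'` is bounded.
  have key2 := LpBdd.bdd_mul (P := P) (f := fun ω => deriv b (Y ((0 : ℕ) * Δ) ω))
    (hM.measurable_deriv_b.comp (hM.measurable_eval _)).aestronglyMeasurable hK
    (Eventually.of_forall fun ω => hM.abs_deriv_le _)
    (hM.lpBdd_sum_secondDiff_noise hqt hδ.1 hδ.2 0 m)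
  rw [← Finset.range_eq_Ico, Nat.sub_zero] at key2
  have := key.add hq1 (by positivity) (by positivity) key2
  simp only [sub_add_cancel] at this
  refine this.mono ?_
  rw [← hS, ← hB', add_mul]
  have e1 : Δ ^ H * Δ ^ H * Δ ^ (-(H + 1 / 2)) = Δ ^ (H - 1 / 2) := by
    rw [← Real.rpow_add hΔ, ← Real.rpow_add hΔ]; congr 1; ring
  have e2 : Δ ^ H * Δ ^ (-(1 / 2 : ℝ)) = Δ ^ (H - 1 / 2) := by
    rw [← Real.rpow_add hΔ]; congr 1
  refine add_le_add ?_ ?_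
  · calc S * (K * A * Δ ^ H * (B * Δ ^ H)) * (m : ℝ) ^ (H + 1 / 2)
        ≤ S * (K * A * Δ ^ H * (B * Δ ^ H)) * (T ^ (H + 1 / 2) * Δ ^ (-(H + 1 / 2))) := by
          gcongr
          exact natCast_rpow_le hΔ (by linarith) hm
      _ = S * (K * A * B) * T ^ (H + 1 / 2) * (Δ ^ H * Δ ^ H * Δ ^ (-(H + 1 / 2))) := by ring
      _ = _ := by rw [e1]
  · calc K * (B' * Δ ^ H * (m : ℝ) ^ (1 / 2 : ℝ))
        ≤ K * (B' * Δ ^ H * (T ^ (1 / 2 : ℝ) * Δ ^ (-(1 / 2 : ℝ)))) := by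
          gcongr
          exact natCast_rpow_le hΔ (by norm_num) hm
      _ = K * B' * T ^ (1 / 2 : ℝ) * (Δ ^ H * Δ ^ (-(1 / 2 : ℝ))) := by ring
      _ = _ := by rw [e2]

/-- The drift inherits Hölder exponent `H` from `Y`, so its primitive has second differences of
order `Δ^{1+H}`. -/
theorem lpBdd_secondDiff_drift (hq1 : 1 ≤ q) (hqt : q ≠ ∞) {T C : ℝ} (hC0 : 0 ≤ C)
    (hC : ∀ s ∈ Icc (-τ) T, ∀ t ∈ Icc (-τ) T,
      LpBdd P q (fun ω => Y t ω - Y s ω) (C * |t - s| ^ H)) {Δ δ : ℝ} (h0 : 0 ≤ δ) (h1 : δ ≤ Δ)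
    {k : ℕ} (hk : (k + 1) * Δ ≤ T) :
    LpBdd P q (fun ω => secondDiff Δ δ
      (fun t => Y 0 ω + ∫ s in (0 : ℝ)..t, delayDrift ν h b Y s ω) k)
      (Δ * (ν.real univ * (K * (C * Δ ^ H)))) := by
  have hΔ : 0 ≤ Δ := h0.trans h1
  have hK := hM.bound_nonneg
  have hH := hM.half_lt
  have hk0 : 0 ≤ (k : ℝ) * Δ := by positivity
  have e : (fun ω => secondDiff Δ δ
      (fun t => Y 0 ω + ∫ s in (0 : ℝ)..t, delayDrift ν h b Y s ω) k) =
      fun ω => ∫ x in (0 : ℝ)..δ, (delayDrift ν h b Y (k * Δ + x) ω -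
        delayDrift ν h b Y ((k + 1) * Δ - δ + x) ω) := by
    ext ω
    exact secondDiff_primitive (hM.intervalIntegrable_drift ω) _ h0 h1 hk
  rw [e]
  have hm : ∀ u : ℝ, Measurable (fun p : ℝ × Ω => delayDrift ν h b Y (u + p.1) p.2) := fun u =>
    hM.measurable_drift.comp ((measurable_const.add measurable_fst).prodMk measurable_snd)
  have := LpBdd.intervalIntegral (P := P) (q := q) (C := ν.real univ * (K * (C * Δ ^ H))) hq1 hqt
    (F := fun x ω => delayDrift ν h b Y (k * Δ + x) ω -
        delayDrift ν h b Y ((k + 1) * Δ - δ + x) ω) ((hm _).sub (hm _)) h0 (fun x hx => by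
      refine (hM.lpBdd_drift_sub hq1 hqt hC ⟨by linarith [hx.1], by linarith [hx.2]⟩
        ⟨by linarith [hx.1], by linarith [hx.2]⟩).mono ?_
      gcongr
      rw [abs_le]; constructor <;> linarith)
  refine this.mono ?_
  rw [sub_zero]
  gcongr

/-- The sums of second differences of `b(Y)` are small in `L^q`. -/
theorem exists_lpBdd_sum_secondDiff (hq1 : 1 ≤ q) (hqt : q ≠ ∞) (T : ℝ) :
    ∃ C, 0 ≤ C ∧ ∀ Δ, 0 < Δ → ∀ δ ∈ Icc 0 Δ, ∀ m : ℕ, m * Δ ≤ T →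
      LpBdd P q (fun ω => ∑ k ∈ Finset.range m, secondDiff Δ δ (fun t => b (Y t ω)) k)
        (C * (Δ ^ (2 * H - 1) + Δ ^ H + Δ ^ (H - 1 / 2))) := by
  have hK := hM.bound_nonneg
  have hH := hM.half_lt
  have hτ := hM.delay_pos
  have h2t : 2 * q ≠ ∞ := ENNReal.mul_ne_top (by simp) hqt
  obtain ⟨A, hA0, hA⟩ := hM.exists_lpBdd_sub (one_le_two_mul_ennreal hq1) h2t T
  obtain ⟨B, hB0, hB⟩ := hM.exists_lpBdd_sub hq1 hqt T
  obtain ⟨D, hD0, hD⟩ := hM.exists_lpBdd_sum_noise hq1 hqt T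
  set C₁ := 3 * K * A ^ 2 * |T| with hC₁
  set C₂ := |T| * (K * (ν.real univ * (K * B))) with hC₂
  have hC₁0 : 0 ≤ C₁ := by positivity
  have hC₂0 : 0 ≤ C₂ := by positivity
  refine ⟨C₁ + C₂ + D, by positivity, fun Δ hΔ δ hδ m hm => ?_⟩
  have hT : m * Δ ≤ |T| := hm.trans (le_abs_self T)
  have hcell : ∀ k ∈ Finset.range m, 0 ≤ (k : ℝ) * Δ ∧ ((k : ℝ) + 1) * Δ ≤ T := fun k hk => by
    refine ⟨by positivity, le_trans ?_ hm⟩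
    gcongr; exact_mod_cast Finset.mem_range.1 hk
  -- Taylor expansion of `b` at the left endpoint of the cell. The left endpoint itself has no
  -- remainder, which leaves three, each of order `Δ^{2H}`.
  have r1 : ∀ k ∈ Finset.range m, LpBdd P q (fun ω => secondDiff Δ δ (fun t => b (Y t ω)) k -
      deriv b (Y (k * Δ) ω) * secondDiff Δ δ (fun t => Y t ω) k)
      (3 * (K * (A * Δ ^ H * (A * Δ ^ H)))) := by
    intro k hk
    obtain ⟨k0, k1⟩ := hcell k hk
    have tl : ∀ p, k * Δ ≤ p → p ≤ (k + 1) * Δ → LpBdd P q (fun ω => b (Y p ω) - b (Y (k * Δ) ω) -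
        deriv b (Y (k * Δ) ω) * (Y p ω - Y (k * Δ) ω)) (K * (A * Δ ^ H * (A * Δ ^ H))) := by
      intro p hp1 hp2
      refine hM.lpBdd_taylor (by positivity) ((hA _ ⟨by linarith, by linarith⟩ p
        ⟨by linarith, by linarith⟩).mono ?_)
      gcongr
      rw [abs_of_nonneg (by linarith)]; linarith
    have t1 := tl (k * Δ + δ) (by linarith [hδ.1]) (by linarith [hδ.2])
    have t2 := tl ((k + 1) * Δ - δ) (by linarith [hδ.2]) (by linarith [hδ.1])
    have t3 := tl ((k + 1) * Δ) (by linarith) (by linarith)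
    have := (t1.add hq1 (by positivity) (by positivity) t2).sub hq1 (by positivity)
      (by positivity) t3
    refine (this.mono (le_of_eq (by ring))).congr (Eventually.of_forall fun ω => ?_)
    simp only [secondDiff]
    ring
  have r2 : ∀ k ∈ Finset.range m, LpBdd P q (fun ω => deriv b (Y (k * Δ) ω) * secondDiff Δ δ
      (fun t => Y 0 ω + ∫ s in (0 : ℝ)..t, delayDrift ν h b Y s ω) k)
      (K * (Δ * (ν.real univ * (K * (B * Δ ^ H))))) := by
    intro k hk
    exact LpBdd.bdd_mul (hM.measurable_deriv_b.comp (hM.measurable_eval _)).aestronglyMeasurable hK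
      (Eventually.of_forall fun ω => hM.abs_deriv_le _)
      (hM.lpBdd_secondDiff_drift hq1 hqt hB0 hB hδ.1 hδ.2 (hcell k hk).2)
  have s1 := LpBdd.sum hq1 (Finset.range m) (fun _ _ => by positivity) r1
  have s2 := LpBdd.sum hq1 (Finset.range m) (fun _ _ => by positivity) r2
  have s3 := hD Δ hΔ δ hδ m hm
  rw [Finset.sum_const, Finset.card_range, nsmul_eq_mul] at s1 s2
  have := (s1.add hq1 (by positivity) (by positivity) s2).add hq1 (by positivity) (by positivity) s3
  refine (this.mono ?_).congr (Eventually.of_forall fun ω => ?_)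
  -- As `m Δ ≤ |T|`, summing over the `m` cells costs one factor `Δ⁻¹`.
  · have e1 : Δ ^ (2 * H - 1) * Δ = Δ ^ H * Δ ^ H := by
      nth_rw 2 [← Real.rpow_one Δ]
      rw [← Real.rpow_add hΔ, ← Real.rpow_add hΔ]; congr 1; ring
    have b1 : m * (3 * (K * (A * Δ ^ H * (A * Δ ^ H)))) ≤ C₁ * Δ ^ (2 * H - 1) := by
      calc m * (3 * (K * (A * Δ ^ H * (A * Δ ^ H))))
          = 3 * K * A ^ 2 * m * (Δ ^ H * Δ ^ H) := by ring
        _ = 3 * K * A ^ 2 * (m * Δ) * Δ ^ (2 * H - 1) := by rw [← e1]; ring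
        _ ≤ C₁ * Δ ^ (2 * H - 1) := by rw [hC₁]; gcongr
    have b2 : m * (K * (Δ * (ν.real univ * (K * (B * Δ ^ H))))) ≤ C₂ * Δ ^ H := by
      calc m * (K * (Δ * (ν.real univ * (K * (B * Δ ^ H)))))
          = (m * Δ) * (K * (ν.real univ * (K * B))) * Δ ^ H := by ring
        _ ≤ C₂ * Δ ^ H := by rw [hC₂]; gcongr
    have p1 : 0 ≤ Δ ^ (2 * H - 1) := by positivity
    have p2 : 0 ≤ Δ ^ H := by positivity
    have p3 : 0 ≤ Δ ^ (H - 1 / 2) := by positivity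
    have q1 := mul_nonneg hC₁0 p2
    have q2 := mul_nonneg hC₁0 p3
    have q3 := mul_nonneg hC₂0 p1
    have q4 := mul_nonneg hC₂0 p3
    have q5 := mul_nonneg hD0 p1
    have q6 := mul_nonneg hD0 p2
    linarith
  · simp only [← Finset.sum_add_distrib]
    refine Finset.sum_congr rfl fun k _ => ?_
    simp only [secondDiff]
    rw [hM.eval_eq (k * Δ + δ) ω, hM.eval_eq ((k + 1) * Δ - δ) ω, hM.eval_eq ((k + 1) * Δ) ω]
    have e0 := hM.eval_eq (k * Δ) ω
    set d := deriv b (Y (k * Δ) ω)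
    rw [show Y 0 ω + ∫ s in (0:ℝ)..(k * Δ), delayDrift ν h b Y s ω =
      Y (k * Δ) ω - delayNoise ν h b Y (k * Δ) ω by rw [e0]; ring]
    ring

end IsDelayModel

end
-- Decomposition of the forcing and the trapezoidal error in `L^q`
noncomputable section

variable {Ω : Type*} [MeasurableSpace Ω] {P : Measure Ω} [IsProbabilityMeasure P] {q : ℝ≥0∞}
  {τ : ℝ} {ν : Measure ℝ} [IsFiniteMeasure ν] {h b x₀ : ℝ → ℝ} {K H c : ℝ} {Z Y : ℝ → Ω → ℝ}

section Forcing

/-- The forcing `∫ (y(s - r) - y(s - [r / Δ] Δ)) η(dr)` due to the discretization of the delay. -/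
def shiftForcing (ν : Measure ℝ) (h : ℝ → ℝ) (Δ : ℝ) (y : ℝ → ℝ) (s : ℝ) : ℝ :=
  ∫ r, h r * (y (s - r) - y (s - gridFloor Δ r)) ∂ν

/-- The total forcing of the error of the Euler scheme. -/
def eulerForcing (ν : Measure ℝ) (h : ℝ → ℝ) (Δ : ℝ) (y : ℝ → ℝ) (t : ℝ) : ℝ :=
  ∫ s in (0 : ℝ)..t, ∫ r, h r * (y (s - r) - y (gridFloor Δ s - gridFloor Δ r)) ∂ν

/-- The forcing due to the discretization of time. -/
def gridForcing (ν : Measure ℝ) (h : ℝ → ℝ) (Δ : ℝ) (y : ℝ → ℝ) (t : ℝ) : ℝ :=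
  ∫ r, h r * (∫ s in (0 : ℝ)..t, (y (s - gridFloor Δ r) - y (gridFloor Δ s - gridFloor Δ r))) ∂ν

/-- The limit `(1/2) ∫ (y(t - r) - y(-r)) η(dr)` of the rescaled forcing. -/
def halfForcing (ν : Measure ℝ) (h : ℝ → ℝ) (y : ℝ → ℝ) (t : ℝ) : ℝ :=
  1 / 2 * ∫ r, h r * (y (t - r) - y (-r)) ∂ν

theorem integral_delay_swap (hh : IsDelayDensity τ ν h) {F : ℝ → ℝ → ℝ}
    (hF : Measurable (Function.uncurry F)) {t C : ℝ} (ht : 0 ≤ t)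
    (hC : ∀ s ∈ Ioc 0 t, ∀ r ∈ Icc 0 τ, |F s r| ≤ C) :
    ∫ s in (0 : ℝ)..t, ∫ r, h r * F s r ∂ν = ∫ r, h r * (∫ s in (0 : ℝ)..t, F s r) ∂ν := by
  simp only [intervalIntegral.integral_of_le ht]
  have hm : Measurable (Function.uncurry fun s r => h r * F s r) :=
    (hh.measurable.comp measurable_snd).mul hF
  rw [integral_swap_of_bdd (μ := volume.restrict (Ioc 0 t)) (ρ := ν) (C := C) hm]
  · simp only [integral_const_mul]
  · filter_upwards [ae_restrict_mem measurableSet_Ioc] with s hs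
    filter_upwards [hh.supp] with r hr
    rw [abs_mul, hh.abs_eq_one, one_mul]
    exact hC s hs r hr

theorem intervalIntegrable_delay (hh : IsDelayDensity τ ν h) {F : ℝ → ℝ → ℝ}
    (hF : Measurable (Function.uncurry F)) {t C : ℝ} (ht : 0 ≤ t)
    (hC : ∀ s ∈ Ioc 0 t, ∀ r ∈ Icc 0 τ, |F s r| ≤ C) :
    IntervalIntegrable (fun s => ∫ r, h r * F s r ∂ν) volume 0 t := by
  have hm : Measurable (Function.uncurry fun s r => h r * F s r) :=
    (hh.measurable.comp measurable_snd).mul hF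
  rw [intervalIntegrable_iff_integrableOn_Ioc_of_le ht]
  refine Measure.integrableOn_of_bounded (M := C * ν.real univ) (by simp)
    (StronglyMeasurable.integral_prod_right (f := fun s r => h r * F s r)
      hm.stronglyMeasurable).aestronglyMeasurable ?_
  filter_upwards [ae_restrict_mem measurableSet_Ioc] with s hs
  refine norm_integral_le_of_norm_le_const ?_
  filter_upwards [hh.supp] with r hr
  rw [Real.norm_eq_abs, abs_mul, hh.abs_eq_one, one_mul]
  exact hC s hs r hr

theorem integrable_delay_section (hh : IsDelayDensity τ ν h) {f : ℝ → ℝ} (hf : Measurable f) {C : ℝ}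
    (hC : ∀ r ∈ Icc 0 τ, |f r| ≤ C) : Integrable (fun r => h r * f r) ν := by
  refine Integrable.of_bound (C := C) (hh.measurable.mul hf).aestronglyMeasurable ?_
  filter_upwards [hh.supp] with r hr
  rw [Real.norm_eq_abs, abs_mul, hh.abs_eq_one, one_mul]
  exact hC r hr

/-- Double delay integrals are additive on bounded integrands. -/
theorem integral_delay_add (hh : IsDelayDensity τ ν h) {F G : ℝ → ℝ → ℝ}
    (hF : Measurable (Function.uncurry F)) (hG : Measurable (Function.uncurry G)) {t C D : ℝ}
    (ht : 0 ≤ t) (hC : ∀ s ∈ Ioc 0 t, ∀ r ∈ Icc 0 τ, |F s r| ≤ C)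
    (hD : ∀ s ∈ Ioc 0 t, ∀ r ∈ Icc 0 τ, |G s r| ≤ D) :
    ∫ s in (0 : ℝ)..t, ∫ r, h r * (F s r + G s r) ∂ν =
      (∫ s in (0 : ℝ)..t, ∫ r, h r * F s r ∂ν) + ∫ s in (0 : ℝ)..t, ∫ r, h r * G s r ∂ν := by
  rw [← intervalIntegral.integral_add (intervalIntegrable_delay hh hF ht hC)
    (intervalIntegrable_delay hh hG ht hD)]
  refine intervalIntegral.integral_congr_ae (Eventually.of_forall fun s hs => ?_)
  rw [uIoc_of_le ht] at hs
  simp only [mul_add]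
  exact integral_add
    (integrable_delay_section hh (hF.comp (measurable_const.prodMk measurable_id)) (hC s hs))
    (integrable_delay_section hh (hG.comp (measurable_const.prodMk measurable_id)) (hD s hs))

variable {Δ : ℝ} {y : ℝ → ℝ}

theorem gridFloor_sub_gridFloor (hΔ : 0 < Δ) (s r : ℝ) :
    gridFloor Δ (s - gridFloor Δ r) = gridFloor Δ s - gridFloor Δ r := by
  unfold gridFloor
  rw [sub_div, mul_div_assoc, div_self hΔ.ne', mul_one, Int.floor_sub_intCast]
  push_cast; ring

theorem exists_bound_Icc (hy : Continuous y) (a c : ℝ) : ∃ C, ∀ v ∈ Icc a c, |y v| ≤ C :=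
  (isCompact_Icc (a := a) (b := c)).exists_bound_of_continuousOn hy.continuousOn

theorem shift_mem_Icc {s r t : ℝ} (hs : s ∈ Icc 0 t) (hr : r ∈ Icc 0 τ) : s - r ∈ Icc (-τ) t :=
  ⟨by linarith [hs.1, hr.2], by linarith [hs.2, hr.1]⟩

theorem shift_gridFloor_mem_Icc (hΔ : 0 < Δ) {s r t : ℝ} (hs : s ∈ Icc 0 t) (hr : r ∈ Icc 0 τ) :
    s - gridFloor Δ r ∈ Icc (-τ) t :=
  shift_mem_Icc hs ⟨gridFloor_nonneg hΔ hr.1, (gridFloor_le hΔ r).trans hr.2⟩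

theorem gridFloor_shift_mem_Icc (hΔ : 0 < Δ) {s r t : ℝ} (hs : s ∈ Icc 0 t) (hr : r ∈ Icc 0 τ) :
    gridFloor Δ s - gridFloor Δ r ∈ Icc (-τ) t :=
  shift_gridFloor_mem_Icc hΔ ⟨gridFloor_nonneg hΔ hs.1, (gridFloor_le hΔ s).trans hs.2⟩ hr

theorem measurable_shift_sub (hy : Measurable y) :
    Measurable (Function.uncurry fun s r => y (s - r) - y (s - gridFloor Δ r)) :=
  (hy.comp (measurable_fst.sub measurable_snd)).sub
    (hy.comp (measurable_fst.sub (measurable_gridFloor.comp measurable_snd)))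

theorem measurable_grid_sub (hy : Measurable y) : Measurable
    (Function.uncurry fun s r => y (s - gridFloor Δ r) - y (gridFloor Δ s - gridFloor Δ r)) :=
  (hy.comp (measurable_fst.sub (measurable_gridFloor.comp measurable_snd))).sub
    (hy.comp ((measurable_gridFloor.comp measurable_fst).sub
      (measurable_gridFloor.comp measurable_snd)))

theorem abs_sub_le_two_mul {x y C : ℝ} (hx : |x| ≤ C) (hy : |y| ≤ C) : |x - y| ≤ 2 * C :=
  (abs_sub x y).trans (by linarith)

theorem locBdd_shiftForcing (hh : IsDelayDensity τ ν h) (hΔ : 0 < Δ) (hy : Continuous y) :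
    LocBdd (shiftForcing ν h Δ y) := by
  have hm : Measurable (Function.uncurry fun s r => h r * (y (s - r) - y (s - gridFloor Δ r))) :=
    (hh.measurable.comp measurable_snd).mul (measurable_shift_sub hy.measurable)
  refine ⟨(StronglyMeasurable.integral_prod_right
    (f := fun s r => h r * (y (s - r) - y (s - gridFloor Δ r)))
    hm.stronglyMeasurable).measurable, fun T => ?_⟩
  obtain ⟨C, hC⟩ := exists_bound_Icc hy (-τ) T
  refine ⟨2 * C * ν.real univ, fun s hs => norm_integral_le_of_norm_le_const
    (f := fun r => h r * (y (s - r) - y (s - gridFloor Δ r))) ?_⟩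
  filter_upwards [hh.supp] with r hr
  rw [Real.norm_eq_abs, abs_mul, hh.abs_eq_one, one_mul]
  exact abs_sub_le_two_mul (hC _ (shift_mem_Icc hs hr)) (hC _ (shift_gridFloor_mem_Icc hΔ hs hr))

theorem integral_shiftForcing (hh : IsDelayDensity τ ν h) (hΔ : 0 < Δ) (hy : Continuous y) {t : ℝ}
    (ht : 0 ≤ t) : ∫ s in (0 : ℝ)..t, shiftForcing ν h Δ y s =
      ∫ r, h r * (∫ s in (0 : ℝ)..t, (y (s - r) - y (s - gridFloor Δ r))) ∂ν := by
  obtain ⟨C, hC⟩ := exists_bound_Icc hy (-τ) t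
  exact integral_delay_swap hh (measurable_shift_sub hy.measurable) (C := 2 * C) ht
    fun s hs r hr => abs_sub_le_two_mul (hC _ (shift_mem_Icc ⟨hs.1.le, hs.2⟩ hr))
      (hC _ (shift_gridFloor_mem_Icc hΔ ⟨hs.1.le, hs.2⟩ hr))

/-- Inserting `y(s - T(r))` separates the discretization of the delay, which becomes the bias, from
that of time, which becomes the limit. -/
theorem eulerForcing_eq (hh : IsDelayDensity τ ν h) (hΔ : 0 < Δ) (hy : Continuous y) {t : ℝ}
    (ht : 0 ≤ t) : eulerForcing ν h Δ y t =
      (∫ s in (0 : ℝ)..t, shiftForcing ν h Δ y s) + gridForcing ν h Δ y t := by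
  obtain ⟨C, hC⟩ := exists_bound_Icc hy (-τ) t
  have b1 : ∀ s ∈ Ioc 0 t, ∀ r ∈ Icc 0 τ, |y (s - r) - y (s - gridFloor Δ r)| ≤ 2 * C :=
    fun s hs r hr => abs_sub_le_two_mul (hC _ (shift_mem_Icc ⟨hs.1.le, hs.2⟩ hr))
      (hC _ (shift_gridFloor_mem_Icc hΔ ⟨hs.1.le, hs.2⟩ hr))
  have b2 : ∀ s ∈ Ioc 0 t, ∀ r ∈ Icc 0 τ,
      |y (s - gridFloor Δ r) - y (gridFloor Δ s - gridFloor Δ r)| ≤ 2 * C :=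
    fun s hs r hr => abs_sub_le_two_mul (hC _ (shift_gridFloor_mem_Icc hΔ ⟨hs.1.le, hs.2⟩ hr))
      (hC _ (gridFloor_shift_mem_Icc hΔ ⟨hs.1.le, hs.2⟩ hr))
  have e := integral_delay_add hh (measurable_shift_sub (Δ := Δ) hy.measurable)
    (measurable_grid_sub (Δ := Δ) hy.measurable) ht b1 b2
  rw [integral_delay_swap hh (measurable_grid_sub (Δ := Δ) hy.measurable) ht b2] at e
  simp only [sub_add_sub_cancel] at e
  exact e

/-- After translation the two time integrals overlap except for two windows of length `r - T(r) ≤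
Δ`. Order `Δ` thus follows from boundedness alone, without regularity of `y`. -/
theorem integral_shift_sub (hy : Continuous y) (t r : ℝ) :
    ∫ s in (0 : ℝ)..t, (y (s - r) - y (s - gridFloor Δ r)) =
      (∫ v in (-r)..(-gridFloor Δ r), y v) - ∫ v in (t - r)..(t - gridFloor Δ r), y v := by
  have c1 : Continuous fun s => y (s - r) := by fun_prop
  have c2 : Continuous fun s => y (s - gridFloor Δ r) := by fun_prop
  rw [intervalIntegral.integral_sub (c1.intervalIntegrable _ _) (c2.intervalIntegrable _ _),
    intervalIntegral.integral_comp_sub_right, intervalIntegral.integral_comp_sub_right,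
    zero_sub, zero_sub]
  have i := fun u v => hy.intervalIntegrable (μ := volume) u v
  have e1 := intervalIntegral.integral_add_adjacent_intervals (i (-r) (-gridFloor Δ r))
    (i (-gridFloor Δ r) (t - gridFloor Δ r))
  have e2 := intervalIntegral.integral_add_adjacent_intervals (i (-r) (t - r))
    (i (t - r) (t - gridFloor Δ r))
  linarith

/-- Since `T(r)` is a multiple of `Δ`, translating by it preserves the grid, and the left-point
error is a difference of values of `gridError` plus its main term. -/
theorem integral_grid_sub (hΔ : 0 < Δ) (hy : Continuous y) (t r : ℝ) :
    ∫ s in (0 : ℝ)..t, (y (s - gridFloor Δ r) - y (gridFloor Δ s - gridFloor Δ r)) =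
      gridError Δ y (t - gridFloor Δ r) - gridError Δ y (-gridFloor Δ r) +
        Δ / 2 * (y (t - gridFloor Δ r) - y (-gridFloor Δ r)) := by
  simp only [← gridFloor_sub_gridFloor hΔ]
  rw [intervalIntegral.integral_comp_sub_right (fun v => y v - y (gridFloor Δ v)), zero_sub,
    gridError_eq_add hΔ hy (-gridFloor Δ r) (t - gridFloor Δ r)]
  ring

theorem gridForcing_sub_halfForcing (hh : IsDelayDensity τ ν h) (hΔ : 0 < Δ) (hy : Continuous y)
    {t : ℝ} (ht : 0 ≤ t) : gridForcing ν h Δ y t - Δ * halfForcing ν h y t =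
      ∫ r, h r * (gridError Δ y (t - gridFloor Δ r) - gridError Δ y (-gridFloor Δ r) +
        Δ / 2 * ((y (t - gridFloor Δ r) - y (t - r)) - (y (-gridFloor Δ r) - y (-r)))) ∂ν := by
  obtain ⟨C, hC⟩ := exists_bound_Icc hy (-τ) t
  have b2 : ∀ s ∈ Ioc 0 t, ∀ r ∈ Icc 0 τ,
      |y (s - gridFloor Δ r) - y (gridFloor Δ s - gridFloor Δ r)| ≤ 2 * C :=
    fun s hs r hr => abs_sub_le_two_mul (hC _ (shift_gridFloor_mem_Icc hΔ ⟨hs.1.le, hs.2⟩ hr))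
      (hC _ (gridFloor_shift_mem_Icc hΔ ⟨hs.1.le, hs.2⟩ hr))
  have m1 : Measurable fun r => ∫ s in (0 : ℝ)..t,
      (y (s - gridFloor Δ r) - y (gridFloor Δ s - gridFloor Δ r)) :=
    measurable_intervalIntegral_param (F := fun r s => y (s - gridFloor Δ r) -
      y (gridFloor Δ s - gridFloor Δ r))
      ((measurable_grid_sub hy.measurable).comp measurable_swap) measurable_const measurable_const
  have i1 := integrable_delay_section (C := 2 * C * |t - 0|) hh m1 (fun r hr =>
    intervalIntegral.norm_integral_le_of_norm_le_const
      (f := fun s => y (s - gridFloor Δ r) - y (gridFloor Δ s - gridFloor Δ r)) fun s hs =>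
      b2 s (by rwa [uIoc_of_le ht] at hs) r hr)
  have i2 : Integrable (fun r => h r * (y (t - r) - y (-r))) ν :=
    integrable_delay_section (C := 2 * C) hh
      ((hy.measurable.comp (measurable_const.sub measurable_id)).sub
        (hy.measurable.comp measurable_neg)) fun r hr =>
      abs_sub_le_two_mul (hC _ (shift_mem_Icc ⟨ht, le_rfl⟩ hr)) (hC _ (by
        have := shift_mem_Icc (s := 0) (t := t) ⟨le_rfl, ht⟩ hr
        rwa [zero_sub] at this))
  unfold gridForcing halfForcing
  rw [← mul_assoc, ← integral_const_mul, ← integral_sub i1 (i2.const_mul _)]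
  refine integral_congr_ae (Eventually.of_forall fun r => ?_)
  simp only [integral_grid_sub hΔ hy]
  ring

end Forcing

namespace IsDelayModel

variable (hM : IsDelayModel P τ ν h b x₀ K H c Z Y)
include hM

theorem step_pos {n : ℕ} (hn : 1 ≤ n) : 0 < τ / n :=
  div_pos hM.delay_pos (by exact_mod_cast hn)

theorem natCast_mul_step {n : ℕ} (hn : 1 ≤ n) : n * (τ / n) = τ := by
  have : (n : ℝ) ≠ 0 := by exact_mod_cast (by omega : n ≠ 0)
  field_simp

theorem step_le {n : ℕ} (hn : 1 ≤ n) : τ / n ≤ τ :=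
  div_le_self hM.delay_pos.le (by exact_mod_cast hn)

theorem continuous_b_path (ω : Ω) : Continuous fun t => b (Y t ω) :=
  hM.contDiff.continuous.comp (hM.continuous ω)

theorem measurable_b_uncurry : Measurable (Function.uncurry fun t ω => b (Y t ω)) :=
  hM.measurable_b.comp hM.measurable

theorem measurable_b_comp {S : Type*} [MeasurableSpace S] {u : S → ℝ} {w : S → Ω}
    (hu : Measurable u) (hw : Measurable w) : Measurable fun s => b (Y (u s) (w s)) :=
  hM.measurable_b.comp (hM.measurable.comp (hu.prodMk hw))

theorem exists_lpBdd_b_sub (hq1 : 1 ≤ q) (hqt : q ≠ ∞) (T : ℝ) :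
    ∃ C, 0 ≤ C ∧ ∀ s ∈ Icc (-τ) T, ∀ t ∈ Icc (-τ) T,
      LpBdd P q (fun ω => b (Y t ω) - b (Y s ω)) (C * |t - s| ^ H) := by
  obtain ⟨C, hC0, hC⟩ := hM.exists_lpBdd_sub hq1 hqt T
  refine ⟨K * C, mul_nonneg hM.bound_nonneg hC0, fun s hs t ht => ?_⟩
  rw [mul_assoc]
  exact (hC s hs t ht).sub_comp hM.measurable_b hM.bound_nonneg hM.abs_sub_le
    (hM.measurable_eval _) (hM.measurable_eval _)

theorem measurable_gridError {S : Type*} [MeasurableSpace S] {Δ : ℝ} {u : S → ℝ} {w : S → Ω}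
    (hu : Measurable u) (hw : Measurable w) :
    Measurable fun s => gridError Δ (fun t => b (Y t (w s))) (u s) := by
  unfold gridError
  refine (measurable_intervalIntegral_param (F := fun s x => b (Y x (w s)) -
    b (Y (gridFloor Δ x) (w s))) ?_ measurable_const hu).sub
    (((hM.measurable_b_comp hu hw).sub (hM.measurable_b_comp measurable_const hw)).const_mul _)
  exact (hM.measurable_b_comp measurable_snd (hw.comp measurable_fst)).sub
    (hM.measurable_b_comp (measurable_gridFloor.comp measurable_snd) (hw.comp measurable_fst))

/-- Full cells are averages over `δ` of sums of second differences. The last incomplete cell has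
length at most `Δ` and increments of order `Δ^H`. -/
theorem exists_lpBdd_gridError_nonneg (hq1 : 1 ≤ q) (hqt : q ≠ ∞) (T : ℝ) :
    ∃ C, 0 ≤ C ∧ ∀ Δ, 0 < Δ → ∀ v ∈ Icc 0 T,
      LpBdd P q (fun ω => gridError Δ (fun t => b (Y t ω)) v)
        (C * (Δ ^ (2 * H - 1) + Δ ^ H + Δ ^ (H - 1 / 2)) * Δ) := by
  obtain ⟨A, hA0, hA⟩ := hM.exists_lpBdd_sum_secondDiff hq1 hqt T
  obtain ⟨B, hB0, hB⟩ := hM.exists_lpBdd_b_sub hq1 hqt T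
  have hH := hM.half_lt
  have hτ := hM.delay_pos
  refine ⟨A + 2 * B, by positivity, fun Δ hΔ v hv => ?_⟩
  set m := ⌊v / Δ⌋₊ with hm
  have hmv : m * Δ ≤ v := by
    have := Nat.floor_le (div_nonneg hv.1 hΔ.le)
    rwa [le_div_iff₀ hΔ] at this
  have hvm : v < (m + 1) * Δ := by
    have := Nat.lt_floor_add_one (v / Δ)
    rwa [div_lt_iff₀ hΔ] at this
  have hm0 : 0 ≤ m * Δ := by positivity
  set ρ := Δ ^ (2 * H - 1) + Δ ^ H + Δ ^ (H - 1 / 2) with hρ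
  have hρ0 : 0 ≤ ρ := by positivity
  have hρ1 : Δ ^ H ≤ ρ := by
    have h1 : 0 ≤ Δ ^ (2 * H - 1) := by positivity
    have h2 : 0 ≤ Δ ^ (H - 1 / 2) := by positivity
    rw [hρ]; linarith
  have hsm : Measurable (Function.uncurry fun δ ω =>
      ∑ k ∈ Finset.range m, secondDiff Δ δ (fun t => b (Y t ω)) k) := by
    refine Finset.measurable_fun_sum _ fun k _ => ?_
    simp only [secondDiff]
    exact (((hM.measurable_b_comp (measurable_const.add measurable_fst) measurable_snd).add
      (hM.measurable_b_comp (measurable_const.sub measurable_fst) measurable_snd)).sub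
      (hM.measurable_b_comp measurable_const measurable_snd)).sub
      (hM.measurable_b_comp measurable_const measurable_snd)
  have p1 := ((LpBdd.intervalIntegral (P := P) (q := q) hq1 hqt hsm hΔ.le fun δ hδ =>
    hA Δ hΔ δ ⟨hδ.1.le, hδ.2⟩ m (hmv.trans hv.2)).const_mul (1 / 2))
  have p2 := LpBdd.intervalIntegral (P := P) (q := q) (C := B * Δ ^ H) hq1 hqt
    (F := fun s ω => b (Y s ω) - b (Y (gridFloor Δ s) ω))
    ((hM.measurable_b_comp measurable_fst measurable_snd).sub
      (hM.measurable_b_comp (measurable_gridFloor.comp measurable_fst) measurable_snd)) hmv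
    (fun s hs => by
      have hs0 : 0 ≤ s := hm0.trans hs.1.le
      refine (hB _ ⟨by linarith [gridFloor_nonneg hΔ hs0], by
        linarith [gridFloor_le hΔ s, hs.2, hv.2]⟩ s ⟨by linarith, hs.2.trans hv.2⟩).mono ?_
      gcongr
      exact abs_sub_gridFloor_le hΔ s)
  have p3 := (hB (m * Δ) ⟨by linarith, hmv.trans hv.2⟩ v ⟨by linarith, hv.2⟩).const_mul (Δ / 2)
  have h2 : |v - m * Δ| ≤ Δ := by rw [abs_of_nonneg (by linarith)]; linarith
  have := p1.add hq1 (by positivity) (add_nonneg (mul_nonneg (by linarith) (by positivity))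
    (by positivity)) (p2.sub hq1 (mul_nonneg (by linarith) (by positivity)) (by positivity) p3)
  refine (this.mono ?_).congr (Eventually.of_forall fun ω => ?_)
  · rw [abs_of_pos (half_pos hΔ), abs_of_pos (by norm_num : (0:ℝ) < 1 / 2), sub_zero]
    calc 1 / 2 * (Δ * (A * ρ)) + ((v - m * Δ) * (B * Δ ^ H) + Δ / 2 * (B * |v - m * Δ| ^ H))
        ≤ 1 * (Δ * (A * ρ)) + (Δ * (B * ρ) + Δ * (B * ρ)) := by
          gcongr
          · norm_num
          · linarith
          · linarith
          · exact le_trans (by gcongr) hρ1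
      _ = _ := by ring
  · simp only []
    rw [gridError_eq_add hΔ (hM.continuous_b_path ω) (m * Δ) v,
      gridError_natCast_mul hΔ (hM.continuous_b_path ω)]

theorem tendsto_step_rpow {e : ℝ} (he : 0 < e) :
    Tendsto (fun n : ℕ => (τ / (n : ℝ)) ^ e) atTop (𝓝 0) := by
  have h1 : Tendsto (fun n : ℕ => τ / (n : ℝ)) atTop (𝓝 0) :=
    tendsto_const_div_atTop_nhds_zero_nat τ
  have h2 := h1.rpow_const (p := e) (Or.inr he.le)
  rwa [Real.zero_rpow he.ne'] at h2

/-- The trapezoidal rule along `b(Y)` has an error of order `o(Δ)` in `L^q`, uniformly in time. -/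
theorem eventually_lpBdd_gridError (hq1 : 1 ≤ q) (hqt : q ≠ ∞) (T : ℝ) {ε : ℝ} (hε : 0 < ε) :
    ∀ᶠ n : ℕ in atTop, ∀ v ∈ Icc (-τ) T,
      LpBdd P q (fun ω => gridError (τ / n) (fun t => b (Y t ω)) v) (ε * (τ / n)) := by
  obtain ⟨A, hA0, hA⟩ := hM.exists_lpBdd_gridError_nonneg hq1 hqt T
  have hH := hM.half_lt
  -- On `[-τ, 0]` the path is deterministic and `C^1`; the classical estimate on `[0, τ]` is used
  -- after translation by `τ = n Δ`.
  have hf : ContDiffOn ℝ 1 (fun t => b (x₀ (t - τ))) (Icc 0 τ) := by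
    refine (hM.contDiff.of_le (by norm_num)).comp_contDiffOn (hM.contDiffOn.comp
      (contDiff_id.sub contDiff_const).contDiffOn fun t ht => ?_)
    exact ⟨by linarith [ht.1], by linarith [ht.2]⟩
  have hlim : Tendsto (fun n : ℕ => A * ((τ / (n : ℝ)) ^ (2 * H - 1) + (τ / (n : ℝ)) ^ H +
      (τ / (n : ℝ)) ^ (H - 1 / 2))) atTop (𝓝 0) := by
    have := (((hM.tendsto_step_rpow (e := 2 * H - 1) (by linarith)).add
      (hM.tendsto_step_rpow (e := H) (by linarith))).add
      (hM.tendsto_step_rpow (e := H - 1 / 2) (by linarith))).const_mul A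
    simpa using this
  filter_upwards [gridError_le_of_contDiffOn hM.delay_pos hf (half_pos hε),
    hlim.eventually (gt_mem_nhds hε), eventually_ge_atTop 1] with n hn1 hn2 hn v hv
  have hΔ := hM.step_pos hn
  by_cases h0 : 0 ≤ v
  · refine (hA _ hΔ v ⟨h0, hv.2⟩).mono ?_
    gcongr
  · refine LpBdd.of_bound (hM.measurable_gridError measurable_const
      measurable_id).aestronglyMeasurable (Eventually.of_forall fun ω => ?_)
    have hy := hM.continuous_b_path ω
    have hyc : Continuous fun t => b (Y (t - τ) ω) := hy.comp (continuous_id.sub continuous_const)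
    have e := gridError_sub_natCast_mul hΔ hy n v
    rw [hM.natCast_mul_step hn] at e
    have hτ := hM.delay_pos
    have hyf : ∀ t ∈ Icc 0 τ, b (Y (t - τ) ω) = b (x₀ (t - τ)) := fun t ht => by
      rw [hM.init ω (t - τ) ⟨by linarith [ht.1], by linarith [ht.2]⟩]
    have b1 := hn1 _ hyc hyf (v + τ) ⟨by linarith [hv.1], by linarith⟩
    have b2 := hn1 _ hyc hyf τ ⟨hτ.le, le_rfl⟩
    rw [e]
    refine (abs_sub _ _).trans ?_
    linarith

end IsDelayModel

end
-- `L^q` bounds for the forcing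
noncomputable section

variable {Ω : Type*} [MeasurableSpace Ω] {P : Measure Ω} [IsProbabilityMeasure P] {q : ℝ≥0∞}
  {τ : ℝ} {ν : Measure ℝ} [IsFiniteMeasure ν] {h b x₀ : ℝ → ℝ} {K H c : ℝ} {Z Y : ℝ → Ω → ℝ}

theorem LpBdd.integral_le_abs (hq1 : 1 ≤ q) (hqt : q ≠ ∞) {F : ℝ → Ω → ℝ}
    (hF : Measurable (Function.uncurry F)) {a c C D : ℝ} (hac : a ≤ c) (hD : c - a ≤ D)
    (hC0 : 0 ≤ C) (hC : ∀ s ∈ Ioc a c, LpBdd P q (F s) C) :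
    LpBdd P q (fun ω => ∫ s in a..c, F s ω) (D * C) :=
  (LpBdd.intervalIntegral hq1 hqt hF hac hC).mono (by gcongr)

namespace IsDelayModel

variable (hM : IsDelayModel P τ ν h b x₀ K H c Z Y)
include hM

theorem measurable_integral_h {S : Type*} [MeasurableSpace S] {F : S → ℝ → ℝ}
    (hF : Measurable (Function.uncurry F)) : Measurable fun s => ∫ r, h r * F s r ∂ν := by
  have hm : Measurable (Function.uncurry fun s r => h r * F s r) :=
    (hM.density.measurable.comp measurable_snd).mul hF
  exact (StronglyMeasurable.integral_prod_right (f := fun s r => h r * F s r)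
      hm.stronglyMeasurable).measurable

theorem measurable_shiftForcing (Δ : ℝ) :
    Measurable fun p : Ω × ℝ => shiftForcing ν h Δ (fun t => b (Y t p.1)) p.2 := by
  refine hM.measurable_integral_h (F := fun (p : Ω × ℝ) r =>
    b (Y (p.2 - r) p.1) - b (Y (p.2 - gridFloor Δ r) p.1)) ?_
  have m0 : Measurable fun z : (Ω × ℝ) × ℝ => z.1.1 := measurable_fst.comp measurable_fst
  have m1 : Measurable fun z : (Ω × ℝ) × ℝ => z.1.2 := measurable_snd.comp measurable_fst
  exact (hM.measurable_b_comp (m1.sub measurable_snd) m0).sub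
    (hM.measurable_b_comp (m1.sub (measurable_gridFloor.comp measurable_snd)) m0)

theorem measurable_eulerForcing (Δ : ℝ) :
    Measurable fun p : ℝ × Ω => eulerForcing ν h Δ (fun t => b (Y t p.2)) p.1 := by
  refine measurable_intervalIntegral_param (S := ℝ × Ω) (F := fun p s => ∫ r, h r *
    (b (Y (s - r) p.2) - b (Y (gridFloor Δ s - gridFloor Δ r) p.2)) ∂ν) ?_ measurable_const
    measurable_fst
  refine hM.measurable_integral_h (S := (ℝ × Ω) × ℝ) (F := fun p r =>
    b (Y (p.2 - r) p.1.2) - b (Y (gridFloor Δ p.2 - gridFloor Δ r) p.1.2)) ?_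
  have m0 : Measurable fun z : ((ℝ × Ω) × ℝ) × ℝ => z.1.1.2 :=
    measurable_snd.comp (measurable_fst.comp measurable_fst)
  have m1 : Measurable fun z : ((ℝ × Ω) × ℝ) × ℝ => z.1.2 := measurable_snd.comp measurable_fst
  exact (hM.measurable_b_comp (m1.sub measurable_snd) m0).sub
    (hM.measurable_b_comp ((measurable_gridFloor.comp m1).sub
      (measurable_gridFloor.comp measurable_snd)) m0)

theorem measurable_halfForcing :
    Measurable fun p : Ω × ℝ => halfForcing ν h (fun t => b (Y t p.1)) p.2 := by
  refine (hM.measurable_integral_h (F := fun (p : Ω × ℝ) r =>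
    b (Y (p.2 - r) p.1) - b (Y (-r) p.1)) ?_).const_mul _
  have m0 : Measurable fun z : (Ω × ℝ) × ℝ => z.1.1 := measurable_fst.comp measurable_fst
  have m1 : Measurable fun z : (Ω × ℝ) × ℝ => z.1.2 := measurable_snd.comp measurable_fst
  exact (hM.measurable_b_comp (m1.sub measurable_snd) m0).sub
    (hM.measurable_b_comp measurable_snd.neg m0)

theorem measurable_integral_b {u w : ℝ → ℝ} (hu : Measurable u) (hw : Measurable w) :
    Measurable (Function.uncurry fun r ω => ∫ v in (u r)..(w r), b (Y v ω)) :=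
  measurable_intervalIntegral_param (S := ℝ × Ω) (F := fun p v => b (Y v p.2))
    (hM.measurable_b_comp measurable_snd (measurable_snd.comp measurable_fst))
    (hu.comp measurable_fst) (hw.comp measurable_fst)

theorem exists_lpBdd_integral_shiftForcing (hq1 : 1 ≤ q) (hqt : q ≠ ∞) (T : ℝ) :
    ∃ C, 0 ≤ C ∧ ∀ Δ, 0 < Δ → ∀ t ∈ Icc 0 T,
      LpBdd P q (fun ω => ∫ s in (0 : ℝ)..t, shiftForcing ν h Δ (fun t => b (Y t ω)) s)
        (C * Δ) := by
  obtain ⟨B, hB0, hB⟩ := hM.exists_lpBdd_b hq1 hqt T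
  refine ⟨ν.real univ * (2 * B), by positivity, fun Δ hΔ t ht => ?_⟩
  have e : (fun ω => ∫ s in (0 : ℝ)..t, shiftForcing ν h Δ (fun t => b (Y t ω)) s) =
      fun ω => ∫ r, h r * ((∫ v in (-r)..(-gridFloor Δ r), b (Y v ω)) -
        ∫ v in (t - r)..(t - gridFloor Δ r), b (Y v ω)) ∂ν := by
    ext ω
    rw [integral_shiftForcing hM.density hΔ (hM.continuous_b_path ω) ht.1]
    simp only [integral_shift_sub (hM.continuous_b_path ω)]
  rw [e]
  have hg := measurable_gridFloor (Δ := Δ)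
  have m1 := hM.measurable_integral_b (u := fun r => -r) (w := fun r => -gridFloor Δ r)
    measurable_neg hg.neg
  have m2 := hM.measurable_integral_b (u := fun r => t - r) (w := fun r => t - gridFloor Δ r)
    (measurable_const.sub measurable_id) (measurable_const.sub hg)
  refine (hM.lpBdd_delayInt (F := fun r ω => (∫ v in (-r)..(-gridFloor Δ r), b (Y v ω)) -
    ∫ v in (t - r)..(t - gridFloor Δ r), b (Y v ω)) (C := Δ * B + Δ * B) hq1 hqt (m1.sub m2)
    fun r hr => ?_).mono (le_of_eq (by ring))
  have h1 := gridFloor_le hΔ r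
  have h2 := lt_gridFloor_add hΔ r
  have h3 := gridFloor_nonneg hΔ hr.1
  exact (LpBdd.integral_le_abs hq1 hqt hM.measurable_b_uncurry (by linarith) (by linarith) hB0
    fun s hs => hB s ⟨by linarith [hs.1, hr.2], by linarith [hs.2, ht.1, ht.2]⟩).sub hq1
    (by positivity) (by positivity) (LpBdd.integral_le_abs hq1 hqt hM.measurable_b_uncurry
      (by linarith) (by linarith) hB0
      fun s hs => hB s ⟨by linarith [hs.1, hr.2, ht.1], by linarith [hs.2, ht.2]⟩)

theorem exists_lpBdd_halfForcing (hq1 : 1 ≤ q) (hqt : q ≠ ∞) (T : ℝ) :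
    ∃ C, 0 ≤ C ∧ ∀ t ∈ Icc 0 T, LpBdd P q (fun ω => halfForcing ν h (fun t => b (Y t ω)) t) C := by
  obtain ⟨B, hB0, hB⟩ := hM.exists_lpBdd_b hq1 hqt T
  refine ⟨1 / 2 * (ν.real univ * (B + B)), by positivity, fun t ht => ?_⟩
  have := (hM.lpBdd_delayInt (F := fun r ω => b (Y (t - r) ω) - b (Y (-r) ω)) (C := B + B) hq1 hqt
    ((hM.measurable_b_comp (measurable_const.sub measurable_fst) measurable_snd).sub
      (hM.measurable_b_comp measurable_fst.neg measurable_snd)) fun r hr =>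
    (hB _ (shift_mem_Icc ht hr)).sub hq1 hB0 hB0 (hB _ (by
      have := shift_mem_Icc (s := 0) (t := T) ⟨le_rfl, ht.1.trans ht.2⟩ hr
      rwa [zero_sub] at this))).const_mul (1 / 2)
  rwa [abs_of_pos (by norm_num : (0:ℝ) < 1 / 2)] at this

/-- The forcing due to time discretization is `Δ` times its limit, up to `o(Δ)` in `L^q`. -/
theorem eventually_lpBdd_gridForcing_sub (hq1 : 1 ≤ q) (hqt : q ≠ ∞) (T : ℝ) {ε : ℝ} (hε : 0 < ε) :
    ∀ᶠ n : ℕ in atTop, ∀ t ∈ Icc 0 T,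
      LpBdd P q (fun ω => gridForcing ν h (τ / n) (fun t => b (Y t ω)) t -
        τ / n * halfForcing ν h (fun t => b (Y t ω)) t) (ε * (τ / n)) := by
  obtain ⟨B, hB0, hB⟩ := hM.exists_lpBdd_b_sub hq1 hqt T
  have hH := hM.half_lt
  set M := ν.real univ with hMdef
  have hM0 : 0 ≤ M := measureReal_nonneg
  -- Two values of `gridError` and half the sum of two increments contribute `3 ε' Δ`, integrated
  -- against mass `M`; `M + 1` avoids dividing by zero.
  set ε' := ε / (3 * (M + 1)) with hε'
  have hε'0 : 0 < ε' := by positivity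
  have hlim : Tendsto (fun n : ℕ => B * (τ / (n : ℝ)) ^ H) atTop (𝓝 0) := by
    simpa using (hM.tendsto_step_rpow (e := H) (by linarith)).const_mul B
  filter_upwards [hM.eventually_lpBdd_gridError hq1 hqt T hε'0,
    hlim.eventually (gt_mem_nhds hε'0), eventually_ge_atTop 1] with n hn1 hn2 hn t ht
  have hΔ := hM.step_pos hn
  set Δ := τ / (n : ℝ) with hΔdef
  simp only [gridForcing_sub_halfForcing hM.density hΔ (hM.continuous_b_path _) ht.1]
  have hg := measurable_gridFloor (Δ := Δ)
  have hgf : Measurable fun p : ℝ × Ω => gridFloor Δ p.1 := hg.comp measurable_fst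
  have hmF : Measurable (Function.uncurry fun r ω =>
      gridError Δ (fun t => b (Y t ω)) (t - gridFloor Δ r) -
      gridError Δ (fun t => b (Y t ω)) (-gridFloor Δ r) +
      Δ / 2 * ((b (Y (t - gridFloor Δ r) ω) - b (Y (t - r) ω)) -
      (b (Y (-gridFloor Δ r) ω) - b (Y (-r) ω)))) :=
    ((hM.measurable_gridError (measurable_const.sub hgf) measurable_snd).sub
      (hM.measurable_gridError hgf.neg measurable_snd)).add
      ((((hM.measurable_b_comp (measurable_const.sub hgf) measurable_snd).sub
        (hM.measurable_b_comp (measurable_const.sub measurable_fst) measurable_snd)).sub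
        ((hM.measurable_b_comp hgf.neg measurable_snd).sub
        (hM.measurable_b_comp measurable_fst.neg measurable_snd))).const_mul _)
  refine (hM.lpBdd_delayInt (C := (ε' * Δ + ε' * Δ) + Δ / 2 * (ε' + ε')) hq1 hqt hmF
    fun r hr => ?_).mono ?_
  · have hT0 : (0 : ℝ) ∈ Icc 0 T := ⟨le_rfl, ht.1.trans ht.2⟩
    have n1 := shift_gridFloor_mem_Icc hΔ hT0 hr
    have n2 := shift_mem_Icc hT0 hr
    rw [zero_sub] at n1 n2
    have hle : B * |gridFloor Δ r - r| ^ H ≤ ε' := by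
      refine le_trans ?_ hn2.le
      gcongr
      rw [abs_sub_comm]
      exact abs_sub_gridFloor_le hΔ r
    have y1 := (hB _ (shift_mem_Icc ht hr) _ (shift_gridFloor_mem_Icc hΔ ht hr)).mono (D := ε')
      (by rw [sub_sub_sub_cancel_left, abs_sub_comm]; exact hle)
    have y2 := (hB _ n2 _ n1).mono (D := ε')
      (by rw [neg_sub_neg, abs_sub_comm]; exact hle)
    have y3 := (y1.sub hq1 hε'0.le hε'0.le y2).const_mul (Δ / 2)
    rw [abs_of_pos (half_pos hΔ)] at y3
    exact ((hn1 _ (shift_gridFloor_mem_Icc hΔ ht hr)).sub hq1 (by positivity) (by positivity)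
      (hn1 _ n1)).add hq1 (by positivity) (by positivity) y3
  · calc M * ((ε' * Δ + ε' * Δ) + Δ / 2 * (ε' + ε')) = M * (3 * ε' * Δ) := by ring
      _ ≤ (M + 1) * (3 * ε' * Δ) := by gcongr; linarith
      _ = ε * Δ := by rw [hε']; field_simp

/-- For large `n` the asymptotics with `ε = 1` suffice. For the finitely many remaining `n` the step
is bounded below, so a bound independent of `Δ` is enough. -/
theorem exists_lpBdd_gridForcing (hq1 : 1 ≤ q) (hqt : q ≠ ∞) (T : ℝ) :
    ∃ C, 0 ≤ C ∧ ∀ n : ℕ, 1 ≤ n → ∀ t ∈ Icc 0 T,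
      LpBdd P q (fun ω => gridForcing ν h (τ / n) (fun t => b (Y t ω)) t) (C * (τ / n)) := by
  obtain ⟨B, hB0, hB⟩ := hM.exists_lpBdd_b hq1 hqt T
  obtain ⟨A, hA0, hA⟩ := hM.exists_lpBdd_halfForcing hq1 hqt T
  obtain ⟨N, hN⟩ := eventually_atTop.1 (hM.eventually_lpBdd_gridForcing_sub hq1 hqt T one_pos)
  have hτ := hM.delay_pos
  set D := ν.real univ * (|T| * (B + B)) * (N / τ) with hD
  have hD0 : 0 ≤ D := by positivity
  refine ⟨1 + A + D, by positivity, fun n hn t ht => ?_⟩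
  have hΔ := hM.step_pos hn
  set Δ := τ / (n : ℝ) with hΔdef
  by_cases hnN : N ≤ n
  · have h1 := (hA t ht).const_mul Δ
    rw [abs_of_pos hΔ] at h1
    have := (hN n hnN t ht).add hq1 (by positivity) (by positivity) h1
    simp only [← hΔdef, sub_add_cancel] at this
    exact this.mono (by nlinarith [mul_nonneg hD0 hΔ.le])
  · have hg := measurable_gridFloor (Δ := Δ)
    have m0 : Measurable fun z : (ℝ × Ω) × ℝ => z.1.2 := measurable_snd.comp measurable_fst
    have m1 : Measurable fun z : (ℝ × Ω) × ℝ => gridFloor Δ z.1.1 :=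
      hg.comp (measurable_fst.comp measurable_fst)
    have hm : Measurable (Function.uncurry fun r ω => ∫ s in (0 : ℝ)..t,
        (b (Y (s - gridFloor Δ r) ω) - b (Y (gridFloor Δ s - gridFloor Δ r) ω))) :=
      measurable_intervalIntegral_param (S := ℝ × Ω) (F := fun p s =>
        b (Y (s - gridFloor Δ p.1) p.2) - b (Y (gridFloor Δ s - gridFloor Δ p.1) p.2))
        ((hM.measurable_b_comp (measurable_snd.sub m1) m0).sub
        (hM.measurable_b_comp ((hg.comp measurable_snd).sub m1) m0)) measurable_const
        measurable_const
    refine (hM.lpBdd_delayInt (C := |T| * (B + B)) hq1 hqt hm fun r hr => ?_).mono ?_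
    · refine LpBdd.integral_le_abs hq1 hqt (F := fun s ω =>
        b (Y (s - gridFloor Δ r) ω) - b (Y (gridFloor Δ s - gridFloor Δ r) ω))
        ((hM.measurable_b_comp (measurable_fst.sub measurable_const) measurable_snd).sub
        (hM.measurable_b_comp ((hg.comp measurable_fst).sub measurable_const) measurable_snd))
        ht.1 (by linarith [ht.2, le_abs_self T]) (by positivity) fun s hs => ?_
      have hs' : s ∈ Icc 0 T := ⟨hs.1.le, hs.2.trans ht.2⟩
      exact (hB _ (shift_gridFloor_mem_Icc hΔ hs' hr)).sub hq1 hB0 hB0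
        (hB _ (gridFloor_shift_mem_Icc hΔ hs' hr))
    -- For `n < N` the step exceeds `τ / N`, which explains the factor `N / τ` in `D`.
    · have h1 : 1 ≤ N / τ * Δ := by
        rw [hΔdef, div_mul_div_comm, mul_comm, mul_div_mul_left _ _ hτ.ne', one_le_div
          (by exact_mod_cast hn)]
        exact_mod_cast (not_le.1 hnN).le
      have h2 : 0 ≤ (1 + A) * Δ := by positivity
      calc ν.real univ * (|T| * (B + B)) = ν.real univ * (|T| * (B + B)) * 1 := (mul_one _).symm
        _ ≤ ν.real univ * (|T| * (B + B)) * (N / τ * Δ) := by gcongr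
        _ = D * Δ := by rw [hD]; ring
        _ ≤ (1 + A + D) * Δ := by linarith

theorem exists_lpBdd_eulerForcing (hq1 : 1 ≤ q) (hqt : q ≠ ∞) (T : ℝ) :
    ∃ C, 0 ≤ C ∧ ∀ n : ℕ, 1 ≤ n → ∀ t ∈ Icc 0 T,
      LpBdd P q (fun ω => eulerForcing ν h (τ / n) (fun t => b (Y t ω)) t) (C * (τ / n)) := by
  obtain ⟨A, hA0, hA⟩ := hM.exists_lpBdd_integral_shiftForcing hq1 hqt T
  obtain ⟨B, hB0, hB⟩ := hM.exists_lpBdd_gridForcing hq1 hqt T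
  refine ⟨A + B, by positivity, fun n hn t ht => ?_⟩
  have hΔ := hM.step_pos hn
  simp only [eulerForcing_eq hM.density hΔ (hM.continuous_b_path _) ht.1]
  rw [add_mul]
  exact (hA _ hΔ t ht).add hq1 (by positivity) (by positivity) (hB n hn t ht)

end IsDelayModel

end
-- The error of the Euler scheme
noncomputable section

variable {Ω : Type*} [MeasurableSpace Ω] {P : Measure Ω} [IsProbabilityMeasure P] {q : ℝ≥0∞}
  {τ : ℝ} {ν : Measure ℝ} [IsFiniteMeasure ν] {h b x₀ : ℝ → ℝ} {K H c : ℝ} {Z Y : ℝ → Ω → ℝ}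

/-- A jointly measurable process solving the equation of the Euler scheme of step `Δ` on
`[-τ, T]`. -/
structure IsEulerVersion (P : Measure Ω) (τ : ℝ) (ν : Measure ℝ) (h b : ℝ → ℝ) (Y : ℝ → Ω → ℝ)
    (Δ T : ℝ) (V : ℝ → Ω → ℝ) : Prop where
  measurable : Measurable (Function.uncurry V)
  bdd : ∀ ω T', ∃ C, ∀ t ∈ Icc (-τ) T', |V t ω| ≤ C
  init : ∀ᵐ ω ∂P, ∀ t ∈ Icc (-τ) 0, V t ω = Y t ω
  eqn : ∀ᵐ ω ∂P, ∀ t ∈ Icc 0 T, V t ω = Y 0 ω +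
    (∫ s in (0 : ℝ)..t, ∫ r, h r * b (V (gridFloor Δ s - gridFloor Δ r) ω) ∂ν) +
      delayNoise ν h b Y t ω

/-- The drift of the error of the Euler scheme. -/
def errorDrift (ν : Measure ℝ) (h b : ℝ → ℝ) (Y V : ℝ → Ω → ℝ) (Δ s : ℝ) (ω : Ω) : ℝ :=
  ∫ r, h r * (b (Y (s - r) ω) - b (V (gridFloor Δ s - gridFloor Δ r) ω)) ∂ν

namespace IsEulerVersion

variable {V : ℝ → Ω → ℝ} {Δ T : ℝ} (hM : IsDelayModel P τ ν h b x₀ K H c Z Y)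
  (hV : IsEulerVersion P τ ν h b Y Δ T V)
include hM hV

theorem measurable_eval (t : ℝ) : Measurable (V t) :=
  hV.measurable.comp (measurable_const.prodMk measurable_id)

theorem measurable_comp {S : Type*} [MeasurableSpace S] {u : S → ℝ} {w : S → Ω}
    (hu : Measurable u) (hw : Measurable w) : Measurable fun s => V (u s) (w s) :=
  hV.measurable.comp (hu.prodMk hw)

theorem measurable_b_comp {S : Type*} [MeasurableSpace S] {u : S → ℝ} {w : S → Ω}
    (hu : Measurable u) (hw : Measurable w) : Measurable fun s => b (V (u s) (w s)) :=
  hM.measurable_b.comp (hV.measurable_comp hM hu hw)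

theorem bdd_b (ω : Ω) (T' : ℝ) : ∃ C, ∀ t ∈ Icc (-τ) T', |b (V t ω)| ≤ C := by
  obtain ⟨C, hC⟩ := hV.bdd ω T'
  have := hM.bound_nonneg
  refine ⟨|b 0| + K * C, fun t ht => (hM.abs_b_le _).trans ?_⟩
  gcongr
  exact hC t ht

/-- The exact drift minus the Euler drift is bounded and measurable along every path. -/
theorem drift_aux (hΔ : 0 < Δ) (ω : Ω) (t : ℝ) :
    Measurable (Function.uncurry fun s r => b (Y (s - r) ω)) ∧
    Measurable (Function.uncurry fun s r => b (Y (gridFloor Δ s - gridFloor Δ r) ω)) ∧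
    Measurable (Function.uncurry fun s r => b (V (gridFloor Δ s - gridFloor Δ r) ω)) ∧
    ∃ C, ∀ s ∈ Ioc 0 t, ∀ r ∈ Icc 0 τ, |b (Y (s - r) ω)| ≤ C ∧
      |b (Y (gridFloor Δ s - gridFloor Δ r) ω)| ≤ C ∧
      |b (V (gridFloor Δ s - gridFloor Δ r) ω)| ≤ C := by
  have hg := measurable_gridFloor (Δ := Δ)
  have hgg : Measurable fun p : ℝ × ℝ => gridFloor Δ p.1 - gridFloor Δ p.2 :=
    (hg.comp measurable_fst).sub (hg.comp measurable_snd)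
  refine ⟨hM.measurable_b_comp (measurable_fst.sub measurable_snd) measurable_const,
    hM.measurable_b_comp hgg measurable_const, hV.measurable_b_comp hM hgg measurable_const, ?_⟩
  obtain ⟨C, -, hC⟩ := hM.path_bdd_b ω t
  obtain ⟨D, hD⟩ := hV.bdd_b hM ω t
  refine ⟨max C D, fun s hs r hr => ⟨(hC _ (shift_mem_Icc ⟨hs.1.le, hs.2⟩ hr)).trans
    (le_max_left _ _), (hC _ (gridFloor_shift_mem_Icc hΔ ⟨hs.1.le, hs.2⟩ hr)).trans
    (le_max_left _ _), (hD _ (gridFloor_shift_mem_Icc hΔ ⟨hs.1.le, hs.2⟩ hr)).trans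
    (le_max_right _ _)⟩⟩

theorem sub_eq_integral (hΔ : 0 < Δ) : ∀ᵐ ω ∂P, ∀ t ∈ Icc 0 T,
    Y t ω - V t ω = ∫ s in (0 : ℝ)..t, errorDrift ν h b Y V Δ s ω := by
  filter_upwards [hV.eqn] with ω hω t ht
  obtain ⟨m1, m2, m3, C, hC⟩ := hV.drift_aux hM hΔ ω t
  have e := integral_delay_add hM.density (G := fun s r => b (Y (s - r) ω) -
    b (V (gridFloor Δ s - gridFloor Δ r) ω)) m3 (m1.sub m3) (C := C) (D := 2 * C) ht.1
    (fun s hs r hr => (hC s hs r hr).2.2)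
    (fun s hs r hr => abs_sub_le_two_mul (hC s hs r hr).1 (hC s hs r hr).2.2)
  simp only [add_sub_cancel] at e
  rw [hω t ht, hM.eval_eq t ω]
  simp only [errorDrift, delayDrift, delayInt]
  rw [e]
  ring

/-- The error equation: inserting `b(Y)` at the discretized times leaves the forcing, which involves
the exact solution only, and a term Lipschitz in the error at grid times. -/
theorem sub_eq_add (hΔ : 0 < Δ) : ∀ᵐ ω ∂P, ∀ t ∈ Icc 0 T,
    Y t ω - V t ω = eulerForcing ν h Δ (fun t => b (Y t ω)) t +
      ∫ s in (0 : ℝ)..t, ∫ r, h r * (b (Y (gridFloor Δ s - gridFloor Δ r) ω) -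
        b (V (gridFloor Δ s - gridFloor Δ r) ω)) ∂ν := by
  filter_upwards [hV.sub_eq_integral hM hΔ] with ω hω t ht
  obtain ⟨m1, m2, m3, C, hC⟩ := hV.drift_aux hM hΔ ω t
  have e := integral_delay_add hM.density
    (F := fun s r => b (Y (s - r) ω) - b (Y (gridFloor Δ s - gridFloor Δ r) ω))
    (G := fun s r => b (Y (gridFloor Δ s - gridFloor Δ r) ω) -
      b (V (gridFloor Δ s - gridFloor Δ r) ω)) (m1.sub m2) (m2.sub m3) (C := 2 * C) (D := 2 * C) ht.1
    (fun s hs r hr => abs_sub_le_two_mul (hC s hs r hr).1 (hC s hs r hr).2.1)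
    (fun s hs r hr => abs_sub_le_two_mul (hC s hs r hr).2.1 (hC s hs r hr).2.2)
  simp only [sub_add_sub_cancel] at e
  rw [hω t ht]
  exact e

theorem measurable_sub : Measurable (Function.uncurry fun t ω => Y t ω - V t ω) :=
  hM.measurable.sub hV.measurable

theorem measurable_errorDrift : Measurable (Function.uncurry (errorDrift ν h b Y V Δ)) := by
  refine hM.measurable_integral_h (S := ℝ × Ω) (F := fun p r =>
    b (Y (p.1 - r) p.2) - b (V (gridFloor Δ p.1 - gridFloor Δ r) p.2)) ?_
  have hg := measurable_gridFloor (Δ := Δ)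
  have m0 : Measurable fun z : (ℝ × Ω) × ℝ => z.1.1 := measurable_fst.comp measurable_fst
  have m1 : Measurable fun z : (ℝ × Ω) × ℝ => z.1.2 := measurable_snd.comp measurable_fst
  exact (hM.measurable_b_comp (m0.sub measurable_snd) m1).sub
    (hV.measurable_b_comp hM ((hg.comp m0).sub (hg.comp measurable_snd)) m1)

theorem sub_bdd (ω : Ω) (T' : ℝ) : ∃ C, ∀ t ∈ Icc (-τ) T', |Y t ω - V t ω| ≤ C := by
  obtain ⟨C, -, hC⟩ := hM.path_bdd ω T'
  obtain ⟨D, hD⟩ := hV.bdd ω T'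
  exact ⟨C + D, fun t ht => (abs_sub _ _).trans (add_le_add (hC t ht) (hD t ht))⟩

theorem locBdd_sub (ω : Ω) : LocBdd fun t => Y t ω - V t ω := by
  refine ⟨(hM.measurable_path ω).sub (hV.measurable_comp hM measurable_id measurable_const),
    fun T' => ?_⟩
  obtain ⟨C, hC⟩ := hV.sub_bdd hM ω T'
  exact ⟨C, fun t ht => hC t ⟨by linarith [hM.delay_pos, ht.1], ht.2⟩⟩

theorem sub_ae_eq_zero {t : ℝ} (ht : t ∈ Icc (-τ) 0) : ∀ᵐ ω ∂P, Y t ω - V t ω = 0 := by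
  filter_upwards [hV.init] with ω hω
  rw [hω t ht, sub_self]

end IsEulerVersion

namespace IsDelayModel

variable (hM : IsDelayModel P τ ν h b x₀ K H c Z Y)
include hM

/-- The error of the Euler scheme is of order `Δ` in `L^q`. -/
theorem exists_lpBdd_euler (hq1 : 1 ≤ q) (hqt : q ≠ ∞) (T : ℝ) :
    ∃ C, 0 ≤ C ∧ ∀ n : ℕ, 1 ≤ n → ∀ V, IsEulerVersion P τ ν h b Y (τ / n) T V →
      ∀ t ∈ Icc (-τ) T, LpBdd P q (fun ω => Y t ω - V t ω) (C * (τ / n)) := by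
  obtain ⟨A, hA0, hA⟩ := hM.exists_lpBdd_eulerForcing hq1 hqt T
  have hK := hM.bound_nonneg
  refine ⟨A * 2 * Real.exp (volterraRate ν K * T), by positivity, fun n hn V hV t ht => ?_⟩
  have hΔ := hM.step_pos hn
  set Δ := τ / (n : ℝ) with hΔdef
  by_cases h0 : 0 ≤ t
  swap
  · refine (LpBdd.zero.mono (by positivity)).congr ?_
    filter_upwards [hV.sub_ae_eq_zero hM (t := t) ⟨ht.1, (not_le.1 h0).le⟩] with ω hω
    rw [hω]
  have ham : Measurable (Function.uncurry fun s r => gridFloor Δ s - gridFloor Δ r) :=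
    (measurable_gridFloor.comp measurable_fst).sub (measurable_gridFloor.comp measurable_snd)
  refine (LpBdd.gronwall (τ := τ) (ε := A * Δ) (w := fun t ω => Y t ω - V t ω)
    (g := fun t ω => eulerForcing ν h Δ (fun t => b (Y t ω)) t) ham
    hM.density.supp (fun s r hr => ?_) hq1 hqt hK (by positivity) (hV.measurable_sub hM)
    (hM.measurable_eulerForcing Δ) (Eventually.of_forall fun ω => ?_) ?_ (hA n hn)
    ⟨h0, ht.2⟩).mono (le_of_eq (by ring))
  · have := gridFloor_le hΔ s
    have := gridFloor_nonneg hΔ hr.1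
    linarith
  · exact (hV.locBdd_sub hM ω).2 T
  · filter_upwards [hV.sub_eq_add hM hΔ, hV.init] with ω hω hi u hu
    rw [hω u hu]
    refine (enorm_add_le _ _).trans ?_
    gcongr
    refine enorm_integral_le_eDelay hu.1 fun s hs => ?_
    filter_upwards [hM.density.supp] with r hr
    rw [enorm_mul, show ‖h r‖ₑ = 1 by
      rw [← ofReal_norm, Real.norm_eq_abs, hM.density.abs_eq_one, ENNReal.ofReal_one], one_mul]
    have hp := gridFloor_shift_mem_Icc hΔ (⟨hs.1.le, hs.2⟩ : s ∈ Icc 0 u) hr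
    set p := gridFloor Δ s - gridFloor Δ r
    -- At negative grid times the scheme coincides with the solution, in agreement with the
    -- indicator in `eDelay`.
    by_cases hp0 : 0 ≤ p
    · rw [indicator_of_mem (show p ∈ Ici (0:ℝ) from hp0), ← ofReal_norm, ← ofReal_norm,
        ← ENNReal.ofReal_mul hK]
      exact ENNReal.ofReal_le_ofReal (hM.abs_sub_le _ _)
    · rw [hi p ⟨hp.1, (not_le.1 hp0).le⟩, sub_self, enorm_zero]
      exact bot_le

/-- The error of the Euler scheme is `L^q`-Lipschitz with constant of order `Δ ^ H`. -/
theorem exists_lpBdd_euler_sub (hq1 : 1 ≤ q) (hqt : q ≠ ∞) (T : ℝ) :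
    ∃ C, 0 ≤ C ∧ ∀ n : ℕ, 1 ≤ n → ∀ V, IsEulerVersion P τ ν h b Y (τ / n) T V →
      ∀ s ∈ Icc (-τ) T, ∀ t ∈ Icc (-τ) T,
      LpBdd P q (fun ω => (Y t ω - V t ω) - (Y s ω - V s ω)) (C * (|t - s| * (τ / n) ^ H)) := by
  obtain ⟨A, hA0, hA⟩ := hM.exists_lpBdd_euler hq1 hqt T
  obtain ⟨B, hB0, hB⟩ := hM.exists_lpBdd_b_sub hq1 hqt T
  have hK := hM.bound_nonneg
  have hτ := hM.delay_pos
  have hH := hM.half_lt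
  have hH1 := hM.lt_one
  set C := ν.real univ * (B + K * (A * τ ^ (1 - H))) with hC
  have hC0 : 0 ≤ C := by positivity
  refine ⟨C, hC0, fun n hn V hV => ?_⟩
  have hΔ := hM.step_pos hn
  have hΔτ := hM.step_le hn
  set Δ := τ / (n : ℝ) with hΔdef
  have hΔH : Δ ≤ τ ^ (1 - H) * Δ ^ H := by
    calc Δ = Δ ^ (1 - H) * Δ ^ H := by
          rw [← Real.rpow_add hΔ, sub_add_cancel, Real.rpow_one]
      _ ≤ τ ^ (1 - H) * Δ ^ H := by gcongr
  -- The drift of the error is an increment of `b(Y)` over a lag of at most `Δ`, of order `Δ^H`,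
  -- plus a Lipschitz term of order `Δ`, which is absorbed in `Δ^H`.
  have pos : ∀ s t, 0 ≤ s → s ≤ t → t ≤ T →
      LpBdd P q (fun ω => (Y t ω - V t ω) - (Y s ω - V s ω)) (C * (|t - s| * Δ ^ H)) := by
    intro s t hs hst ht
    have h1 := LpBdd.intervalIntegral (P := P) (q := q) (C := C * Δ ^ H) hq1 hqt
      (hV.measurable_errorDrift hM) hst (fun u hu => by
        have hu' : u ∈ Icc 0 T := ⟨hs.trans hu.1.le, hu.2.trans ht⟩
        have hg := measurable_gridFloor (Δ := Δ)
        refine (hM.lpBdd_delayInt (F := fun r ω =>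
          b (Y (u - r) ω) - b (V (gridFloor Δ u - gridFloor Δ r) ω))
          (C := B * Δ ^ H + K * (A * Δ)) hq1 hqt
          ((hM.measurable_b_comp (measurable_const.sub measurable_fst) measurable_snd).sub
            (hV.measurable_b_comp hM (measurable_const.sub (hg.comp measurable_fst))
              measurable_snd)) fun r hr => ?_).mono ?_
        · have hp := gridFloor_shift_mem_Icc hΔ hu' hr
          have y1 := hB _ hp _ (shift_mem_Icc hu' hr)
          have y2 := (hA n hn V hV _ hp).sub_comp hM.measurable_b hK hM.abs_sub_le
            (hM.measurable_eval _) (hV.measurable_eval hM _)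
          have y3 := (y1.mono (D := B * Δ ^ H) (by
            gcongr
            have a1 := gridFloor_le hΔ u
            have a2 := lt_gridFloor_add hΔ u
            have a3 := gridFloor_le hΔ r
            have a4 := lt_gridFloor_add hΔ r
            rw [abs_le]; constructor <;> linarith)).add hq1 (by positivity) (by positivity) y2
          simpa only [sub_add_sub_cancel] using y3
        · rw [hC, mul_assoc]
          gcongr
          have : K * (A * Δ) ≤ K * (A * (τ ^ (1 - H) * Δ ^ H)) := by gcongr
          linarith)
    refine (h1.mono (le_of_eq ?_)).congr ?_
    · rw [abs_of_nonneg (sub_nonneg.2 hst)]; ring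
    · filter_upwards [hV.sub_eq_integral hM hΔ] with ω hω
      rw [hω t ⟨hs.trans hst, ht⟩, hω s ⟨hs, hst.trans ht⟩]
      have hi : ∀ v, 0 ≤ v →
          IntervalIntegrable (fun u => errorDrift ν h b Y V Δ u ω) volume 0 v := fun v hv => by
        obtain ⟨m1, -, m3, D, hD⟩ := hV.drift_aux hM hΔ ω v
        exact intervalIntegrable_delay hM.density (F := fun s r => b (Y (s - r) ω) -
          b (V (gridFloor Δ s - gridFloor Δ r) ω)) (m1.sub m3) (C := 2 * D) hv
          (fun s hs r hr => abs_sub_le_two_mul (hD s hs r hr).1 (hD s hs r hr).2.2)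
      exact (intervalIntegral.integral_interval_sub_left (hi t (hs.trans hst)) (hi s hs)).symm
  have main : ∀ s t, -τ ≤ s → s ≤ t → t ≤ T →
      LpBdd P q (fun ω => (Y t ω - V t ω) - (Y s ω - V s ω)) (C * (|t - s| * Δ ^ H)) := by
    intro s t hs hst ht
    by_cases h0 : 0 ≤ s
    · exact pos s t h0 hst ht
    by_cases h1 : 0 ≤ t
    · push Not at h0
      refine ((pos 0 t le_rfl h1 ht).mono ?_).congr ?_
      · rw [abs_of_nonneg (by linarith), abs_of_nonneg (by linarith)]
        gcongr
      · filter_upwards [hV.sub_ae_eq_zero hM (t := s) ⟨hs, h0.le⟩,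
          hV.sub_ae_eq_zero hM (t := 0) ⟨by linarith, le_rfl⟩] with ω h1 h2
        rw [h1, h2]
    · refine (LpBdd.zero.mono (by positivity)).congr ?_
      filter_upwards [hV.sub_ae_eq_zero hM (t := s) ⟨hs, (not_le.1 h0).le⟩,
        hV.sub_ae_eq_zero hM (t := t) ⟨hs.trans hst, (not_le.1 h1).le⟩] with ω h1 h2
      rw [h1, h2, sub_zero]
  intro s hs t ht
  rcases le_total s t with hst | hst
  · exact main s t hs.1 hst ht.2
  · have := (main t s ht.1 hst hs.2).neg
    simp only [neg_sub] at this
    rwa [abs_sub_comm] at this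

/-- The remainder after linearizing the error of the Euler scheme. -/
theorem exists_lpBdd_linearization (hq1 : 1 ≤ q) (hqt : q ≠ ∞) (T : ℝ) :
    ∃ C, 0 ≤ C ∧ ∀ n : ℕ, 1 ≤ n → ∀ V, IsEulerVersion P τ ν h b Y (τ / n) T V →
      ∀ s ∈ Icc (-τ) T, ∀ t ∈ Icc (-τ) T, |t - s| ≤ τ / n →
      LpBdd P q (fun ω => (b (Y s ω) - b (V s ω)) - deriv b (Y t ω) * (Y t ω - V t ω))
        (C * (τ / n + (τ / n) ^ H) * (τ / n)) := by
  have h2t : 2 * q ≠ ∞ := ENNReal.mul_ne_top (by simp) hqt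
  obtain ⟨A, hA0, hA⟩ := hM.exists_lpBdd_euler (one_le_two_mul_ennreal hq1) h2t T
  obtain ⟨B, hB0, hB⟩ := hM.exists_lpBdd_sub (one_le_two_mul_ennreal hq1) h2t T
  obtain ⟨D, hD0, hD⟩ := hM.exists_lpBdd_euler_sub hq1 hqt T
  have hK := hM.bound_nonneg
  have hH := hM.half_lt
  refine ⟨K * A * A + K * B * A + K * D, by positivity, fun n hn V hV s hs t ht hst => ?_⟩
  have hΔ := hM.step_pos hn
  set Δ := τ / (n : ℝ) with hΔdef
  have us := hA n hn V hV s hs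
  -- Three remainders, for `U` the error: Taylor at `Y s`, of order `Δ²`; the change of `b'` from `Y
  -- t` to `Y s` times `U s`, of order `Δ^H Δ`; and `b'(Y t) (U s - U t)`, of order `Δ Δ^H`.
  have r1 := ((us.mul (by positivity) us).const_mul K)
  rw [abs_of_nonneg hK] at r1
  have mYs := hM.measurable_eval s
  have mYt := hM.measurable_eval t
  have mVs := hV.measurable_eval hM s
  have r1' : LpBdd P q (fun ω => b (V s ω) - b (Y s ω) - deriv b (Y s ω) * (V s ω - Y s ω))
      (K * (A * Δ * (A * Δ))) :=
    r1.of_abs_le (((hM.measurable_b.comp mVs).sub (hM.measurable_b.comp mYs)).sub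
      ((hM.measurable_deriv_b.comp mYs).mul (mVs.sub mYs))).aestronglyMeasurable
      (Eventually.of_forall fun ω => (hM.abs_taylor_le _ _).trans (by
        rw [abs_mul, abs_mul, abs_of_nonneg hK, sq, abs_sub_comm]))
  have r2 := (((hB t ht s hs).mono (D := B * Δ ^ H) (by
      gcongr; rwa [abs_sub_comm])).sub_comp hM.measurable_deriv_b hK
    hM.abs_deriv_sub_le mYs mYt).mul (by positivity) us
  have r3 := LpBdd.bdd_mul (P := P) (f := fun ω => deriv b (Y t ω))
    (hM.measurable_deriv_b.comp mYt).aestronglyMeasurable hK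
    (Eventually.of_forall fun ω => hM.abs_deriv_le _)
    ((hD n hn V hV t ht s hs).mono (D := D * (Δ * Δ ^ H)) (by
      gcongr; rwa [abs_sub_comm]))
  have := (r1'.neg.add hq1 (by positivity) (by positivity) r2).add hq1 (by positivity)
    (by positivity) r3
  refine (this.mono ?_).congr (Eventually.of_forall fun ω => by ring)
  have p0 : 0 ≤ Δ ^ H := by positivity
  have q1 : 0 ≤ K * A * A * Δ ^ H * Δ := by positivity
  have q2 : 0 ≤ (K * B * A + K * D) * Δ * Δ := by positivity
  nlinarith

end IsDelayModel

end
-- Linearization and the limit of the debiased error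
noncomputable section

variable {Ω : Type*} [MeasurableSpace Ω] {P : Measure Ω} [IsProbabilityMeasure P] {q : ℝ≥0∞}
  {τ : ℝ} {ν : Measure ℝ} [IsFiniteMeasure ν] {h b x₀ : ℝ → ℝ} {K H c : ℝ} {Z Y : ℝ → Ω → ℝ}

theorem volterra_const_mul (β f : ℝ → ℝ) (a t : ℝ) :
    volterra ν h β (fun v => a * f v) t = a * volterra ν h β f t := by
  unfold volterra delayInt
  rw [← intervalIntegral.integral_const_mul]
  refine intervalIntegral.integral_congr fun u _ => ?_
  simp only
  rw [← integral_const_mul]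
  refine integral_congr_ae (Eventually.of_forall fun r => ?_)
  by_cases h0 : u - r ∈ Ici (0 : ℝ)
  · simp only [indicator_of_mem h0]; ring
  · simp only [indicator_of_notMem h0]; ring

theorem LocBdd.sub {f g : ℝ → ℝ} (hf : LocBdd f) (hg : LocBdd g) : LocBdd fun t => f t - g t := by
  refine ⟨hf.1.sub hg.1, fun T => ?_⟩
  obtain ⟨C, hC⟩ := hf.2 T
  obtain ⟨D, hD⟩ := hg.2 T
  exact ⟨C + D, fun t ht => (abs_sub _ _).trans (add_le_add (hC t ht) (hD t ht))⟩

theorem LocBdd.const_mul {f : ℝ → ℝ} (hf : LocBdd f) (a : ℝ) : LocBdd fun t => a * f t := by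
  refine ⟨hf.1.const_mul a, fun T => ?_⟩
  obtain ⟨C, hC⟩ := hf.2 T
  exact ⟨|a| * C, fun t ht => by rw [abs_mul]; gcongr; exact hC t ht⟩

theorem continuous_halfForcing (hh : IsDelayDensity τ ν h) {y : ℝ → ℝ} (hy : Continuous y) :
    Continuous (halfForcing ν h y) := by
  refine continuous_const.mul (continuous_iff_continuousAt.2 fun t => ?_)
  obtain ⟨C, hC⟩ := exists_bound_Icc hy (t - 1 - τ) (t + 1)
  obtain ⟨D, hD⟩ := exists_bound_Icc hy (-τ) 0
  refine continuousAt_of_dominated (bound := fun _ => C + D) ?_ ?_ (integrable_const _) ?_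
  · exact Eventually.of_forall fun u => (hh.measurable.mul
      ((hy.measurable.comp (measurable_const.sub measurable_id)).sub
        (hy.measurable.comp measurable_neg))).aestronglyMeasurable
  · filter_upwards [Icc_mem_nhds (show t - 1 < t by linarith) (show t < t + 1 by linarith)]
      with u hu
    filter_upwards [hh.supp] with r hr
    rw [Real.norm_eq_abs, abs_mul, hh.abs_eq_one, one_mul]
    exact (abs_sub _ _).trans (add_le_add
      (hC _ ⟨by linarith [hu.1, hr.2], by linarith [hu.2, hr.1]⟩)
      (hD _ ⟨by linarith [hr.2], by linarith [hr.1]⟩))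
  · exact Eventually.of_forall fun r => by fun_prop

theorem locBdd_halfForcing (hh : IsDelayDensity τ ν h) {y : ℝ → ℝ} (hy : Continuous y) :
    LocBdd (halfForcing ν h y) :=
  ⟨(continuous_halfForcing hh hy).measurable, fun T =>
    exists_bound_Icc (continuous_halfForcing hh hy) 0 T⟩

/-- The bias path driven by the discretization of the delay. -/
def biasPath (ν : Measure ℝ) (h b : ℝ → ℝ) (Y : ℝ → Ω → ℝ) (Δ t : ℝ) (ω : Ω) : ℝ :=
  resolventInt ν h (fun s => deriv b (Y s ω)) (shiftForcing ν h Δ fun s => b (Y s ω)) t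

/-- The limit of the rescaled and debiased error of the Euler scheme. -/
def limitPath (ν : Measure ℝ) (h b : ℝ → ℝ) (Y : ℝ → Ω → ℝ) (t : ℝ) (ω : Ω) : ℝ :=
  volterraSol ν h (fun s => deriv b (Y s ω)) (halfForcing ν h fun s => b (Y s ω)) t

/-- The integrand of the remainder of the linearization of the error equation. -/
def linRemainder (b : ℝ → ℝ) (Y V : ℝ → Ω → ℝ) (Δ s r : ℝ) (ω : Ω) : ℝ :=
  (b (Y (gridFloor Δ s - gridFloor Δ r) ω) - b (V (gridFloor Δ s - gridFloor Δ r) ω)) -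
    (Ici (0 : ℝ)).indicator (fun v => deriv b (Y v ω) * (Y v ω - V v ω)) (s - r)

namespace IsDelayModel

variable (hM : IsDelayModel P τ ν h b x₀ K H c Z Y)
include hM

theorem measurable_deriv_swap : Measurable fun p : Ω × ℝ => deriv b (Y p.2 p.1) :=
  hM.measurable_deriv_b.comp hM.measurable_swap

theorem measurable_deriv_path (ω : Ω) : Measurable fun s => deriv b (Y s ω) :=
  hM.measurable_deriv_b.comp (hM.measurable_path ω)

theorem measurable_biasPath (Δ : ℝ) : Measurable (Function.uncurry (biasPath ν h b Y Δ)) :=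
  (measurable_resolventInt hM.density (β := fun ω s => deriv b (Y s ω))
    (f := fun ω => shiftForcing ν h Δ fun s => b (Y s ω)) hM.measurable_deriv_swap
    (hM.measurable_shiftForcing Δ)).comp _root_.measurable_swap

theorem measurable_limitPath : Measurable (Function.uncurry (limitPath ν h b Y)) :=
  (measurable_volterraSol hM.density (β := fun ω s => deriv b (Y s ω))
    (N := fun ω => halfForcing ν h fun s => b (Y s ω)) hM.measurable_deriv_swap
    hM.measurable_halfForcing).comp _root_.measurable_swap

theorem locBdd_biasPath {Δ : ℝ} (hΔ : 0 < Δ) (ω : Ω) :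
    LocBdd fun t => biasPath ν h b Y Δ t ω :=
  locBdd_resolventInt hM.density hM.bound_nonneg (hM.measurable_deriv_path ω)
    (fun _ _ => hM.abs_deriv_le _) (locBdd_shiftForcing hM.density hΔ (hM.continuous_b_path ω))

theorem locBdd_limitPath (ω : Ω) : LocBdd fun t => limitPath ν h b Y t ω :=
  (locBdd_halfForcing hM.density (hM.continuous_b_path ω)).volterraSol hM.density hM.bound_nonneg
    (hM.measurable_deriv_path ω) (fun _ _ => hM.abs_deriv_le _)

theorem biasPath_eq {Δ : ℝ} (hΔ : 0 < Δ) (ω : Ω) {t : ℝ} (ht : 0 ≤ t) :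
    biasPath ν h b Y Δ t ω =
      volterra ν h (fun s => deriv b (Y s ω)) (fun t => biasPath ν h b Y Δ t ω) t +
      ∫ s in (0 : ℝ)..t, shiftForcing ν h Δ (fun s => b (Y s ω)) s :=
  volterra_resolventInt hM.density hM.bound_nonneg (hM.measurable_deriv_path ω)
    (fun _ _ => hM.abs_deriv_le _) (locBdd_shiftForcing hM.density hΔ (hM.continuous_b_path ω)) ht

theorem limitPath_eq (ω : Ω) {t : ℝ} (ht : 0 ≤ t) :
    limitPath ν h b Y t ω =
      volterra ν h (fun s => deriv b (Y s ω)) (fun t => limitPath ν h b Y t ω) t +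
      halfForcing ν h (fun s => b (Y s ω)) t :=
  volterraSol_eq hM.density hM.bound_nonneg (hM.measurable_deriv_path ω)
    (fun _ _ => hM.abs_deriv_le _) (locBdd_halfForcing hM.density (hM.continuous_b_path ω)) ht

/-- `L^q` bounds for solutions of the linearized equation. -/
theorem lpBdd_of_volterra (hq1 : 1 ≤ q) (hqt : q ≠ ∞) {T ε : ℝ} (hε : 0 ≤ ε) {w : ℝ → Ω → ℝ}
    (hw : Measurable (Function.uncurry w)) (hwb : ∀ ω, LocBdd fun t => w t ω)
    (hN : ∀ t ∈ Icc 0 T, LpBdd P q (fun ω => w t ω -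
      volterra ν h (fun s => deriv b (Y s ω)) (fun t => w t ω) t) ε) {t : ℝ} (ht : t ∈ Icc 0 T) :
    LpBdd P q (w t) (ε * 2 * Real.exp (volterraRate ν K * T)) := by
  have hK := hM.bound_nonneg
  have hvm : Measurable (Function.uncurry fun t ω =>
      volterra ν h (fun s => deriv b (Y s ω)) (fun t => w t ω) t) :=
    (measurable_volterra hM.density (β := fun ω s => deriv b (Y s ω)) (f := fun ω t => w t ω)
      hM.measurable_deriv_swap (hw.comp _root_.measurable_swap)).comp _root_.measurable_swap
  refine LpBdd.gronwall (τ := τ) (a := fun s r => s - r) (g := fun t ω => w t ω -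
      volterra ν h (fun s => deriv b (Y s ω)) (fun t => w t ω) t) (by fun_prop) hM.density.supp
      (fun s r hr => by linarith [hr.1]) hq1 hqt hK hε hw (hw.sub hvm)
      (Eventually.of_forall fun ω => (hwb ω).2 T) (Eventually.of_forall fun ω u hu => ?_) hN ht
  have h1 : ‖volterra ν h (fun s => deriv b (Y s ω)) (fun t => w t ω) u‖ₑ ≤
      eDelay ν K (fun s r => s - r) (fun v => ‖w v ω‖ₑ) u := by
    refine enorm_integral_le_eDelay (G := fun s r => h r * (Ici (0 : ℝ)).indicator
      (fun v => deriv b (Y v ω) * w v ω) (s - r)) hu.1 fun s hs => ?_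
    refine Eventually.of_forall fun r => ?_
    rw [enorm_mul, show ‖h r‖ₑ = 1 by
      rw [← ofReal_norm, Real.norm_eq_abs, hM.density.abs_eq_one, ENNReal.ofReal_one], one_mul]
    by_cases h0 : s - r ∈ Ici (0 : ℝ)
    · rw [indicator_of_mem h0, indicator_of_mem h0, enorm_mul]
      gcongr
      rw [← ofReal_norm]
      exact ENNReal.ofReal_le_ofReal (hM.abs_deriv_le _)
    · rw [indicator_of_notMem h0, enorm_zero]
      exact bot_le
  have e : w u ω = (w u ω - volterra ν h (fun s => deriv b (Y s ω)) (fun t => w t ω) u) +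
      volterra ν h (fun s => deriv b (Y s ω)) (fun t => w t ω) u := by ring
  conv_lhs => rw [e]
  exact (enorm_add_le _ _).trans (add_le_add_right h1 _)

theorem memLp_limitPath (hq1 : 1 ≤ q) (hqt : q ≠ ∞) {t : ℝ} (ht : 0 ≤ t) :
    MemLp (limitPath ν h b Y t) q P := by
  obtain ⟨C, hC0, hC⟩ := hM.exists_lpBdd_halfForcing hq1 hqt t
  refine (hM.lpBdd_of_volterra (T := t) hq1 hqt hC0 hM.measurable_limitPath hM.locBdd_limitPath
    (fun u hu => (hC u hu).congr (Eventually.of_forall fun ω => ?_)) ⟨ht, le_rfl⟩).memLp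
  have := hM.limitPath_eq ω hu.1
  linarith

theorem memLp_biasPath (hq1 : 1 ≤ q) (hqt : q ≠ ∞) {Δ : ℝ} (hΔ : 0 < Δ) {t : ℝ} (ht : 0 ≤ t) :
    MemLp (biasPath ν h b Y Δ t) q P := by
  obtain ⟨C, hC0, hC⟩ := hM.exists_lpBdd_integral_shiftForcing hq1 hqt t
  refine (hM.lpBdd_of_volterra (T := t) (ε := C * Δ) hq1 hqt (by positivity)
    (hM.measurable_biasPath Δ) (hM.locBdd_biasPath hΔ)
    (fun u hu => (hC Δ hΔ u hu).congr (Eventually.of_forall fun ω => ?_)) ⟨ht, le_rfl⟩).memLp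
  have := hM.biasPath_eq hΔ ω hu.1
  linarith

theorem measurable_linRemainder {V : ℝ → Ω → ℝ} {Δ T : ℝ}
    (hV : IsEulerVersion P τ ν h b Y Δ T V) {S : Type*} [MeasurableSpace S] {u v : S → ℝ}
    {w : S → Ω} (hu : Measurable u) (hv : Measurable v) (hw : Measurable w) :
    Measurable fun z => linRemainder b Y V Δ (u z) (v z) (w z) := by
  have hg := measurable_gridFloor (Δ := Δ)
  have m2 : Measurable fun z => gridFloor Δ (u z) - gridFloor Δ (v z) :=
    (hg.comp hu).sub (hg.comp hv)
  have mI : Measurable fun z : ℝ × Ω => (Ici (0 : ℝ)).indicator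
      (fun v => deriv b (Y v z.2) * (Y v z.2 - V v z.2)) z.1 :=
    ((hM.measurable_deriv_b.comp hM.measurable).mul (hV.measurable_sub hM)).indicator
      (s := {z : ℝ × Ω | z.1 ∈ Ici (0:ℝ)}) (measurable_fst measurableSet_Ici)
  exact ((hM.measurable_b_comp m2 hw).sub (hV.measurable_b_comp hM m2 hw)).sub
    (mI.comp ((hu.sub hv).prodMk hw))

theorem exists_lpBdd_linRemainder (hq1 : 1 ≤ q) (hqt : q ≠ ∞) (T : ℝ) :
    ∃ C, 0 ≤ C ∧ ∀ n : ℕ, 1 ≤ n → ∀ V, IsEulerVersion P τ ν h b Y (τ / n) T V →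
      ∀ s ∈ Icc 0 T, ∀ r ∈ Icc 0 τ,
      LpBdd P q (linRemainder b Y V (τ / n) s r) (C * (τ / n + (τ / n) ^ H) * (τ / n)) := by
  obtain ⟨A, hA0, hA⟩ := hM.exists_lpBdd_linearization hq1 hqt T
  refine ⟨A, hA0, fun n hn V hV s hs r hr => ?_⟩
  have hΔ := hM.step_pos hn
  have hsr := shift_mem_Icc hs hr
  refine (hA n hn V hV _ (gridFloor_shift_mem_Icc hΔ hs hr) (s - r) hsr ?_).congr ?_
  · have a1 := gridFloor_le hΔ s
    have a2 := lt_gridFloor_add hΔ s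
    have a3 := gridFloor_le hΔ r
    have a4 := lt_gridFloor_add hΔ r
    rw [abs_le]; constructor <;> linarith
  · by_cases h0 : 0 ≤ s - r
    · refine Eventually.of_forall fun ω => ?_
      simp only [linRemainder, indicator_of_mem (show s - r ∈ Ici (0:ℝ) from h0)]
    · filter_upwards [hV.sub_ae_eq_zero hM (t := s - r) ⟨hsr.1, (not_le.1 h0).le⟩] with ω hω
      simp only [linRemainder, indicator_of_notMem (show s - r ∉ Ici (0:ℝ) from h0), hω, mul_zero]

/-- An exact identity: the remainder of the linear equation is the double integral of the pointwise
linearization errors, so Minkowski carries the pointwise bound over. -/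
theorem sub_eulerForcing_sub_volterra {V : ℝ → Ω → ℝ} {Δ T : ℝ} (hΔ : 0 < Δ)
    (hV : IsEulerVersion P τ ν h b Y Δ T V) {t : ℝ} (ht : t ∈ Icc 0 T) : ∀ᵐ ω ∂P,
    (Y t ω - V t ω) - eulerForcing ν h Δ (fun t => b (Y t ω)) t -
        volterra ν h (fun s => deriv b (Y s ω)) (fun v => Y v ω - V v ω) t =
      ∫ s in (0 : ℝ)..t, ∫ r, h r * linRemainder b Y V Δ s r ω ∂ν := by
  filter_upwards [hV.sub_eq_add hM hΔ] with ω hω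
  rw [hω t ht]
  obtain ⟨-, m2, m3, C, hC⟩ := hV.drift_aux hM hΔ ω t
  obtain ⟨mi, bi, -⟩ := (hV.locBdd_sub hM ω).delay hM.density hM.bound_nonneg
    (hM.measurable_deriv_path ω) (fun _ _ => hM.abs_deriv_le _)
  obtain ⟨D, hD0, hD⟩ := bi t
  set I := (Ici (0 : ℝ)).indicator (fun v => deriv b (Y v ω) * (Y v ω - V v ω)) with hI
  have mi' : Measurable (Function.uncurry fun s r => I (s - r)) :=
    mi.comp (measurable_fst.sub measurable_snd)
  have mF : Measurable (Function.uncurry fun s r => linRemainder b Y V Δ s r ω) := by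
    rw [Function.uncurry_def]
    exact hM.measurable_linRemainder hV measurable_fst measurable_snd measurable_const
  have e := integral_delay_add hM.density mF mi' (C := 2 * C + D) (D := D) ht.1
    (fun s hs r hr => (abs_sub _ _).trans (add_le_add
      (abs_sub_le_two_mul (hC s hs r hr).2.1 (hC s hs r hr).2.2)
      (hD _ (by linarith [hs.2, hr.1]))))
    (fun s hs r hr => hD _ (by linarith [hs.2, hr.1]))
  have e' : ∀ s r, linRemainder b Y V Δ s r ω + I (s - r) =
      b (Y (gridFloor Δ s - gridFloor Δ r) ω) - b (V (gridFloor Δ s - gridFloor Δ r) ω) :=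
    fun s r => sub_add_cancel _ _
  simp only [e'] at e
  rw [e, show volterra ν h (fun s => deriv b (Y s ω)) (fun v => Y v ω - V v ω) t =
    ∫ s in (0 : ℝ)..t, ∫ r, h r * I (s - r) ∂ν from rfl]
  ring

/-- The remainder of the linearization of the error equation. -/
theorem exists_lpBdd_remainder (hq1 : 1 ≤ q) (hqt : q ≠ ∞) (T : ℝ) :
    ∃ C, 0 ≤ C ∧ ∀ n : ℕ, 1 ≤ n → ∀ V, IsEulerVersion P τ ν h b Y (τ / n) T V → ∀ t ∈ Icc 0 T,
      LpBdd P q (fun ω => (Y t ω - V t ω) - eulerForcing ν h (τ / n) (fun t => b (Y t ω)) t -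
        volterra ν h (fun s => deriv b (Y s ω)) (fun v => Y v ω - V v ω) t)
        (C * (τ / n + (τ / n) ^ H) * (τ / n)) := by
  obtain ⟨A, hA0, hA⟩ := hM.exists_lpBdd_linRemainder hq1 hqt T
  refine ⟨|T| * (ν.real univ * A), by positivity, fun n hn V hV t ht => ?_⟩
  have hΔ := hM.step_pos hn
  have mF : Measurable (Function.uncurry fun (z : ℝ × Ω) r =>
      linRemainder b Y V (τ / n) z.1 r z.2) := by
    rw [Function.uncurry_def]
    exact hM.measurable_linRemainder hV (measurable_fst.comp measurable_fst) measurable_snd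
      (measurable_snd.comp measurable_fst)
  have m1 : Measurable (Function.uncurry fun s ω => ∫ r, h r *
      linRemainder b Y V (τ / n) s r ω ∂ν) := by
    rw [Function.uncurry_def]
    exact hM.measurable_integral_h mF
  have key := LpBdd.integral_le_abs (P := P) (q := q) hq1 hqt m1 ht.1
    (show t - 0 ≤ |T| by linarith [ht.2, le_abs_self T])
    (C := ν.real univ * (A * (τ / n + (τ / n) ^ H) * (τ / n))) (by positivity) fun s hs => by
      have mFs : Measurable (Function.uncurry fun r ω => linRemainder b Y V (τ / n) s r ω) := by
        rw [Function.uncurry_def]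
        exact hM.measurable_linRemainder hV measurable_const measurable_fst measurable_snd
      exact hM.lpBdd_delayInt hq1 hqt mFs
        fun r hr => hA n hn V hV s ⟨hs.1.le, hs.2.trans ht.2⟩ r hr
  refine (key.mono (le_of_eq (by ring))).congr ?_
  filter_upwards [hM.sub_eulerForcing_sub_volterra hΔ hV ht] with ω hω
  exact hω.symm

/-- The debiased error of the Euler scheme is `Δ` times the limit path, up to `o(Δ)` in `L^q`. -/
theorem eventually_lpBdd_limit (hq1 : 1 ≤ q) (hqt : q ≠ ∞) (T : ℝ) {ε : ℝ} (hε : 0 < ε) :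
    ∀ᶠ n : ℕ in atTop, ∀ V, IsEulerVersion P τ ν h b Y (τ / n) T V → ∀ t ∈ Icc 0 T,
      LpBdd P q (fun ω => (Y t ω - V t ω) - biasPath ν h b Y (τ / n) t ω -
        τ / n * limitPath ν h b Y t ω) (ε * (τ / n)) := by
  obtain ⟨A, hA0, hA⟩ := hM.exists_lpBdd_remainder hq1 hqt T
  have hH := hM.half_lt
  have hK := hM.bound_nonneg
  set E := Real.exp (volterraRate ν K * T) with hE
  have hE0 : 0 < E := Real.exp_pos _
  -- Two errors `ε' Δ`, multiplied by the Grönwall constant `2 E`.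
  set ε' := ε / (4 * E) with hε'
  have hε'0 : 0 < ε' := by positivity
  have hlim : Tendsto (fun n : ℕ => A * (τ / (n : ℝ) + (τ / (n : ℝ)) ^ H)) atTop (𝓝 0) := by
    have := ((tendsto_const_div_atTop_nhds_zero_nat τ).add
      (hM.tendsto_step_rpow (e := H) (by linarith))).const_mul A
    simpa using this
  filter_upwards [hM.eventually_lpBdd_gridForcing_sub hq1 hqt T hε'0,
    hlim.eventually (gt_mem_nhds hε'0), eventually_ge_atTop 1] with n hn1 hn2 hn V hV t ht
  have hΔ := hM.step_pos hn
  set Δ := τ / (n : ℝ) with hΔdef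
  -- For this `w` the residual `w - A w` loses the shift forcing to the bias path; what is left is
  -- `gridForcing - Δ halfForcing` plus the linearization remainder, both `o(Δ)`.
  refine (hM.lpBdd_of_volterra (T := T) (ε := ε' * Δ + ε' * Δ) (w := fun t ω => (Y t ω - V t ω) -
    biasPath ν h b Y Δ t ω - Δ * limitPath ν h b Y t ω) hq1 hqt (by positivity)
    (((hV.measurable_sub hM).sub (hM.measurable_biasPath Δ)).sub
      (hM.measurable_limitPath.const_mul Δ))
    (fun ω => ((hV.locBdd_sub hM ω).sub (hM.locBdd_biasPath hΔ ω)).sub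
      ((hM.locBdd_limitPath ω).const_mul Δ)) (fun u hu => ?_) ht).mono ?_
  · have := (hn1 u hu).add hq1 (by positivity) (by positivity)
      ((hA n hn V hV u hu).mono (D := ε' * Δ) (by gcongr))
    refine this.congr (Eventually.of_forall fun ω => ?_)
    have hβm := hM.measurable_deriv_path ω
    have hβ : ∀ v : ℝ, 0 ≤ v → |deriv b (Y v ω)| ≤ K := fun _ _ => hM.abs_deriv_le _
    have e1 := volterra_sub hM.density hK hβm hβ
      ((hV.locBdd_sub hM ω).sub (hM.locBdd_biasPath hΔ ω)) ((hM.locBdd_limitPath ω).const_mul Δ)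
      hu.1
    have e2 := volterra_sub hM.density hK hβm hβ (hV.locBdd_sub hM ω) (hM.locBdd_biasPath hΔ ω)
      hu.1
    have e3 := volterra_const_mul (ν := ν) (h := h) (fun s => deriv b (Y s ω))
      (fun t => limitPath ν h b Y t ω) Δ u
    have e4 := hM.biasPath_eq hΔ ω hu.1
    have e5 := hM.limitPath_eq ω hu.1
    have e6 := eulerForcing_eq hM.density hΔ (hM.continuous_b_path ω) hu.1
    simp only at e1 e2 e3 e4 e5 e6 ⊢
    rw [e1, e2, e3, e6]
    linear_combination e4 + Δ * e5
  · rw [← hE]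
    refine le_of_eq ?_
    rw [hε']
    field_simp
    ring

end IsDelayModel

end
-- Measurable versions of the scheme and of the solution
noncomputable section

variable {Ω : Type*} [MeasurableSpace Ω] {P : Measure Ω} [IsProbabilityMeasure P] {q : ℝ≥0∞}
  {τ : ℝ} {ν : Measure ℝ} [IsFiniteMeasure ν] {h b x₀ : ℝ → ℝ} {K H c : ℝ} {Z Y : ℝ → Ω → ℝ}

section EulerVersion

/-- Picard iterates for the equation of the Euler scheme. They are stationary on bounded
intervals. -/
def eulerIter (ν : Measure ℝ) (h b : ℝ → ℝ) (Y : ℝ → Ω → ℝ) (Δ : ℝ) : ℕ → ℝ → Ω → ℝ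
  | 0 => Y
  | k + 1 => fun t ω => if t < 0 then Y t ω else Y 0 ω +
      (∫ s in (0 : ℝ)..t, ∫ r, h r * b (eulerIter ν h b Y Δ k (gridFloor Δ s - gridFloor Δ r) ω) ∂ν)
      + delayNoise ν h b Y t ω

namespace IsDelayModel

variable (hM : IsDelayModel P τ ν h b x₀ K H c Z Y)
include hM

theorem measurable_eulerIter (Δ : ℝ) (k : ℕ) :
    Measurable (Function.uncurry (eulerIter ν h b Y Δ k)) := by
  induction k with
  | zero => exact hM.measurable
  | succ k ih =>
    have hg := measurable_gridFloor (Δ := Δ)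
    have m0 : Measurable fun z : ((ℝ × Ω) × ℝ) × ℝ => z.1.1.2 :=
      measurable_snd.comp (measurable_fst.comp measurable_fst)
    have m1 : Measurable fun z : ((ℝ × Ω) × ℝ) × ℝ => gridFloor Δ z.1.2 - gridFloor Δ z.2 :=
      (hg.comp (measurable_snd.comp measurable_fst)).sub (hg.comp measurable_snd)
    have m2 : Measurable fun z : ((ℝ × Ω) × ℝ) × ℝ =>
        b (eulerIter ν h b Y Δ k (gridFloor Δ z.1.2 - gridFloor Δ z.2) z.1.1.2) :=
      hM.measurable_b.comp (ih.comp (m1.prodMk m0))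
    have m3 : Measurable fun z : (ℝ × Ω) × ℝ => ∫ r, h r *
        b (eulerIter ν h b Y Δ k (gridFloor Δ z.2 - gridFloor Δ r) z.1.2) ∂ν :=
      hM.measurable_integral_h (S := (ℝ × Ω) × ℝ) (F := fun z r =>
        b (eulerIter ν h b Y Δ k (gridFloor Δ z.2 - gridFloor Δ r) z.1.2)) m2
    have m4 : Measurable fun p : ℝ × Ω => ∫ s in (0 : ℝ)..p.1, ∫ r, h r *
        b (eulerIter ν h b Y Δ k (gridFloor Δ s - gridFloor Δ r) p.2) ∂ν :=
      measurable_intervalIntegral_param (S := ℝ × Ω) (F := fun p s => ∫ r, h r *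
        b (eulerIter ν h b Y Δ k (gridFloor Δ s - gridFloor Δ r) p.2) ∂ν) m3 measurable_const
        measurable_fst
    have m5 : Measurable fun p : ℝ × Ω => Y 0 p.2 := (hM.measurable_eval 0).comp measurable_snd
    exact Measurable.ite (measurable_fst measurableSet_Iio) hM.measurable
      ((m5.add m4).add hM.measurable_noise)

theorem noise_bdd (ω : Ω) (T : ℝ) : ∃ C, ∀ t ∈ Icc 0 T, |delayNoise ν h b Y t ω| ≤ C := by
  obtain ⟨C, hC0, hC⟩ := hM.path_bdd ω T
  obtain ⟨D, hD⟩ := hM.drift_bdd ω T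
  have hτ := hM.delay_pos
  refine ⟨C + C + |D| * T, fun t ht => ?_⟩
  have h1 := intervalIntegral.norm_integral_le_of_norm_le_const (a := 0) (b := t) (C := |D|)
    (f := fun s => delayDrift ν h b Y s ω) (fun s hs => by
      rw [uIoc_of_le ht.1] at hs
      exact (hD s ⟨hs.1.le, hs.2.trans ht.2⟩).trans (le_abs_self D))
  rw [sub_zero, abs_of_nonneg ht.1, Real.norm_eq_abs] at h1
  have h2 : |D| * t ≤ |D| * T := by gcongr; exact ht.2
  have h3 := abs_sub (Y t ω - Y 0 ω) (∫ s in (0 : ℝ)..t, delayDrift ν h b Y s ω)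
  have h4 := abs_sub (Y t ω) (Y 0 ω)
  have h5 := hC t ⟨by linarith [ht.1], ht.2⟩
  have h6 := hC 0 ⟨by linarith, ht.1.trans ht.2⟩
  unfold delayNoise
  linarith

theorem eulerIter_bdd {Δ : ℝ} (hΔ : 0 < Δ) (ω : Ω) (k : ℕ) (T : ℝ) :
    ∃ C, ∀ t ∈ Icc (-τ) T, |eulerIter ν h b Y Δ k t ω| ≤ C := by
  obtain ⟨C, hC0, hC⟩ := hM.path_bdd ω T
  induction k with
  | zero => exact ⟨C, hC⟩
  | succ k ih =>
    obtain ⟨D, hD⟩ := ih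
    obtain ⟨E, hE⟩ := hM.noise_bdd ω T
    obtain ⟨F, hF⟩ := hM.path_bdd ω 0
    have hτ := hM.delay_pos
    have hK := hM.bound_nonneg
    refine ⟨C + (F + (|b 0| + K * |D|) * ν.real univ * |T| + |E|), fun t ht => ?_⟩
    have hF0 : 0 ≤ F := hF.1
    have hpos : 0 ≤ F + (|b 0| + K * |D|) * ν.real univ * |T| + |E| := by positivity
    by_cases h0 : t < 0
    · simp only [eulerIter, if_pos h0]
      linarith [hC t ht]
    · push Not at h0
      have hT : t ≤ |T| := ht.2.trans (le_abs_self T)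
      simp only [eulerIter, if_neg (not_lt.2 h0)]
      have h1 := intervalIntegral.norm_integral_le_of_norm_le_const (a := 0) (b := t)
        (C := (|b 0| + K * |D|) * ν.real univ) (f := fun s => ∫ r, h r *
          b (eulerIter ν h b Y Δ k (gridFloor Δ s - gridFloor Δ r) ω) ∂ν) (fun s hs => by
        rw [uIoc_of_le h0] at hs
        refine norm_integral_le_of_norm_le_const ?_
        filter_upwards [hM.density.supp] with r hr
        rw [Real.norm_eq_abs, abs_mul, hM.density.abs_eq_one, one_mul]
        refine (hM.abs_b_le _).trans ?_
        have h5 := mul_le_mul_of_nonneg_left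
          ((hD _ (gridFloor_shift_mem_Icc hΔ ⟨hs.1.le, hs.2.trans ht.2⟩ hr)).trans
            (le_abs_self D)) hK
        linarith)
      rw [sub_zero, abs_of_nonneg h0, Real.norm_eq_abs] at h1
      have h2 : (|b 0| + K * |D|) * ν.real univ * t ≤ (|b 0| + K * |D|) * ν.real univ * |T| := by
        gcongr
      have h3 := hF.2 0 ⟨by linarith, le_rfl⟩
      have h4 := (hE t ⟨h0, ht.2⟩).trans (le_abs_self E)
      refine (abs_add_three _ _ _).trans ?_
      linarith

/-- The Euler scheme has a jointly measurable version on every bounded interval. -/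
theorem exists_eulerVersion {n : ℕ} (hn : 1 ≤ n) {X : ℝ → Ω → ℝ} (T : ℝ)
    (hX0 : ∀ᵐ ω ∂P, ∀ t, -τ ≤ t → t < 0 → X t ω = x₀ t)
    (hX : ∀ᵐ ω ∂P, ∀ t, 0 ≤ t → X t ω = x₀ 0 + (∫ s in (0 : ℝ)..t, ∫ r, h r *
      b (X (gridFloor (τ / n) s - gridFloor (τ / n) r) ω) ∂ν) + Z t ω) :
    ∃ V, IsEulerVersion P τ ν h b Y (τ / n) T V ∧
      ∀ᵐ ω ∂P, ∀ t ∈ Icc (-τ) T, X t ω = V t ω := by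
  have hΔ := hM.step_pos hn
  have hτ := hM.delay_pos
  set Δ := τ / (n : ℝ) with hΔdef
  -- On `[-τ, kΔ]` the scheme equals the `k`-th Picard iterate: for `s < (k + 1) Δ` all grid times
  -- used are at most `k Δ`. This yields joint measurability, which the scheme is not assumed to
  -- have.
  have agree : ∀ᵐ ω ∂P, ∀ k : ℕ, ∀ t ∈ Icc (-τ) (k * Δ), X t ω = eulerIter ν h b Y Δ k t ω := by
    filter_upwards [hX0, hX, hM.noise_eq] with ω h0 h1 h2 k
    induction k with
    | zero =>
      intro t ht
      simp only [Nat.cast_zero, zero_mul] at ht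
      simp only [eulerIter]
      rw [hM.init ω t ht]
      rcases lt_or_eq_of_le ht.2 with h | h
      · exact h0 t ht.1 h
      -- The initial condition covers only `t < 0`; at `t = 0` the equation gives `x₀ 0 + Z 0`, and
      -- the recovered noise vanishes at `0`.
      · rw [h, h1 0 le_rfl, ← h2 0 le_rfl]
        simp [delayNoise]
    | succ k ih =>
      intro t ht
      by_cases hneg : t < 0
      · simp only [eulerIter, if_pos hneg]
        rw [h0 t ht.1 hneg, hM.init ω t ⟨ht.1, hneg.le⟩]
      · push Not at hneg
        simp only [eulerIter, if_neg (not_lt.2 hneg)]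
        rw [h1 t hneg, h2 t hneg, hM.eval_zero]
        congr 2
        refine intervalIntegral.integral_congr_ae ?_
        have hne : ∀ᵐ s : ℝ, s ≠ (k + 1) * Δ := by simp [ae_iff, measure_singleton]
        filter_upwards [hne] with s hs hst
        rw [uIoc_of_le hneg] at hst
        have hst2 : s ≤ (k + 1) * Δ := hst.2.trans (by exact_mod_cast ht.2)
        have hsk : gridFloor Δ s ≤ k * Δ := by
          unfold gridFloor
          gcongr
          have : ⌊s / Δ⌋ < (k : ℤ) + 1 := by
            rw [Int.floor_lt, div_lt_iff₀ hΔ]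
            push_cast
            exact lt_of_le_of_ne hst2 hs
          exact_mod_cast Int.lt_add_one_iff.1 this
        refine integral_congr_ae ?_
        filter_upwards [hM.density.supp] with r hr
        rw [ih _ (shift_gridFloor_mem_Icc hΔ ⟨gridFloor_nonneg hΔ hst.1.le, hsk⟩ hr)]
  obtain ⟨N, hN⟩ := exists_nat_ge (T / Δ)
  rw [div_le_iff₀ hΔ] at hN
  have agree' : ∀ᵐ ω ∂P, ∀ t ∈ Icc (-τ) T, X t ω = eulerIter ν h b Y Δ N t ω := by
    filter_upwards [agree] with ω hω t ht
    exact hω N t ⟨ht.1, ht.2.trans hN⟩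
  refine ⟨eulerIter ν h b Y Δ N, ⟨hM.measurable_eulerIter Δ N,
    fun ω T' => hM.eulerIter_bdd hΔ ω N T', ?_, ?_⟩, agree'⟩
  · filter_upwards [agree] with ω hω t ht
    have hN0 : t ≤ N * Δ := ht.2.trans (by positivity)
    rw [← hω N t ⟨ht.1, hN0⟩, hω 0 t ⟨ht.1, by simpa using ht.2⟩]
    rfl
  · filter_upwards [agree', hX, hM.noise_eq] with ω hω h1 h2 t ht
    rw [← hω t ⟨by linarith [ht.1], ht.2⟩, h1 t ht.1, h2 t ht.1, hM.eval_zero]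
    congr 2
    refine intervalIntegral.integral_congr fun s hs => ?_
    rw [uIcc_of_le ht.1] at hs
    refine integral_congr_ae ?_
    filter_upwards [hM.density.supp] with r hr
    rw [hω _ (gridFloor_shift_mem_Icc hΔ ⟨hs.1, hs.2.trans ht.2⟩ hr)]

end IsDelayModel

end EulerVersion

section Version

/-- A process with a.s. continuous paths and a deterministic initial segment has a jointly
measurable version all of whose paths are continuous and have this initial segment. -/
theorem exists_continuous_version {X : ℝ → Ω → ℝ} (hτ : 0 < τ)
    (hx₀ : ContinuousOn x₀ (Icc (-τ) 0))
    (hXm : ∀ t : ℝ, -τ ≤ t → AEMeasurable (X t) P)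
    (hXc : ∀ᵐ ω ∂P, ContinuousOn (fun t => X t ω) (Ici (-τ)))
    (hX0 : ∀ᵐ ω ∂P, ∀ t, -τ ≤ t → t < 0 → X t ω = x₀ t) :
    ∃ Y : ℝ → Ω → ℝ, Measurable (Function.uncurry Y) ∧ (∀ ω, Continuous fun t => Y t ω) ∧
      (∀ ω, ∀ t ∈ Icc (-τ) 0, Y t ω = x₀ t) ∧ ∀ᵐ ω ∂P, ∀ t, -τ ≤ t → X t ω = Y t ω := by
  classical
  have hmk : ∀ᵐ ω ∂P, ∀ r : ℚ, ∀ hr : -τ ≤ (r : ℝ), X r ω = (hXm r hr).mk (X r) ω := by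
    rw [ae_all_iff]
    intro r
    by_cases hr : -τ ≤ (r : ℝ)
    · filter_upwards [(hXm r hr).ae_eq_mk] with ω hω _ using hω
    · exact Eventually.of_forall fun ω h => absurd h hr
  obtain ⟨G, hGsub, hGm, hGae⟩ : ∃ G : Set Ω, G ⊆ {ω | ContinuousOn (fun t => X t ω) (Ici (-τ)) ∧
      (∀ t, -τ ≤ t → t < 0 → X t ω = x₀ t) ∧
      ∀ r : ℚ, ∀ hr : -τ ≤ (r : ℝ), X r ω = (hXm r hr).mk (X r) ω} ∧ MeasurableSet G ∧
      G ∈ ae P := by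
    have : {ω | ContinuousOn (fun t => X t ω) (Ici (-τ)) ∧
      (∀ t, -τ ≤ t → t < 0 → X t ω = x₀ t) ∧
      ∀ r : ℚ, ∀ hr : -τ ≤ (r : ℝ), X r ω = (hXm r hr).mk (X r) ω} ∈ ae P := by
      filter_upwards [hXc, hX0, hmk] with ω h1 h2 h3 using ⟨h1, h2, h3⟩
    obtain ⟨G, hG1, hG2, hG3⟩ := exists_measurable_superset_of_null (mem_ae_iff.1 this)
    exact ⟨Gᶜ, compl_subset_comm.1 hG1, hG2.compl, compl_mem_ae_iff.2 hG3⟩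
  -- On the exceptional set the path is replaced by the frozen initial segment, so that continuity
  -- and the initial condition hold for every `ω`.
  let Y : ℝ → Ω → ℝ := fun t => G.piecewise (X (max t (-τ))) fun _ => x₀ (max (min t 0) (-τ))
  have hYG : ∀ ω ∈ G, ∀ t, Y t ω = X (max t (-τ)) ω := fun ω hω t => piecewise_eq_of_mem _ _ _ hω
  have hYG' : ∀ ω, ω ∉ G → ∀ t, Y t ω = x₀ (max (min t 0) (-τ)) := fun ω hω t =>
    piecewise_eq_of_notMem _ _ _ hω
  have hcont : ∀ ω, Continuous fun t => Y t ω := by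
    intro ω
    by_cases hω : ω ∈ G
    · simp only [hYG ω hω]
      exact (hGsub hω).1.comp_continuous (by fun_prop) fun t => le_max_right t (-τ)
    · simp only [hYG' ω hω]
      exact hx₀.comp_continuous (by fun_prop) fun t =>
        ⟨le_max_right _ _, max_le (min_le_right _ _) (by linarith)⟩
  have hmeas : ∀ t, Measurable (Y t) := by
    intro t
    -- On `G` the path at rational times is given by measurable modifications; approximation by
    -- rationals from the right and continuity give measurability at every time.
    obtain ⟨u, -, hu1, hu2⟩ := Real.exists_seq_rat_strictAnti_tendsto (max t (-τ))
    have hu3 : ∀ k, -τ ≤ (u k : ℝ) := fun k => (le_max_right t (-τ)).trans (hu1 k).le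
    refine measurable_of_tendsto_metrizable (f := fun k => G.piecewise
      ((hXm (u k) (hu3 k)).mk (X (u k))) fun _ => x₀ (max (min t 0) (-τ)))
      (fun k => (AEMeasurable.measurable_mk _).piecewise hGm measurable_const) ?_
    rw [tendsto_pi_nhds]
    intro ω
    by_cases hω : ω ∈ G
    · rw [hYG ω hω]
      have e : ∀ k, G.piecewise ((hXm (u k) (hu3 k)).mk (X (u k)))
          (fun _ => x₀ (max (min t 0) (-τ))) ω = X (u k) ω := fun k => by
        rw [piecewise_eq_of_mem _ _ _ hω, (hGsub hω).2.2 (u k) (hu3 k)]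
      simp only [e]
      exact ((hGsub hω).1 (max t (-τ)) (mem_Ici.2 (le_max_right _ _))).tendsto.comp
        (tendsto_nhdsWithin_iff.2 ⟨hu2, Eventually.of_forall hu3⟩)
    · rw [hYG' ω hω]
      have e : ∀ k, G.piecewise ((hXm (u k) (hu3 k)).mk (X (u k)))
          (fun _ => x₀ (max (min t 0) (-τ))) ω = x₀ (max (min t 0) (-τ)) := fun k =>
        piecewise_eq_of_notMem _ _ _ hω
      simp only [e]
      exact tendsto_const_nhds
  have hinit : ∀ ω, ∀ t ∈ Icc (-τ) 0, Y t ω = x₀ t := by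
    intro ω
    by_cases hω : ω ∈ G
    -- The value at `0` is obtained from the values on `[-τ, 0)` by continuity.
    · have hIco : EqOn (fun t => Y t ω) x₀ (Ico (-τ) 0) := fun t ht => by
        simp only [hYG ω hω, max_eq_left ht.1]
        exact (hGsub hω).2.1 t ht.1 ht.2
      have hcl : closure (Ico (-τ) 0) = Icc (-τ) 0 := closure_Ico (by linarith)
      intro t ht
      refine hIco.of_subset_closure (t := Icc (-τ) 0) (hcont ω).continuousOn hx₀
        Ico_subset_Icc_self (by rw [hcl]) ht
    · intro t ht
      rw [hYG' ω hω, min_eq_left ht.2, max_eq_left ht.1]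
  refine ⟨Y, (measurable_uncurry_of_continuous_of_measurable hcont hmeas), hcont, hinit, ?_⟩
  filter_upwards [hGae] with ω hω t ht
  rw [hYG ω hω, max_eq_left ht]

end Version

end
-- Transfer to the original formulation and the theorem
noncomputable section

variable {Ω : Type*} [MeasurableSpace Ω] {P : Measure Ω} [IsProbabilityMeasure P] {q : ℝ≥0∞}
  {τ : ℝ} {ν : Measure ℝ} [IsFiniteMeasure ν] {h b x₀ : ℝ → ℝ} {K H c : ℝ} {Z Y : ℝ → Ω → ℝ}

theorem IsSemilinearSolution.congr {η : SignedMeasure ℝ} {β β' N N' w : ℝ → ℝ}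
    (hw : IsSemilinearSolution τ η β N w) (hβ : ∀ v, 0 ≤ v → β v = β' v)
    (hN : ∀ t, 0 ≤ t → N t = N' t) : IsSemilinearSolution τ η β' N' w where
  cont := hw.cont
  init := hw.init
  eqn t ht := by
    rw [hw.eqn t ht, hN t ht]
    congr 1
    refine intervalIntegral.integral_congr fun u _ => ?_
    refine VectorMeasure.setIntegral_congr_fun fun r hr => ?_
    simp only [hβ _ (sub_nonneg.2 hr.2)]

theorem LpBdd.integral_rpow_le {p C : ℝ} (hp : 1 ≤ p) (hC : 0 ≤ C) {f : Ω → ℝ}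
    (hf : LpBdd P (ENNReal.ofReal p) f C) : ∫ ω, |f ω| ^ p ∂P ≤ C ^ p := by
  have hp0 : 0 < p := by linarith
  have h1 := hf.memLp.eLpNorm_eq_integral_rpow_norm (by simpa using hp0) ENNReal.ofReal_ne_top
  have h2 := hf.2
  rw [h1, ENNReal.toReal_ofReal hp0.le, ENNReal.ofReal_le_ofReal_iff hC] at h2
  simp only [Real.norm_eq_abs] at h2
  have h0 : 0 ≤ ∫ ω, |f ω| ^ p ∂P := integral_nonneg fun ω => by positivity
  calc ∫ ω, |f ω| ^ p ∂P = ((∫ ω, |f ω| ^ p ∂P) ^ p⁻¹) ^ p := by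
        rw [← Real.rpow_mul h0, inv_mul_cancel₀ hp0.ne', Real.rpow_one]
    _ ≤ C ^ p := Real.rpow_le_rpow (by positivity) h2 hp0.le

section Transfer

variable {η : SignedMeasure ℝ} (hην : ∀ (s : Set ℝ) (f : ℝ → ℝ), MeasurableSet s →
  (∫ᵛ r in s, f r ∂<•η) = ∫ r in s, h r * f r ∂ν)
include hην

theorem setIntegral_Icc_eq_integral (hh : IsDelayDensity τ ν h) {f g : ℝ → ℝ}
    (hfg : ∀ r ∈ Icc 0 τ, f r = g r) :
    (∫ᵛ r in Icc 0 τ, f r ∂<•η) = ∫ r, h r * g r ∂ν := by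
  rw [hην _ _ measurableSet_Icc, ← setIntegral_Icc_supp hh]
  exact setIntegral_congr_fun measurableSet_Icc fun r hr => by simp only [hfg r hr]

theorem limitForcing_eq_halfForcing (hh : IsDelayDensity τ ν h) {x y : ℝ → ℝ}
    (hxy : ∀ t, -τ ≤ t → x t = y t) {t : ℝ} (ht : 0 ≤ t) :
    limitForcing τ η b x t = halfForcing ν h (fun s => b (y s)) t := by
  unfold limitForcing halfForcing
  rw [setIntegral_Icc_eq_integral hην hh fun r hr => ?_]
  rw [hxy (t - r) (by linarith [hr.2]), hxy (-r) (by linarith [hr.2])]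

/-- The two expressions differ in the order of integration in `s` and `r`; Fubini applies as all
factors are bounded on `[0, t]`. -/
theorem biasTerm_eq_resolventInt (hh : IsDelayDensity τ ν h) {β : ℝ → ℝ} (hK : 0 ≤ K)
    (hβm : Measurable β) (hβ : ∀ v, 0 ≤ v → |β v| ≤ K) {x y : ℝ → ℝ}
    (hxy : ∀ t, -τ ≤ t → x t = y t) (hy : Continuous fun s => b (y s)) {Δ t : ℝ} (hΔ : 0 < Δ)
    (ht : 0 ≤ t) : biasTerm τ η b x (delayResolvent ν h β) Δ t =
      resolventInt ν h β (shiftForcing ν h Δ fun s => b (y s)) t := by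
  have hRm : Measurable fun s => delayResolvent ν h β t s :=
    (measurable_delayResolvent hh (S := Unit) (β := fun _ => β)
      (hβm.comp measurable_snd)).comp
      ((measurable_const (a := ())).prodMk ((measurable_const (a := t)).prodMk measurable_id))
  obtain ⟨C, hC⟩ := exists_bound_Icc hy (-τ) t
  have swap := integral_delay_swap (t := t)
    (F := fun s r => delayResolvent ν h β t s * (b (y (s - r)) - b (y (s - gridFloor Δ r))))
    (C := 2 * Real.exp (volterraRate ν K * t) * (2 * C)) hh
    ((hRm.comp measurable_fst).mul (measurable_shift_sub (Δ := Δ) hy.measurable)) ht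
    fun s hs r hr => by
      rw [abs_mul]
      exact mul_le_mul (abs_delayResolvent_le hh hK hβ le_rfl s)
        (abs_sub_le_two_mul (hC _ (shift_mem_Icc ⟨hs.1.le, hs.2⟩ hr))
          (hC _ (shift_gridFloor_mem_Icc hΔ ⟨hs.1.le, hs.2⟩ hr))) (abs_nonneg _) (by positivity)
  unfold biasTerm resolventInt shiftForcing
  rw [setIntegral_Icc_eq_integral hην hh (g := fun r => ∫ s in (0 : ℝ)..t,
    delayResolvent ν h β t s * (b (y (s - r)) - b (y (s - gridFloor Δ r)))) fun r hr => ?_, ← swap]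
  · refine intervalIntegral.integral_congr fun s _ => ?_
    simp only
    rw [← integral_const_mul]
    refine integral_congr_ae (Eventually.of_forall fun r => ?_)
    simp only
    ring
  · refine intervalIntegral.integral_congr fun s hs => ?_
    rw [uIcc_of_le ht] at hs
    rw [hxy _ (shift_mem_Icc hs hr).1, hxy _ (shift_gridFloor_mem_Icc hΔ hs hr).1]

end Transfer

end
theorem mainTheorem2 {Ω : Type*} [MeasurableSpace Ω] (P : Measure Ω) [IsProbabilityMeasure P]
    (τ : ℝ) (hτ : 0 < τ)
    (η : SignedMeasure ℝ)
    (hη : ∀ A : Set ℝ, MeasurableSet A → Disjoint A (Icc 0 τ) → η A = 0)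
    (b : ℝ → ℝ) (hb : ContDiff ℝ 2 b)
    (hb' : ∃ K : ℝ, ∀ x : ℝ, |deriv b x| ≤ K ∧ |deriv (deriv b) x| ≤ K)
    (x₀ : ℝ → ℝ) (hx₀ : ContDiffOn ℝ 1 x₀ (Icc (-τ) 0))
    (H c : ℝ) (hH : 1 / 2 < H) (hH1 : H < 1) (hc : 0 < c)
    (Z : ℝ → Ω → ℝ) (hZ : IsFractionalBrownianMotion H c Z P)
    (X : ℝ → Ω → ℝ) (hXm : ∀ t : ℝ, -τ ≤ t → AEMeasurable (X t) P)
    (hXc : ∀ᵐ ω ∂P, ContinuousOn (fun t => X t ω) (Ici (-τ)))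
    (hX : ∀ᵐ ω ∂P, IsDelaySolution τ η b x₀ (fun t => Z t ω) (fun t => X t ω))
    (Xn : ℕ → ℝ → Ω → ℝ)
    (hXn : ∀ n : ℕ, 1 ≤ n → ∀ᵐ ω ∂P,
      IsEulerScheme τ η b x₀ (fun t => Z t ω) (τ / n) (fun t => Xn n t ω)) :
    ∃ (R : Ω → ℝ → ℝ → ℝ) (W : ℝ → Ω → ℝ),
      (∀ᵐ ω ∂P,
        IsDifferentialResolvent η (fun s => deriv b (X s ω)) (R ω) ∧
        ∀ R' : ℝ → ℝ → ℝ, IsDifferentialResolvent η (fun s => deriv b (X s ω)) R' →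
          ∀ t s : ℝ, 0 ≤ t → 0 ≤ s → R' t s = R ω t s) ∧
      (∀ᵐ ω ∂P,
        IsSemilinearSolution τ η (fun s => deriv b (X s ω))
          (limitForcing τ η b (fun s => X s ω)) (fun t => W t ω) ∧
        ∀ w : ℝ → ℝ,
          IsSemilinearSolution τ η (fun s => deriv b (X s ω))
            (limitForcing τ η b (fun s => X s ω)) w →
          ∀ t : ℝ, -τ ≤ t → w t = W t ω) ∧
      ∀ t : ℝ, 0 < t → ∀ p : ℝ, 1 ≤ p →
        (∃ C : ℝ, 0 < C ∧ ∀ n : ℕ, 1 ≤ n →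
          MemLp (fun ω => X t ω - Xn n t ω) (ENNReal.ofReal p) P ∧
          ∫ ω, |X t ω - Xn n t ω| ^ p ∂P ≤ C * (τ / n) ^ p) ∧
        MemLp (W t) (ENNReal.ofReal p) P ∧
        (∀ n : ℕ, 1 ≤ n →
          MemLp (fun ω => biasTerm τ η b (fun s => X s ω) (R ω) (τ / n) t)
            (ENNReal.ofReal p) P) ∧
        Tendsto (fun n : ℕ => eLpNorm
          (fun ω => (1 / (τ / n)) *
            ((X t ω - Xn n t ω) - biasTerm τ η b (fun s => X s ω) (R ω) (τ / n) t) - W t ω)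
          (ENNReal.ofReal p) P) atTop (𝓝 0) := by
  obtain ⟨ν, h, hfin, hh, hην⟩ := exists_delayDensity τ η hη
  obtain ⟨K, hK⟩ := hb'
  have hK0 : 0 ≤ K := (abs_nonneg _).trans (hK 0).1
  obtain ⟨Y, hYm, hYc, hYi, hXY⟩ := exists_continuous_version hτ hx₀.continuousOn hXm hXc
    (hX.mono fun ω hω => hω.init)
  have hM : IsDelayModel P τ ν h b x₀ K H c Z Y :=
    { delay_pos := hτ
      density := hh
      contDiff := hb
      bound_nonneg := hK0
      abs_deriv_le := fun x => (hK x).1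
      abs_deriv_deriv_le := fun x => (hK x).2
      contDiffOn := hx₀
      half_lt := hH
      lt_one := hH1
      scale_pos := hc
      fbm := hZ
      measurable := hYm
      continuous := hYc
      init := hYi
      eqn := by
        filter_upwards [hX, hXY] with ω h1 h2 t ht
        rw [← h2 t (by linarith), h1.eqn t ht]
        congr 2
        refine intervalIntegral.integral_congr fun s hs => ?_
        rw [uIcc_of_le ht] at hs
        exact setIntegral_Icc_eq_integral hην hh fun r hr => by
          rw [h2 _ (shift_mem_Icc hs hr).1] }
  have hβ : ∀ ω v, 0 ≤ v → |deriv b (Y v ω)| ≤ K := fun ω v _ => (hK _).1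
  have hder : ∀ᵐ ω ∂P, ∀ v, 0 ≤ v → deriv b (X v ω) = deriv b (Y v ω) := by
    filter_upwards [hXY] with ω hω v hv
    rw [hω v (by linarith)]
  -- Both witnesses are built from the continuous version `Y`, hence measurable in `ω`. Almost
  -- surely `X` and `Y` agree at all times from `-τ` on, so the equations transfer to `X`.
  refine ⟨fun ω => delayResolvent ν h fun s => deriv b (Y s ω), limitPath ν h b Y, ?_, ?_,
    fun t ht p hp => ?_⟩
  · filter_upwards [hder] with ω hω
    refine ⟨(isDifferentialResolvent_delayResolvent hην hh hK0 (hM.measurable_deriv_path ω)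
      (hβ ω)).congr fun v hv => (hω v hv).symm, fun R' hR' t s ht hs => ?_⟩
    exact (hR'.congr hω).eq_delayResolvent hην hh hK0 (hM.measurable_deriv_path ω) (hβ ω) ht hs
  · filter_upwards [hder, hXY] with ω hω hxy
    have hN : ∀ t, 0 ≤ t → limitForcing τ η b (fun s => X s ω) t =
        halfForcing ν h (fun s => b (Y s ω)) t :=
      fun t ht => limitForcing_eq_halfForcing hην hh hxy ht
    have hNb := locBdd_halfForcing hh (hM.continuous_b_path ω)
    refine ⟨(isSemilinearSolution_volterraSol hην hh hK0 (hM.measurable_deriv_path ω) (hβ ω) hNb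
      (continuous_halfForcing hh (hM.continuous_b_path ω)).continuousOn).congr
      (fun v hv => (hω v hv).symm) fun t ht => (hN t ht).symm, fun w hw t ht => ?_⟩
    exact (hw.congr hω hN).eq_volterraSol hην hh hK0 (hM.measurable_deriv_path ω) (hβ ω) hNb ht
  have hq1 : 1 ≤ ENNReal.ofReal p := by simpa using hp
  have hqt : ENNReal.ofReal p ≠ ∞ := ENNReal.ofReal_ne_top
  have hbias : ∀ n : ℕ, 1 ≤ n → biasPath ν h b Y (τ / n) t =ᵐ[P] fun ω =>
      biasTerm τ η b (fun s => X s ω) (delayResolvent ν h fun s => deriv b (Y s ω)) (τ / n) t := by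
    intro n hn
    filter_upwards [hXY] with ω hω
    exact (biasTerm_eq_resolventInt hην hh hK0 (hM.measurable_deriv_path ω) (hβ ω) hω
      (hM.continuous_b_path ω) (hM.step_pos hn) ht.le).symm
  have hversion : ∀ n : ℕ, 1 ≤ n → ∃ V, IsEulerVersion P τ ν h b Y (τ / n) t V ∧
      (fun ω => Y t ω - V t ω) =ᵐ[P] fun ω => X t ω - Xn n t ω := by
    intro n hn
    obtain ⟨V, hV, hVX⟩ := hM.exists_eulerVersion hn t
      ((hXn n hn).mono fun ω hω => hω.init) ((hXn n hn).mono fun ω hω s hs => by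
        rw [hω.eqn s hs]
        congr 2
        exact intervalIntegral.integral_congr fun u _ =>
          setIntegral_Icc_eq_integral hην hh fun r _ => rfl)
    refine ⟨V, hV, ?_⟩
    filter_upwards [hXY, hVX] with ω h1 h2
    rw [h1 t (by linarith), h2 t ⟨by linarith, le_rfl⟩]
  refine ⟨?_, hM.memLp_limitPath hq1 hqt ht.le, fun n hn =>
    (hM.memLp_biasPath hq1 hqt (hM.step_pos hn) ht.le).ae_eq (hbias n hn), ?_⟩
  · obtain ⟨C, hC0, hC⟩ := hM.exists_lpBdd_euler hq1 hqt t
    -- The bound `C` may be `0`; adding `1` makes the constant strictly positive.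
    refine ⟨C ^ p + 1, by positivity, fun n hn => ?_⟩
    obtain ⟨V, hV, hVX⟩ := hversion n hn
    have hΔ := hM.step_pos hn
    have hb := (hC n hn V hV t ⟨by linarith, le_rfl⟩).congr hVX
    refine ⟨hb.memLp, (hb.integral_rpow_le hp (by positivity)).trans ?_⟩
    rw [Real.mul_rpow hC0 hΔ.le]
    have : 0 ≤ (τ / n) ^ p := by positivity
    linarith
  · rw [ENNReal.tendsto_nhds_zero]
    intro ε hε
    obtain ⟨δ, hδ0, hδ⟩ : ∃ δ : ℝ, 0 < δ ∧ ENNReal.ofReal δ ≤ ε := by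
      obtain ⟨δ, hδ0, hδ⟩ := ENNReal.lt_iff_exists_nnreal_btwn.1 hε
      exact ⟨δ, by exact_mod_cast hδ0, by simpa using hδ.le⟩
    filter_upwards [hM.eventually_lpBdd_limit hq1 hqt t hδ0, eventually_ge_atTop 1] with n h1 hn
    obtain ⟨V, hV, hVX⟩ := hversion n hn
    have hΔ := hM.step_pos hn
    have h2 := (h1 V hV t ⟨ht.le, le_rfl⟩).const_mul (1 / (τ / n))
    have h3 : |1 / (τ / (n : ℝ))| * (δ * (τ / n)) = δ := by
      rw [abs_of_pos (by positivity)]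
      field_simp
    rw [h3] at h2
    refine le_trans (le_of_eq (eLpNorm_congr_ae ?_)) (h2.2.trans hδ)
    filter_upwards [hVX, hbias n hn] with ω h4 h5
    rw [← h4, ← h5]
    field_simp
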